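/- Fix $m>0$, $\kappa_*>0$ and $x=(x_1,x_2)\in\mathbb R^2$. For integers $g\ge 1$ let $R=R_g>0$ be given by $\kappa_*=mg/R^2$, and consider those $g$ (all large enough ones) for which $|x|<R$. Let $(U_1,V_1),\dots,(U_g,V_g)$ be independent random points, each uniformly distributed in the disk $\{(u,v)\in\mathbb R^2: u^2+v^2\le R^2\}$, and set $$\Gamma^*_{1,g}(x)=\sum_{j=1}^g\frac{m\left((U_j-x_1)^2-(V_j-x_2)^2\right)}{\left[(U_j-x_1)^2+(V_j-x_2)^2\right]^2},\qquad \Gamma^*_{2,g}(x)=\sum_{j=1}^g\frac{2m(U_j-x_1)(V_j-x_2)}{\left[(U_j-x_1)^2+(V_j-x_2)^2\right]^2}.$$ Then for all sufficiently large $g$ the pair $(\Gamma^*_{1,g}(x),\Gamma^*_{2,g}(x))$ has a continuous probability density $f_g$ on $\mathbb R^2$, and, as $g\to\infty$, uniformly in $(z,w)\in\mathbb R^2$, with $\Gamma=\sqrt{z^2+w^2}$, $$f_g(z,w)=\frac{\kappa_*}{2\pi(\kappa_*^2+\Gamma^2)^{3/2}}\left[1+\frac{H_1(\Gamma)}{g}+\frac{H_2(\Gamma;|x|)}{g^2}\right]+O(g^{-3}),$$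 where $$H_1(\Gamma)=\kappa_*^2\,\frac{9\Gamma^2-6\kappa_*^2}{4(\kappa_*^2+\Gamma^2)^2},$$ $$H_2(\Gamma;|x|)=\frac{\kappa_*|x|^2}{m}\,\frac{\kappa_*^2(6\kappa_*^2-9\Gamma^2)}{2(\kappa_*^2+\Gamma^2)^2}-\frac{\kappa_*^2(8\kappa_*^4-24\kappa_*^2\Gamma^2+3\Gamma^4)}{4(\kappa_*^2+\Gamma^2)^3}+\frac{15\kappa_*^4(8\kappa_*^4-40\kappa_*^2\Gamma^2+15\Gamma^4)}{32(\kappa_*^2+\Gamma^2)^4}.$$ Moreover, for $i=1,2$ and all sufficiently large $g$, the component $\Gamma^*_{i,g}(x)$ has a continuous probability density $f_{i,g}$ on $\mathbb R$, equal almost everywhere to the corresponding marginal of $f_g$, and, as $g\to\infty$, uniformly in $a\in\mathbb R$, $$f_{i,g}(a)=\frac{\kappa_*}{\pi(\kappa_*^2+a^2)}\left[1+\frac{K_1(a^2)}{g}+\frac{K_2(a^2;|x|)}{g^2}\right]+O(g^{-3}),$$ where $$K_1(h)=\kappa_*^2\,\frac{3h-\kappa_*^2}{2(\kappa_*^2+h)^2},$$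 $$K_2(h;|x|)=\frac{\kappa_*|x|^2}{m}\,\frac{\kappa_*^2(\kappa_*^2-3h)}{(\kappa_*^2+h)^2}-\frac{\kappa_*^2}{2}\,\frac{\kappa_*^4-6\kappa_*^2h+h^2}{(\kappa_*^2+h)^3}+\frac{3\kappa_*^4}{4}\,\frac{\kappa_*^4-10\kappa_*^2h+5h^2}{(\kappa_*^2+h)^4}.$$ The constants in the $O(g^{-3})$ terms depend only on $m$, $\kappa_*$ and $x$. -/

import Mathlib

open MeasureTheory ProbabilityTheory Filter Topology

noncomputable section

/-- The Euclidean length `|x|` of a point of the plane (the norm of `ℝ × ℝ` is the sup norm). -/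
def planeNorm (x : ℝ × ℝ) : ℝ := Real.sqrt (x.1 ^ 2 + x.2 ^ 2)

/-- The closed Euclidean disk of radius `R` centered at the origin. -/
def disk (R : ℝ) : Set (ℝ × ℝ) := {p | p.1 ^ 2 + p.2 ^ 2 ≤ R ^ 2}

/-- First component of the shear at `x` due to stars of mass `m` at the positions `p j`. -/
def shear₁ (m : ℝ) (x : ℝ × ℝ) {g : ℕ} (p : Fin g → ℝ × ℝ) : ℝ :=
  ∑ j, m * (((p j).1 - x.1) ^ 2 - ((p j).2 - x.2) ^ 2) /
    (((p j).1 - x.1) ^ 2 + ((p j).2 - x.2) ^ 2) ^ 2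

/-- Second component of the shear at `x` due to stars of mass `m` at the positions `p j`. -/
def shear₂ (m : ℝ) (x : ℝ × ℝ) {g : ℕ} (p : Fin g → ℝ × ℝ) : ℝ :=
  ∑ j, 2 * m * ((p j).1 - x.1) * ((p j).2 - x.2) /
    (((p j).1 - x.1) ^ 2 + ((p j).2 - x.2) ^ 2) ^ 2

/-- `f` is a continuous probability density function of the measure `μ` with respect to Lebesgue
measure. On `ℝ` and `ℝ × ℝ` there is at most one such `f`, so its pointwise values are well defined. -/
def IsContinuousDensity {E : Type*} [MeasureSpace E] [TopologicalSpace E]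
    (μ : Measure E) (f : E → ℝ) : Prop :=
  Continuous f ∧ (∀ p, 0 ≤ f p) ∧ μ = volume.withDensity (fun p => ENNReal.ofReal (f p))

/-- The coefficient of `1 / g` in the joint expansion; `κ` is the optical depth in stars and `Γ`
the shear magnitude. -/
def H₁ (κ Γ : ℝ) : ℝ :=
  κ ^ 2 * (9 * Γ ^ 2 - 6 * κ ^ 2) / (4 * (κ ^ 2 + Γ ^ 2) ^ 2)

/-- The coefficient of `1 / g ^ 2` in the joint expansion; `n` is the mean number of stars
`κ |x|² / m` within the disc of radius `|x|`. -/
def H₂ (κ n Γ : ℝ) : ℝ :=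
  n * (κ ^ 2 * (6 * κ ^ 2 - 9 * Γ ^ 2) / (2 * (κ ^ 2 + Γ ^ 2) ^ 2))
    - κ ^ 2 * (8 * κ ^ 4 - 24 * κ ^ 2 * Γ ^ 2 + 3 * Γ ^ 4) / (4 * (κ ^ 2 + Γ ^ 2) ^ 3)
    + 15 * κ ^ 4 * (8 * κ ^ 4 - 40 * κ ^ 2 * Γ ^ 2 + 15 * Γ ^ 4) / (32 * (κ ^ 2 + Γ ^ 2) ^ 4)

/-- The coefficient of `1 / g` in the marginal expansions; `h` is the squared shear component. -/
def K₁ (κ h : ℝ) : ℝ :=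
  κ ^ 2 * (3 * h - κ ^ 2) / (2 * (κ ^ 2 + h) ^ 2)

/-- The coefficient of `1 / g ^ 2` in the marginal expansions; `n` is as in `H₂`. -/
def K₂ (κ n h : ℝ) : ℝ :=
  n * (κ ^ 2 * (κ ^ 2 - 3 * h) / (κ ^ 2 + h) ^ 2)
    - κ ^ 2 / 2 * ((κ ^ 4 - 6 * κ ^ 2 * h + h ^ 2) / (κ ^ 2 + h) ^ 3)
    + 3 * κ ^ 4 / 4 * ((κ ^ 4 - 10 * κ ^ 2 * h + 5 * h ^ 2) / (κ ^ 2 + h) ^ 4)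

/-- The three-term approximation of the joint p.d.f. as a function of the shear magnitude. -/
def jointApprox (κ n : ℝ) (g : ℕ) (Γ : ℝ) : ℝ :=
  κ / (2 * Real.pi * (κ ^ 2 + Γ ^ 2) ^ (3 / 2 : ℝ)) *
    (1 + H₁ κ Γ / (g : ℝ) + H₂ κ n Γ / (g : ℝ) ^ 2)

/-- The three-term approximation of the marginal p.d.f.s. -/
def marginalApprox (κ n : ℝ) (g : ℕ) (a : ℝ) : ℝ :=
  κ / (Real.pi * (κ ^ 2 + a ^ 2)) *
    (1 + K₁ κ (a ^ 2) / (g : ℝ) + K₂ κ n (a ^ 2) / (g : ℝ) ^ 2)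

end

/-!
The pair of shear components is treated as one complex random variable. A star at the position `w`
relative to the point `x`, in units of the radius `R` of the disk, contributes `κ / g` times
`shearKernel w = 1 / conj w ^ 2`, so by independence the characteristic function of the total shear
at `t` is `φ (κ t / g) ^ g`, where `φ` is the characteristic function of `starLaw y` with `y = x / R`
and `|y|² = n / g` for the fixed number `n = κ |x|² / m` (`charFun_complexShear`).

In polar coordinates about `x`, `φ s` is an average over the direction `θ` of integrals
`∫₀^ρ r exp (i u / r²) dr` with `u = |s| cos (2 θ - arg s)` and `ρ` the distance to the boundary of
the disk (`charFun_starLaw`). For small `s` each integral has a logarithmic and other anomalous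
terms, but averaging over the four directions that differ by right angles, for which `u` alternates
in sign and the product of opposite distances is `1 - |y|²`, leaves
`φ s = 1 - |s| + |s|² / (4 (1 - |y|²)²)` up to `O (|s|⁴ + |s|³ |y|²)`
(`norm_sum_rayIntegral_sub_le`, `norm_charFun_starLaw_sub_le`). The term `-|s|` is what makes the
limit law a Cauchy law. For large `s` an integration by parts gives `φ s = O (|s|^(-1/2))`
(`norm_charFun_starLaw_le`), and the doubling inequality `1 - |φ (2 s)|² ≤ 4 (1 - |φ s|²)` carries
this over to a bound `|φ| ≤ q < 1` away from the origin (`exists_norm_charFun_starLaw_le`).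

Raising to the power `g` with `T = g |s|`, one finds that `φ s ^ g` is `charApprox n g T`, that is
`exp (-T)` times a polynomial in `T`, up to `O (g⁻³)` times `(1 + T)⁻³`
(`exists_norm_charFun_starLaw_pow_sub_le`). This weight is integrable over the plane and over the
line, so the characteristic functions of the total shear and of its components are integrable.
A law with an integrable characteristic function has the inverse Fourier transform of that function
as a continuous density; the nonnegativity and the total mass come from smoothing with a Gaussian
(`eq_withDensity_charFunDensity`). Hence the densities differ uniformly by `O (g⁻³)` from the
Fourier transforms of the approximation (`abs_charFunDensity_sub_le`), which are elementary: on the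
line they are Laplace transforms of `t ^ k exp (-κ t)`, and in the plane the same integrated over
the direction, which leads to Legendre polynomials (`fourier_charApprox_real`,
`fourier_charApprox_complex`).
-/

/-! ### Densities from integrable characteristic functions -/

section CharFunDensity

open scoped FourierTransform RealInnerProductSpace

variable {E : Type*} [NormedAddCommGroup E] [InnerProductSpace ℝ E]

/-- The characteristic function in the normalization of Mathlib's Fourier transform: the value at
`t` is `∫ exp (2 π i ⟪x, t⟫) ∂μ`. -/
noncomputable def scaledCharFun [MeasurableSpace E] (μ : Measure E) (t : E) : ℂ :=
  charFun μ ((2 * Real.pi) • t)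

/-- The inverse Fourier transform of the characteristic function of `μ`. -/
noncomputable def charFunDensity [FiniteDimensional ℝ E] [MeasurableSpace E] [BorelSpace E]
    (μ : Measure E) (z : E) : ℝ := (𝓕 (scaledCharFun μ) z).re

/-- The Fourier transform of `t ↦ exp (-b ‖t‖ ^ 2)`, as a real function. -/
noncomputable def gaussianKernel (E : Type*) [NormedAddCommGroup E] [InnerProductSpace ℝ E] (b : ℝ)
    (w : E) : ℝ :=
  (Real.pi / b) ^ (Module.finrank ℝ E / 2 : ℝ) * Real.exp (-(Real.pi ^ 2 / b) * ‖w‖ ^ 2)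

lemma gaussianKernel_nonneg {b : ℝ} (hb : 0 < b) (w : E) : 0 ≤ gaussianKernel E b w := by
  unfold gaussianKernel; positivity

lemma continuous_gaussianKernel (b : ℝ) : Continuous (gaussianKernel E b) := by
  unfold gaussianKernel; fun_prop

variable [FiniteDimensional ℝ E] [MeasurableSpace E] [BorelSpace E]

lemma fourier_gaussian_eq_gaussianKernel {b : ℝ} (hb : 0 < b) (w : E) :
    𝓕 (fun v : E => Complex.exp (-(b : ℂ) * ‖v‖ ^ 2)) w = (gaussianKernel E b w : ℂ) := by
  rw [fourier_gaussian_innerProductSpace (by simpa using hb)]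
  unfold gaussianKernel
  rw [Complex.ofReal_mul, Complex.ofReal_cpow (by positivity)]
  push_cast
  congr 2
  ring

lemma integral_gaussianKernel {b : ℝ} (hb : 0 < b) : ∫ w : E, gaussianKernel E b w = 1 := by
  unfold gaussianKernel
  rw [integral_const_mul, GaussianFourier.integral_rexp_neg_mul_sq_norm (by positivity),
    ← Real.mul_rpow (by positivity) (by positivity)]
  have : Real.pi / b * (Real.pi / (Real.pi ^ 2 / b)) = 1 := by
    field_simp
  rw [this, Real.one_rpow]

lemma integrable_gaussianKernel {b : ℝ} (hb : 0 < b) : Integrable (gaussianKernel E b) := by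
  by_contra h
  have := integral_gaussianKernel (E := E) hb
  rw [integral_undef h] at this
  exact zero_ne_one this

lemma lintegral_gaussianKernel_sub {b : ℝ} (hb : 0 < b) (x : E) :
    ∫⁻ z : E, ENNReal.ofReal (gaussianKernel E b (z - x)) = 1 := by
  rw [lintegral_sub_right_eq_self (fun z => ENNReal.ofReal (gaussianKernel E b z)) x,
    ← ofReal_integral_eq_lintegral_ofReal (integrable_gaussianKernel hb)
      (ae_of_all _ (gaussianKernel_nonneg hb)), integral_gaussianKernel hb, ENNReal.ofReal_one]

lemma integrable_cexp_neg_mul_sq_norm {b : ℝ} (hb : 0 < b) :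
    Integrable (fun t : E => Complex.exp (-(b : ℂ) * ‖t‖ ^ 2)) := by
  have := GaussianFourier.integrable_cexp_neg_mul_sq_norm_add (V := E) (b := b)
    (by simpa using hb) 0 0
  simpa using this

lemma continuous_scaledCharFun (μ : Measure E) [IsFiniteMeasure μ] :
    Continuous (scaledCharFun μ) := by
  unfold scaledCharFun
  exact continuous_charFun.comp (continuous_const_smul _)

/-- Gaussian damping of the characteristic function smooths `μ` by convolution with a Gaussian. -/
lemma fourier_scaledCharFun_mul_gaussian (μ : Measure E) [IsProbabilityMeasure μ] {b : ℝ}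
    (hb : 0 < b) (z : E) :
    𝓕 (fun t : E => Complex.exp (-(b : ℂ) * ‖t‖ ^ 2) * scaledCharFun μ t) z =
      ((∫ x, gaussianKernel E b (z - x) ∂μ : ℝ) : ℂ) := by
  rw [← integral_complex_ofReal]
  simp_rw [← fourier_gaussian_eq_gaussianKernel hb, Real.fourier_eq', smul_eq_mul]
  rw [integral_integral_swap]
  · congr 1 with t
    rw [scaledCharFun, charFun_apply, ← mul_assoc, ← integral_const_mul]
    congr 1 with x
    rw [mul_right_comm, ← Complex.exp_add, inner_sub_right, inner_smul_right,
      real_inner_comm x t]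
    congr 2
    push_cast
    ring
  · have h1 : Integrable (fun p : E × E => Complex.exp (-(b : ℂ) * ‖p.2‖ ^ 2)) (μ.prod volume) := by
      have := (integrable_const (1 : ℂ) (μ := μ)).mul_prod
        (integrable_cexp_neg_mul_sq_norm (E := E) hb)
      simpa using this
    refine h1.mono (Continuous.aestronglyMeasurable (by fun_prop)) (ae_of_all _ fun p => ?_)
    simp only [Function.uncurry, norm_mul, Complex.norm_exp]
    simp

lemma tendsto_fourier_gaussian_regularization {F : E → ℂ} (hF : Integrable F) (z : E) :
    Tendsto (fun n : ℕ => 𝓕 (fun t : E => Complex.exp (-(((n : ℝ) + 1)⁻¹ : ℝ) * ‖t‖ ^ 2) * F t) z)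
      atTop (𝓝 (𝓕 F z)) := by
  simp_rw [Real.fourier_eq', smul_eq_mul]
  refine tendsto_integral_of_dominated_convergence (fun t => ‖F t‖) (fun n => ?_) hF.norm
    (fun n => ae_of_all _ fun t => ?_) (ae_of_all _ fun t => ?_)
  · exact (Continuous.aestronglyMeasurable (by fun_prop)).mul
      ((Continuous.aestronglyMeasurable (by fun_prop)).mul hF.1)
  · simp only [norm_mul, Complex.norm_exp]
    have : (0 : ℝ) < (n : ℝ) + 1 := by positivity
    have h2 : Real.exp ((-(((n : ℝ) + 1)⁻¹ : ℝ) * (‖t‖ : ℂ) ^ 2 : ℂ).re) ≤ 1 := by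
      rw [Real.exp_le_one_iff]
      norm_cast
      have : 0 ≤ ((n : ℝ) + 1)⁻¹ * ‖t‖ ^ 2 := by positivity
      simpa using this
    have h3 : ∀ u : ℝ, Real.exp ((u : ℂ) * Complex.I).re = 1 := by intro u; simp
    rw [h3, one_mul]
    exact mul_le_of_le_one_left (norm_nonneg _) h2
  · refine Tendsto.const_mul _ ?_
    have h : Tendsto (fun n : ℕ => (((n : ℝ) + 1)⁻¹ : ℝ)) atTop (𝓝 0) :=
      tendsto_inv_atTop_zero.comp
        (tendsto_atTop_add_const_right _ _ tendsto_natCast_atTop_atTop)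
    have h' : Tendsto (fun n : ℕ => Complex.exp (-(((n : ℝ) + 1)⁻¹ : ℝ) * ‖t‖ ^ 2)) atTop
        (𝓝 (Complex.exp (-((0 : ℝ) : ℂ) * ‖t‖ ^ 2))) :=
      (Complex.continuous_exp.tendsto _).comp
        ((((Complex.continuous_ofReal.tendsto _).comp h).neg).mul_const _)
    simpa using h'.mul_const (F t)

lemma continuous_fourier_of_integrable {F : E → ℂ} (hF : Integrable F) : Continuous (𝓕 F) :=
  VectorFourier.fourierIntegral_continuous Real.continuous_fourierChar continuous_inner hF

variable {μ : Measure E}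

lemma continuous_charFunDensity (hμ : Integrable (scaledCharFun μ)) :
    Continuous (charFunDensity μ) :=
  Complex.continuous_re.comp (continuous_fourier_of_integrable hμ)

variable [IsProbabilityMeasure μ]

lemma tendsto_integral_gaussianKernel (hμ : Integrable (scaledCharFun μ)) (z : E) :
    Tendsto (fun n : ℕ => ((∫ x, gaussianKernel E ((n : ℝ) + 1)⁻¹ (z - x) ∂μ : ℝ) : ℂ))
      atTop (𝓝 (𝓕 (scaledCharFun μ) z)) := by
  refine (tendsto_fourier_gaussian_regularization hμ z).congr fun n => ?_
  exact fourier_scaledCharFun_mul_gaussian μ (by positivity) z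

lemma tendsto_charFunDensity (hμ : Integrable (scaledCharFun μ)) (z : E) :
    Tendsto (fun n : ℕ => ∫ x, gaussianKernel E ((n : ℝ) + 1)⁻¹ (z - x) ∂μ)
      atTop (𝓝 (charFunDensity μ z)) := by
  have := (Complex.continuous_re.tendsto _).comp (tendsto_integral_gaussianKernel hμ z)
  exact this.congr fun n => by simp

lemma charFunDensity_nonneg (hμ : Integrable (scaledCharFun μ)) (z : E) :
    0 ≤ charFunDensity μ z :=
  ge_of_tendsto' (tendsto_charFunDensity hμ z) fun n =>
    integral_nonneg fun x => gaussianKernel_nonneg (by positivity) _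

lemma ofReal_charFunDensity (hμ : Integrable (scaledCharFun μ)) (z : E) :
    (charFunDensity μ z : ℂ) = 𝓕 (scaledCharFun μ) z :=
  tendsto_nhds_unique ((Complex.continuous_ofReal.tendsto _).comp (tendsto_charFunDensity hμ z))
    (tendsto_integral_gaussianKernel hμ z)

/-- Fatou's lemma for the Gaussian regularizations, each of which has total mass one. -/
lemma lintegral_charFunDensity_le (hμ : Integrable (scaledCharFun μ)) :
    ∫⁻ z, ENNReal.ofReal (charFunDensity μ z) ≤ 1 := by
  have hmass : ∀ n : ℕ, ∫⁻ z, ENNReal.ofReal (∫ x, gaussianKernel E ((n : ℝ) + 1)⁻¹ (z - x) ∂μ)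
      ≤ 1 := by
    intro n
    have hb : (0 : ℝ) < ((n : ℝ) + 1)⁻¹ := by positivity
    calc ∫⁻ z, ENNReal.ofReal (∫ x, gaussianKernel E ((n : ℝ) + 1)⁻¹ (z - x) ∂μ)
        ≤ ∫⁻ z, ∫⁻ x, ENNReal.ofReal (gaussianKernel E ((n : ℝ) + 1)⁻¹ (z - x)) ∂μ := by
          refine lintegral_mono fun z => ?_
          rw [integral_eq_lintegral_of_nonneg_ae
            (ae_of_all _ fun x => gaussianKernel_nonneg hb _)
            (Continuous.aestronglyMeasurable
              ((continuous_gaussianKernel _).comp (by fun_prop)))]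
          exact ENNReal.ofReal_toReal_le
      _ = ∫⁻ x, (∫⁻ z, ENNReal.ofReal (gaussianKernel E ((n : ℝ) + 1)⁻¹ (z - x))) ∂μ := by
          refine lintegral_lintegral_swap (Measurable.aemeasurable ?_)
          exact (ENNReal.continuous_ofReal.comp
            ((continuous_gaussianKernel _).comp (by fun_prop))).measurable
      _ = 1 := by simp [lintegral_gaussianKernel_sub hb]
  calc ∫⁻ z, ENNReal.ofReal (charFunDensity μ z)
      = ∫⁻ z, liminf (fun n : ℕ =>
          ENNReal.ofReal (∫ x, gaussianKernel E ((n : ℝ) + 1)⁻¹ (z - x) ∂μ)) atTop := by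
        refine lintegral_congr fun z => ?_
        exact (((ENNReal.continuous_ofReal.tendsto _).comp
          (tendsto_charFunDensity hμ z)).liminf_eq).symm
    _ ≤ liminf (fun n : ℕ => ∫⁻ z,
          ENNReal.ofReal (∫ x, gaussianKernel E ((n : ℝ) + 1)⁻¹ (z - x) ∂μ)) atTop := by
        refine lintegral_liminf_le fun n => ENNReal.measurable_ofReal.comp ?_
        have : StronglyMeasurable (fun p : E × E => gaussianKernel E ((n : ℝ) + 1)⁻¹ (p.1 - p.2)) :=
          ((continuous_gaussianKernel _).comp (by fun_prop)).stronglyMeasurable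
        exact this.integral_prod_right.measurable
    _ ≤ 1 := liminf_le_of_le (h := fun b hb => by
        obtain ⟨n, hn⟩ := hb.exists
        exact hn.trans (hmass n))

lemma integrable_charFunDensity (hμ : Integrable (scaledCharFun μ)) :
    Integrable (charFunDensity μ) := by
  refine ⟨(continuous_charFunDensity hμ).aestronglyMeasurable, ?_⟩
  rw [hasFiniteIntegral_iff_ofReal (ae_of_all _ (charFunDensity_nonneg hμ))]
  exact (lintegral_charFunDensity_le hμ).trans_lt ENNReal.one_lt_top

/-- A probability measure whose characteristic function is integrable has the inverse Fourier
transform of that function as its density. -/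
theorem eq_withDensity_charFunDensity (hμ : Integrable (scaledCharFun μ)) :
    μ = volume.withDensity (fun z => ENNReal.ofReal (charFunDensity μ z)) := by
  have hint := integrable_charFunDensity hμ
  have : IsFiniteMeasure (volume.withDensity (fun z => ENNReal.ofReal (charFunDensity μ z))) :=
    isFiniteMeasure_withDensity
      ((lintegral_charFunDensity_le hμ).trans_lt ENNReal.one_lt_top).ne
  have hfun : 𝓕 (scaledCharFun μ) = fun z => (charFunDensity μ z : ℂ) :=
    funext fun z => (ofReal_charFunDensity hμ z).symm
  have hinv := (continuous_scaledCharFun μ).fourierInv_fourier_eq hμ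
    (by rw [hfun]; exact hint.ofReal)
  refine Measure.ext_of_charFun ?_
  ext t
  have ht : charFun μ t = scaledCharFun μ ((2 * Real.pi)⁻¹ • t) := by
    rw [scaledCharFun, smul_smul, mul_inv_cancel₀ (by positivity), one_smul]
  rw [ht, ← congrFun hinv, hfun, Real.fourierInv_eq', charFun_apply,
    integral_withDensity_eq_integral_toReal_smul
      (f := fun z => ENNReal.ofReal (charFunDensity μ z))
      (ENNReal.measurable_ofReal.comp (continuous_charFunDensity hμ).measurable)
      (ae_of_all _ fun x => ENNReal.ofReal_lt_top)]
  congr 1 with x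
  rw [ENNReal.toReal_ofReal (charFunDensity_nonneg hμ x), smul_eq_mul, Complex.real_smul, mul_comm,
    inner_smul_right]
  congr 2
  push_cast
  field_simp

/-- If the characteristic function differs from `M` by at most `G`, the density differs from the
inverse Fourier transform of `M` by at most `∫ G`. -/
lemma abs_charFunDensity_sub_le (hμ : Integrable (scaledCharFun μ)) {M : E → ℂ} (hM : Integrable M)
    {G : E → ℝ} (hG : Integrable G) (h : ∀ t, ‖scaledCharFun μ t - M t‖ ≤ G t) {z : E} {a : ℝ}
    (ha : 𝓕 M z = a) : |charFunDensity μ z - a| ≤ ∫ t, G t := by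
  rw [← Real.norm_eq_abs, ← Complex.norm_real, Complex.ofReal_sub, ofReal_charFunDensity hμ, ← ha,
    Real.fourier_eq, Real.fourier_eq, ← integral_sub]
  · refine norm_integral_le_of_norm_le hG (ae_of_all _ fun t => ?_)
    rw [← smul_sub, Circle.norm_smul]
    exact h t
  · simpa using (Real.fourierIntegral_convergent_iff z).2 hμ
  · simpa using (Real.fourierIntegral_convergent_iff z).2 hM

end CharFunDensity

/-! ### Radial integrals -/

section Radial

open Set

lemma integral_Ioi_mul_one_sub_cos_mul_exp {y : ℝ} (hy : 0 < y) :
    IntegrableOn (fun v => y * ((1 - Real.cos v) * Real.exp (-(v * y)))) (Ioi 0) ∧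
      ∫ v in Ioi (0 : ℝ), y * ((1 - Real.cos v) * Real.exp (-(v * y))) = (1 + y ^ 2)⁻¹ := by
  set a : ℂ := -y with ha
  set b : ℂ := -y + Complex.I with hb
  have ha' : a.re < 0 := by simpa [ha] using hy
  have hb' : b.re < 0 := by simpa [hb] using hy
  have hI1 := (integrableOn_exp_mul_complex_Ioi ha' 0).re
  have hI2 := (integrableOn_exp_mul_complex_Ioi hb' 0).re
  have e1 : ∀ v : ℝ, RCLike.re (Complex.exp (a * v)) = Real.exp (-(v * y)) := by
    intro v
    simp [ha, Complex.exp_re, mul_comm]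
  have e2 : ∀ v : ℝ, RCLike.re (Complex.exp (b * v)) = Real.exp (-(v * y)) * Real.cos v := by
    intro v
    simp [hb, Complex.exp_re, mul_comm]
  have hfun : (fun v : ℝ => y * ((1 - Real.cos v) * Real.exp (-(v * y)))) =
      fun v : ℝ => y * (RCLike.re (Complex.exp (a * v)) - RCLike.re (Complex.exp (b * v))) := by
    ext v; rw [e1, e2]; ring
  rw [hfun]
  refine ⟨(hI1.sub hI2).const_mul y, ?_⟩
  have v1 := integral_exp_mul_complex_Ioi ha' 0
  have v2 := integral_exp_mul_complex_Ioi hb' 0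
  rw [integral_const_mul, integral_sub hI1 hI2,
    integral_re (integrableOn_exp_mul_complex_Ioi ha' 0),
    integral_re (integrableOn_exp_mul_complex_Ioi hb' 0), v1, v2]
  have hy2 : y ^ 2 + 1 ≠ 0 := by positivity
  simp [ha, hb, Complex.div_re, Complex.normSq_apply]
  field_simp
  ring

lemma integral_Ioi_mul_exp_neg_mul {v : ℝ} (hv : 0 < v) :
    IntegrableOn (fun y => y * Real.exp (-(v * y))) (Ioi 0) ∧
      ∫ y in Ioi (0 : ℝ), y * Real.exp (-(v * y)) = (v ^ 2)⁻¹ := by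
  have h := Real.integral_rpow_mul_exp_neg_mul_Ioi (a := 2) (by norm_num) hv
  have h2 : ∫ y in Ioi (0 : ℝ), y * Real.exp (-(v * y)) = (v ^ 2)⁻¹ := by
    norm_num at h
    simpa using h
  refine ⟨?_, h2⟩
  by_contra hn
  rw [integral_undef hn] at h2
  have : (v ^ 2)⁻¹ ≠ 0 := by positivity
  exact this h2.symm

/-- `∫₀^∞ (1 - cos v) / v² dv = π / 2`, by writing `1 / v² = ∫₀^∞ y exp (-v y) dy` and exchanging
the integrals. -/
lemma lintegral_one_sub_cos_div_sq :
    ∫⁻ v in Ioi (0 : ℝ), ENNReal.ofReal ((1 - Real.cos v) / v ^ 2) =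
      ENNReal.ofReal (Real.pi / 2) := by
  have hc : ∀ v : ℝ, 0 ≤ 1 - Real.cos v := fun v => by linarith [Real.cos_le_one v]
  calc ∫⁻ v in Ioi (0 : ℝ), ENNReal.ofReal ((1 - Real.cos v) / v ^ 2)
      = ∫⁻ v in Ioi (0 : ℝ), ∫⁻ y in Ioi (0 : ℝ),
          ENNReal.ofReal (y * ((1 - Real.cos v) * Real.exp (-(v * y)))) := by
        refine setLIntegral_congr_fun measurableSet_Ioi fun v (hv : 0 < v) => ?_
        obtain ⟨hi, he⟩ := integral_Ioi_mul_exp_neg_mul hv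
        have : ∀ y : ℝ, y * ((1 - Real.cos v) * Real.exp (-(v * y))) =
            (1 - Real.cos v) * (y * Real.exp (-(v * y))) := fun y => by ring
        simp_rw [this]
        rw [← ofReal_integral_eq_lintegral_ofReal (hi.const_mul _), integral_const_mul, he,
          div_eq_mul_inv]
        filter_upwards [ae_restrict_mem measurableSet_Ioi] with y (hy : 0 < y)
        exact mul_nonneg (hc v) (by positivity)
    _ = ∫⁻ y in Ioi (0 : ℝ), ∫⁻ v in Ioi (0 : ℝ),
          ENNReal.ofReal (y * ((1 - Real.cos v) * Real.exp (-(v * y)))) := by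
        refine lintegral_lintegral_swap (Measurable.aemeasurable ?_)
        exact ENNReal.measurable_ofReal.comp (Continuous.measurable (by fun_prop))
    _ = ∫⁻ y in Ioi (0 : ℝ), ENNReal.ofReal ((1 + y ^ 2)⁻¹) := by
        refine setLIntegral_congr_fun measurableSet_Ioi fun y (hy : 0 < y) => ?_
        obtain ⟨hi, he⟩ := integral_Ioi_mul_one_sub_cos_mul_exp hy
        rw [← ofReal_integral_eq_lintegral_ofReal hi, he]
        exact ae_of_all _ fun v => mul_nonneg hy.le (mul_nonneg (hc v) (Real.exp_pos _).le)
    _ = ENNReal.ofReal (Real.pi / 2) := by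
        rw [← ofReal_integral_eq_lintegral_ofReal integrable_inv_one_add_sq.integrableOn
          (ae_of_all _ fun y => by positivity), integral_Ioi_inv_one_add_sq]
        simp

lemma integral_one_sub_cos_div_sq :
    IntegrableOn (fun v => (1 - Real.cos v) / v ^ 2) (Ioi 0) ∧
      ∫ v in Ioi (0 : ℝ), (1 - Real.cos v) / v ^ 2 = Real.pi / 2 := by
  have hc : ∀ v : ℝ, 0 ≤ (1 - Real.cos v) / v ^ 2 := fun v => by
    have := Real.cos_le_one v
    exact div_nonneg (by linarith) (sq_nonneg v)
  have hm : Measurable (fun v : ℝ => (1 - Real.cos v) / v ^ 2) := by fun_prop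
  constructor
  · refine ⟨hm.aestronglyMeasurable, ?_⟩
    rw [hasFiniteIntegral_iff_ofReal (ae_of_all _ hc), lintegral_one_sub_cos_div_sq]
    exact ENNReal.ofReal_lt_top
  · rw [integral_eq_lintegral_of_nonneg_ae (ae_of_all _ hc) hm.aestronglyMeasurable,
      lintegral_one_sub_cos_div_sq, ENNReal.toReal_ofReal (by positivity)]

lemma integral_Ioi_mul_one_sub_cos_div_sq_one :
    IntegrableOn (fun r => r * (1 - Real.cos (1 / r ^ 2))) (Ioi 0) ∧
      ∫ r in Ioi (0 : ℝ), r * (1 - Real.cos (1 / r ^ 2)) = Real.pi / 4 := by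
  obtain ⟨hi, he⟩ := integral_one_sub_cos_div_sq
  have hp : (-2 : ℝ) ≠ 0 := by norm_num
  have key : ∀ r ∈ Ioi (0 : ℝ), (|(-2 : ℝ)| * r ^ ((-2 : ℝ) - 1)) •
      ((1 - Real.cos (r ^ (-2 : ℝ))) / (r ^ (-2 : ℝ)) ^ 2) =
        2 * (r * (1 - Real.cos (1 / r ^ 2))) := by
    intro r (hr : 0 < r)
    have h1 : r ^ (-2 : ℝ) = 1 / r ^ 2 := by
      rw [Real.rpow_neg hr.le, one_div]; norm_cast
    have h2 : r ^ ((-2 : ℝ) - 1) = 1 / r ^ 3 := by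
      rw [show (-2 : ℝ) - 1 = -3 by norm_num, Real.rpow_neg hr.le, one_div]; norm_cast
    rw [h1, h2, smul_eq_mul, abs_of_neg (by norm_num)]
    field_simp
  constructor
  · have := (integrableOn_Ioi_comp_rpow_iff (fun v => (1 - Real.cos v) / v ^ 2) hp).2 hi
    have h2 := (this.congr_fun key measurableSet_Ioi).const_mul (1 / 2)
    refine IntegrableOn.congr_fun h2 (fun r _ => ?_) measurableSet_Ioi
    ring
  · have := integral_comp_rpow_Ioi (fun v => (1 - Real.cos v) / v ^ 2) hp
    rw [setIntegral_congr_fun measurableSet_Ioi key, integral_const_mul, he] at this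
    linarith

lemma integral_Ioi_mul_one_sub_cos_div_sq (u : ℝ) :
    IntegrableOn (fun r => r * (1 - Real.cos (u / r ^ 2))) (Ioi 0) ∧
      ∫ r in Ioi (0 : ℝ), r * (1 - Real.cos (u / r ^ 2)) = Real.pi * |u| / 4 := by
  rcases eq_or_ne u 0 with rfl | hu
  · simp
  have hu' : 0 < |u| := abs_pos.2 hu
  have hs : 0 < √|u| := Real.sqrt_pos.2 hu'
  obtain ⟨hi, he⟩ := integral_Ioi_mul_one_sub_cos_div_sq_one
  set f : ℝ → ℝ := fun r => r * (1 - Real.cos (1 / r ^ 2)) with hf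
  have key : ∀ r : ℝ, √|u| * f ((√|u|)⁻¹ * r) = r * (1 - Real.cos (u / r ^ 2)) := by
    intro r
    have h1 : 1 / ((√|u|)⁻¹ * r) ^ 2 = |u| / r ^ 2 := by
      rw [mul_pow, inv_pow, Real.sq_sqrt hu'.le, one_div, mul_inv, inv_inv, div_eq_mul_inv]
    have h2 : Real.cos (|u| / r ^ 2) = Real.cos (u / r ^ 2) := by
      rcases abs_choice u with h | h <;> rw [h]
      rw [neg_div, Real.cos_neg]
    simp only [hf]
    rw [h1, h2]
    field_simp
  constructor
  · have := (integrableOn_Ioi_comp_mul_left_iff f 0 (inv_pos.2 hs)).2 (by simpa using hi)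
    have h2 := this.const_mul (√|u|)
    simp_rw [key] at h2
    exact h2
  · have := integral_comp_mul_left_Ioi f 0 (inv_pos.2 hs)
    simp_rw [← key, integral_const_mul]
    rw [this, mul_zero, he, inv_inv, smul_eq_mul, ← mul_assoc, Real.mul_self_sqrt hu'.le]
    ring

lemma integral_Ioi_one_div_pow {ρ : ℝ} (hρ : 0 < ρ) (n : ℕ) :
    IntegrableOn (fun r : ℝ => 1 / r ^ (n + 2)) (Ioi ρ) ∧
      ∫ r in Ioi ρ, 1 / r ^ (n + 2) = 1 / ((n + 1) * ρ ^ (n + 1)) := by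
  have hlt : (-(n + 2 : ℝ)) < -1 := by
    have : (0 : ℝ) ≤ n := n.cast_nonneg
    linarith
  have key : ∀ r ∈ Ioi ρ, r ^ (-(n + 2 : ℝ)) = 1 / r ^ (n + 2) := by
    intro r (hr : ρ < r)
    rw [Real.rpow_neg (hρ.trans hr).le, one_div]; norm_cast
  constructor
  · exact (integrableOn_Ioi_rpow_of_lt hlt hρ).congr_fun key measurableSet_Ioi
  · have h := integral_Ioi_rpow_of_lt hlt hρ
    rw [setIntegral_congr_fun measurableSet_Ioi key] at h
    rw [h, show (-(n + 2 : ℝ)) + 1 = -(n + 1 : ℝ) by ring, Real.rpow_neg hρ.le,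
      show (n + 1 : ℝ) = ((n + 1 : ℕ) : ℝ) by push_cast; ring, Real.rpow_natCast]
    field_simp

/-- The tail of the radial integral, to second order in `u`. -/
lemma abs_integral_Ioi_mul_one_sub_cos_sub_le {u ρ : ℝ} (hρ : 0 < ρ) (hu : |u| ≤ ρ ^ 2) :
    |(∫ r in Ioi ρ, r * (1 - Real.cos (u / r ^ 2))) - u ^ 2 / (4 * ρ ^ 2)| ≤ u ^ 4 / ρ ^ 6 := by
  obtain ⟨h3, e3⟩ := integral_Ioi_one_div_pow hρ 1
  obtain ⟨h7, e7⟩ := integral_Ioi_one_div_pow hρ 5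
  have hi := (integral_Ioi_mul_one_sub_cos_div_sq u).1.mono_set (Ioi_subset_Ioi hρ.le)
  have e : u ^ 2 / (4 * ρ ^ 2) = ∫ r in Ioi ρ, u ^ 2 / 2 * (1 / r ^ (1 + 2)) := by
    rw [integral_const_mul, e3]; norm_num; field_simp; norm_num
  rw [e, ← integral_sub hi (h3.const_mul _), ← Real.norm_eq_abs]
  calc ‖∫ r in Ioi ρ, (r * (1 - Real.cos (u / r ^ 2)) - u ^ 2 / 2 * (1 / r ^ (1 + 2)))‖
      ≤ ∫ r in Ioi ρ, u ^ 4 * (1 / r ^ (5 + 2)) := by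
        refine norm_integral_le_of_norm_le (h7.const_mul _) ?_
        filter_upwards [ae_restrict_mem measurableSet_Ioi] with r (hr : ρ < r)
        have hr0 : 0 < r := hρ.trans hr
        have hle : |u / r ^ 2| ≤ 1 := by
          rw [abs_div, abs_of_pos (by positivity : 0 < r ^ 2), div_le_one (by positivity)]
          exact hu.trans (by gcongr)
        have hcos := Real.cos_bound hle
        have habs : |u / r ^ 2| ^ 4 = u ^ 4 / r ^ 8 := by
          rw [show |u / r ^ 2| ^ 4 = (|u / r ^ 2| ^ 2) ^ 2 by ring, sq_abs]
          field_simp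
        rw [habs] at hcos
        have : r * (1 - Real.cos (u / r ^ 2)) - u ^ 2 / 2 * (1 / r ^ (1 + 2)) =
            -(r * (Real.cos (u / r ^ 2) - (1 - (u / r ^ 2) ^ 2 / 2))) := by
          field_simp
          ring
        rw [this, norm_neg, norm_mul, Real.norm_eq_abs, Real.norm_eq_abs, abs_of_pos hr0]
        calc r * |Real.cos (u / r ^ 2) - (1 - (u / r ^ 2) ^ 2 / 2)|
            ≤ r * (u ^ 4 / r ^ 8 * (5 / 96)) := by gcongr
          _ = (5 / 96) * (u ^ 4 * (1 / r ^ (5 + 2))) := by field_simp; ring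
          _ ≤ u ^ 4 * (1 / r ^ (5 + 2)) := by
            have : 0 ≤ u ^ 4 * (1 / r ^ (5 + 2)) := by positivity
            linarith
    _ ≤ u ^ 4 / ρ ^ 6 := by
        rw [integral_const_mul, e7]
        have h : u ^ 4 * (1 / (((5 : ℕ) + 1) * ρ ^ (5 + 1))) = (u ^ 4 / ρ ^ 6) / 6 := by
          norm_num; ring
        have h0 : 0 ≤ u ^ 4 / ρ ^ 6 := by positivity
        rw [h]; linarith

/-- The contribution of a ray of length `ρ` to the characteristic function of one star:
`∫₀^ρ r exp (i u / r²) dr`. -/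
noncomputable def rayIntegral (u ρ : ℝ) : ℂ :=
  ∫ r in (0 : ℝ)..ρ, (r : ℂ) * Complex.exp ((u / r ^ 2 : ℝ) * Complex.I)

lemma norm_cexp_ofReal_mul_I_mul (r v : ℝ) :
    ‖(r : ℂ) * Complex.exp ((v : ℝ) * Complex.I)‖ = |r| := by
  rw [norm_mul, Complex.norm_exp_ofReal_mul_I, mul_one, Complex.norm_real, Real.norm_eq_abs]

lemma intervalIntegrable_ray (u a b : ℝ) :
    IntervalIntegrable (fun r : ℝ => (r : ℂ) * Complex.exp ((u / r ^ 2 : ℝ) * Complex.I))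
      volume a b := by
  have h : IntervalIntegrable (fun r : ℝ => (r : ℂ)) volume a b :=
    (Complex.continuous_ofReal).intervalIntegrable a b
  refine h.mono_fun (Measurable.aestronglyMeasurable (by fun_prop)) (ae_of_all _ fun r => ?_)
  exact (norm_cexp_ofReal_mul_I_mul _ _).trans_le (by simp)

lemma re_rayIntegral (u ρ : ℝ) :
    (rayIntegral u ρ).re = ∫ r in (0 : ℝ)..ρ, r * Real.cos (u / r ^ 2) := by
  have h := Complex.reCLM.intervalIntegral_comp_comm (intervalIntegrable_ray u 0 ρ)
  simp only [Complex.reCLM_apply] at h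
  rw [rayIntegral, ← h]
  congr 1 with r
  rw [Complex.re_ofReal_mul, Complex.exp_ofReal_mul_I_re]

lemma im_rayIntegral (u ρ : ℝ) :
    (rayIntegral u ρ).im = ∫ r in (0 : ℝ)..ρ, r * Real.sin (u / r ^ 2) := by
  have h := Complex.imCLM.intervalIntegral_comp_comm (intervalIntegrable_ray u 0 ρ)
  simp only [Complex.imCLM_apply] at h
  rw [rayIntegral, ← h]
  congr 1 with r
  rw [Complex.im_ofReal_mul, Complex.exp_ofReal_mul_I_im]

lemma norm_rayIntegral_le {u ρ : ℝ} (hρ : 0 ≤ ρ) : ‖rayIntegral u ρ‖ ≤ ρ ^ 2 / 2 := by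
  have := intervalIntegral.norm_integral_le_of_norm_le (μ := volume) (a := 0) (b := ρ) hρ
    (f := fun r : ℝ => (r : ℂ) * Complex.exp ((u / r ^ 2 : ℝ) * Complex.I)) (g := fun r => r)
    (ae_of_all _ fun r hr => by
      rw [norm_cexp_ofReal_mul_I_mul, abs_of_pos hr.1]) (continuous_id.intervalIntegrable _ _)
  simpa [rayIntegral] using this

/-- Integration by parts against the phase: the derivative of `r ^ 4 exp (i u / r²)` is
`4 r³ exp (i u / r²) - 2 i u r exp (i u / r²)`. -/
lemma abs_mul_norm_rayIntegral_le {u ρ : ℝ} (hρ : 0 ≤ ρ) : |u| * ‖rayIntegral u ρ‖ ≤ ρ ^ 4 := by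
  set e : ℝ → ℂ := fun r => Complex.exp ((u / r ^ 2 : ℝ) * Complex.I) with he
  have hen : ∀ r, ‖e r‖ = 1 := fun r => Complex.norm_exp_ofReal_mul_I _
  have hem : Measurable e := by simp only [he]; fun_prop
  have hI : ∀ n : ℕ, IntervalIntegrable (fun r : ℝ => (r : ℂ) ^ n * e r) volume 0 ρ := by
    intro n
    have h : IntervalIntegrable (fun r : ℝ => (r : ℂ) ^ n) volume 0 ρ :=
      (Complex.continuous_ofReal.pow n).intervalIntegrable _ _
    refine h.mono_fun (Measurable.aestronglyMeasurable (by fun_prop)) (ae_of_all _ fun r => ?_)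
    simp only [norm_mul, hen, mul_one, le_refl]
  have hcont : ContinuousOn (fun r : ℝ => (r : ℂ) ^ 4 * e r) (Icc 0 ρ) := by
    intro r hr
    rcases hr.1.eq_or_lt with h0 | h0
    · subst h0
      refine ContinuousAt.continuousWithinAt ?_
      have : Tendsto (fun r : ℝ => (r : ℂ) ^ 4 * e r) (𝓝 0) (𝓝 0) := by
        refine squeeze_zero_norm (a := fun r : ℝ => |r| ^ 4) (fun r => ?_) ?_
        · rw [norm_mul, hen, mul_one, norm_pow, Complex.norm_real, Real.norm_eq_abs]
        · have : Continuous fun r : ℝ => |r| ^ 4 := by fun_prop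
          simpa using this.tendsto 0
      simpa [ContinuousAt] using this
    · refine ContinuousAt.continuousWithinAt ?_
      have : (r : ℝ) ^ 2 ≠ 0 := by positivity
      simp only [he]
      fun_prop (disch := assumption)
  have hder : ∀ r ∈ Ioo 0 ρ, HasDerivAt (fun r : ℝ => (r : ℂ) ^ 4 * e r)
      (4 * ((r : ℂ) ^ 3 * e r) - 2 * u * Complex.I * ((r : ℂ) ^ 1 * e r)) r := by
    intro r hr
    have hr0 : r ≠ 0 := hr.1.ne'
    have h1 : HasDerivAt (fun r : ℝ => u / r ^ 2) (-(2 * u / r ^ 3)) r := by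
      have := ((hasDerivAt_pow 2 r).inv (by positivity)).const_mul u
      convert! this using 1
      field_simp
      ring
    have h2 : HasDerivAt e (e r * (((-(2 * u / r ^ 3) : ℝ) : ℂ) * Complex.I)) r :=
      (h1.ofReal_comp.mul_const Complex.I).cexp
    have h3 : HasDerivAt (fun r : ℝ => (r : ℂ) ^ 4) (4 * (r : ℂ) ^ 3) r := by
      have := (hasDerivAt_pow 4 (r : ℂ)).comp_ofReal
      simpa using this
    convert! h3.mul h2 using 1
    have : (r : ℂ) ≠ 0 := by exact_mod_cast hr0
    push_cast
    field_simp
    ring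
  have hFTC := intervalIntegral.integral_eq_sub_of_hasDerivAt_of_le hρ hcont hder
    (((hI 3).const_mul 4).sub ((hI 1).const_mul (2 * u * Complex.I)))
  rw [intervalIntegral.integral_sub ((hI 3).const_mul 4) ((hI 1).const_mul _),
    intervalIntegral.integral_const_mul, intervalIntegral.integral_const_mul] at hFTC
  have hray : rayIntegral u ρ = ∫ r in (0 : ℝ)..ρ, (r : ℂ) ^ 1 * e r := by
    simp [rayIntegral, he]
  rw [← hray] at hFTC
  have h3 : ‖∫ r in (0 : ℝ)..ρ, (r : ℂ) ^ 3 * e r‖ ≤ ρ ^ 4 / 4 := by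
    have := intervalIntegral.norm_integral_le_of_norm_le (μ := volume) (a := 0) (b := ρ) hρ
      (f := fun r : ℝ => (r : ℂ) ^ 3 * e r) (g := fun r => r ^ 3)
      (ae_of_all _ fun r hr => by
        rw [norm_mul, hen, mul_one, norm_pow, Complex.norm_real, Real.norm_eq_abs,
          abs_of_pos hr.1]) ((continuous_pow 3).intervalIntegrable _ _)
    norm_num at this
    exact this
  have h4 : 2 * u * Complex.I * rayIntegral u ρ =
      4 * (∫ r in (0 : ℝ)..ρ, (r : ℂ) ^ 3 * e r) - (ρ : ℂ) ^ 4 * e ρ := by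
    rw [Complex.ofReal_zero, zero_pow (by norm_num), zero_mul, sub_zero] at hFTC
    linear_combination -hFTC
  have h5 : ‖2 * u * Complex.I * rayIntegral u ρ‖ = 2 * (|u| * ‖rayIntegral u ρ‖) := by
    simp [mul_assoc]
  have h6 : ‖(ρ : ℂ) ^ 4 * e ρ‖ = ρ ^ 4 := by
    rw [norm_mul, hen, mul_one, norm_pow, Complex.norm_real, Real.norm_eq_abs, abs_of_nonneg hρ]
  have h7 : ‖(4 : ℂ) * (∫ r in (0 : ℝ)..ρ, (r : ℂ) ^ 3 * e r)‖ ≤ ρ ^ 4 := by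
    rw [norm_mul]; norm_num; linarith
  have := norm_sub_le (4 * (∫ r in (0 : ℝ)..ρ, (r : ℂ) ^ 3 * e r)) ((ρ : ℂ) ^ 4 * e ρ)
  rw [← h4, h5, h6] at this
  linarith

/-- The decay of the ray integral in a form that keeps its angular average elementary. -/
lemma norm_rayIntegral_le_div {u ρ lam : ℝ} (hρ : 0 ≤ ρ) (hρ2 : ρ ≤ 2) (hlam : 0 < lam) :
    ‖rayIntegral u ρ‖ ≤ 9 * (lam + lam⁻¹ * (1 + u ^ 2)⁻¹) := by
  have h1 := norm_rayIntegral_le (u := u) hρ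
  have h2 := abs_mul_norm_rayIntegral_le (u := u) hρ
  have h3 : ‖rayIntegral u ρ‖ * (1 + |u|) ≤ 18 := by
    have : ρ ^ 2 ≤ 4 := by nlinarith
    have : ρ ^ 4 ≤ 16 := by nlinarith [sq_nonneg ρ]
    nlinarith
  set N := ‖rayIntegral u ρ‖ with hN
  have hN0 : 0 ≤ N := norm_nonneg _
  have h4 : N ^ 2 * (1 + u ^ 2) ≤ 18 ^ 2 := by
    have e : 1 + u ^ 2 ≤ (1 + |u|) ^ 2 := by nlinarith [abs_nonneg u, sq_abs u]
    calc N ^ 2 * (1 + u ^ 2) ≤ N ^ 2 * (1 + |u|) ^ 2 := by gcongr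
      _ = (N * (1 + |u|)) ^ 2 := by ring
      _ ≤ 18 ^ 2 := by gcongr
  have hpos : 0 < 1 + u ^ 2 := by positivity
  -- `2 * N ≤ 18 * lam + N ^ 2 / (18 * lam)`, by the arithmetic-geometric mean inequality.
  have h5 : N ^ 2 ≤ 18 ^ 2 * (1 + u ^ 2)⁻¹ := by
    rw [← div_eq_mul_inv, le_div_iff₀ hpos]; exact h4
  have h6 : 2 * N ≤ 18 * lam + N ^ 2 * (18 * lam)⁻¹ := by
    have : 0 ≤ (18 * lam - N) ^ 2 * (18 * lam)⁻¹ := by positivity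
    have e : (18 * lam - N) ^ 2 * (18 * lam)⁻¹ = 18 * lam - 2 * N + N ^ 2 * (18 * lam)⁻¹ := by
      field_simp
      ring
    linarith
  have h7 : N ^ 2 * (18 * lam)⁻¹ ≤ 18 ^ 2 * (1 + u ^ 2)⁻¹ * (18 * lam)⁻¹ := by gcongr
  have e : 18 ^ 2 * (1 + u ^ 2)⁻¹ * (18 * lam)⁻¹ = 18 * (lam⁻¹ * (1 + u ^ 2)⁻¹) := by
    field_simp
  linarith

end Radial

section RadialExpansion

open Set

lemma abs_re_rayIntegral_sub_le {u ρ : ℝ} (hρ : 0 < ρ) (hu : |u| ≤ ρ ^ 2) :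
    |(rayIntegral u ρ).re - (ρ ^ 2 / 2 - Real.pi * |u| / 4 + u ^ 2 / (4 * ρ ^ 2))| ≤
      u ^ 4 / ρ ^ 6 := by
  obtain ⟨hi, he⟩ := integral_Ioi_mul_one_sub_cos_div_sq u
  have hsplit := setIntegral_union (μ := volume) (Ioc_disjoint_Ioi le_rfl) measurableSet_Ioi
    (hi.mono_set (Ioc_subset_Ioi_self : Ioc 0 ρ ⊆ Ioi 0)) (hi.mono_set (Ioi_subset_Ioi hρ.le))
  rw [Ioc_union_Ioi_eq_Ioi hρ.le, he] at hsplit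
  have hre : (rayIntegral u ρ).re =
      ρ ^ 2 / 2 - ∫ r in Ioc 0 ρ, r * (1 - Real.cos (u / r ^ 2)) := by
    have h1 : IntervalIntegrable (fun r : ℝ => r * (1 - Real.cos (u / r ^ 2))) volume 0 ρ :=
      (intervalIntegrable_iff_integrableOn_Ioc_of_le hρ.le).2 (hi.mono_set Ioc_subset_Ioi_self)
    have h2 : IntervalIntegrable (fun r : ℝ => r) volume 0 ρ :=
      continuous_id.intervalIntegrable _ _
    rw [re_rayIntegral, ← intervalIntegral.integral_of_le hρ.le]
    have : (fun r : ℝ => r * Real.cos (u / r ^ 2)) =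
        fun r => r - r * (1 - Real.cos (u / r ^ 2)) := by ext r; ring
    rw [this, intervalIntegral.integral_sub h2 h1]
    simp
  have htail := abs_integral_Ioi_mul_one_sub_cos_sub_le hρ hu
  rw [hre]
  convert! htail using 2
  linarith

lemma im_rayIntegral_neg (u ρ : ℝ) : (rayIntegral (-u) ρ).im = -(rayIntegral u ρ).im := by
  rw [im_rayIntegral, im_rayIntegral, ← intervalIntegral.integral_neg]
  congr 1 with r
  rw [neg_div, Real.sin_neg, mul_neg]

lemma abs_im_rayIntegral_sub_le {u ρ : ℝ} (h1 : 1 / 2 ≤ ρ) (h2 : ρ ≤ 3 / 2) (hu : |u| ≤ 1 / 4) :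
    |(rayIntegral u ρ).im - ((rayIntegral u 1).im +
      (u * Real.log ρ + u ^ 3 / 24 * ((ρ ^ 4)⁻¹ - 1)))| ≤ u ^ 4 := by
  have hsin : ∀ a b : ℝ, IntervalIntegrable (fun r : ℝ => r * Real.sin (u / r ^ 2)) volume a b := by
    intro a b
    have h : IntervalIntegrable (fun r : ℝ => r) volume a b := continuous_id.intervalIntegrable _ _
    refine h.mono_fun (Measurable.aestronglyMeasurable (by fun_prop)) (ae_of_all _ fun r => ?_)
    simp only [norm_mul]
    exact mul_le_of_le_one_right (norm_nonneg _) (Real.abs_sin_le_one _)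
  have hmem : ∀ r ∈ uIcc 1 ρ, 1 / 2 ≤ r := by
    intro r hr
    rcases le_total 1 ρ with h | h
    · rw [uIcc_of_le h] at hr; linarith [hr.1]
    · rw [uIcc_of_ge h] at hr; linarith [hr.1]
  have hder : ∀ r ∈ uIcc 1 ρ, HasDerivAt (fun r : ℝ => u * Real.log r + u ^ 3 / 24 * ((r ^ 4)⁻¹ - 1))
      (u / r - u ^ 3 / (6 * r ^ 5)) r := by
    intro r hr
    have hr0 : r ≠ 0 := by linarith [hmem r hr]
    have e1 := (Real.hasDerivAt_log hr0).const_mul u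
    have e2 := (((hasDerivAt_pow 4 r).inv (pow_ne_zero 4 hr0)).sub_const 1).const_mul (u ^ 3 / 24)
    convert! e1.add e2 using 1
    field_simp
    ring
  have hcont : IntervalIntegrable (fun r : ℝ => u / r - u ^ 3 / (6 * r ^ 5)) volume 1 ρ := by
    refine ContinuousOn.intervalIntegrable fun r hr => ContinuousAt.continuousWithinAt ?_
    have hr0 : r ≠ 0 := by linarith [hmem r hr]
    have hr5 : 6 * r ^ 5 ≠ 0 := by positivity
    fun_prop (disch := assumption)
  have hFTC := intervalIntegral.integral_eq_sub_of_hasDerivAt hder hcont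
  have hadd := intervalIntegral.integral_add_adjacent_intervals (hsin 0 1) (hsin 1 ρ)
  rw [im_rayIntegral, im_rayIntegral, ← hadd]
  have hlog : u * Real.log ρ + u ^ 3 / 24 * ((ρ ^ 4)⁻¹ - 1) =
      ∫ r in (1 : ℝ)..ρ, (u / r - u ^ 3 / (6 * r ^ 5)) := by
    rw [hFTC]; simp
  rw [add_sub_add_left_eq_sub, hlog, ← intervalIntegral.integral_sub (hsin 1 ρ) hcont,
    ← Real.norm_eq_abs]
  have hbound : ∀ r ∈ uIoc 1 ρ,
      ‖r * Real.sin (u / r ^ 2) - (u / r - u ^ 3 / (6 * r ^ 5))‖ ≤ 2 * u ^ 4 := by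
    intro r hr
    have hr2 := hmem r (uIoc_subset_uIcc hr)
    have hr0 : 0 < r := by linarith
    have hw : |u / r ^ 2| ≤ 1 := by
      rw [abs_div, abs_of_pos (by positivity : 0 < r ^ 2), div_le_one (by positivity)]
      nlinarith
    have e : r * Real.sin (u / r ^ 2) - (u / r - u ^ 3 / (6 * r ^ 5)) =
        r * (Real.sin (u / r ^ 2) - (u / r ^ 2 - (u / r ^ 2) ^ 3 / 6)) := by
      field_simp
    rw [e, norm_mul, Real.norm_eq_abs, Real.norm_eq_abs, abs_of_pos hr0]
    have hs := Real.sin_bound hw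
    have hinv : r⁻¹ ≤ 2 := by
      rw [inv_le_comm₀ hr0 (by norm_num)]; linarith
    calc r * |Real.sin (u / r ^ 2) - (u / r ^ 2 - (u / r ^ 2) ^ 3 / 6)|
        ≤ r * (|u / r ^ 2| ^ 5 / 100) := by gcongr
      _ = |u| ^ 5 * r⁻¹ ^ 9 / 100 := by
        rw [abs_div, abs_of_pos (by positivity : 0 < r ^ 2)]
        field_simp
      _ ≤ |u| ^ 5 * 2 ^ 9 / 100 := by gcongr
      _ = u ^ 4 * |u| * (2 ^ 9 / 100) := by
        rw [show |u| ^ 5 = (|u| ^ 2) ^ 2 * |u| by ring, sq_abs]; ring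
      _ ≤ u ^ 4 * (1 / 4) * (2 ^ 9 / 100) := by gcongr
      _ ≤ 2 * u ^ 4 := by
        have : 0 ≤ u ^ 4 := by positivity
        linarith
  refine (intervalIntegral.norm_integral_le_of_norm_le_const hbound).trans ?_
  have h3 : |ρ - 1| ≤ 1 / 2 := by rw [abs_le]; constructor <;> linarith
  have : 0 ≤ u ^ 4 := by positivity
  nlinarith

lemma abs_re_rayIntegral_sub_le_of_half_le {u v ρ : ℝ} (hv : |v| = |u|) (hρ : 1 / 2 ≤ ρ)
    (hu : |u| ≤ 1 / 4) :
    |(rayIntegral v ρ).re - (ρ ^ 2 / 2 - Real.pi * |u| / 4 + u ^ 2 / (4 * ρ ^ 2))| ≤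
      64 * u ^ 4 := by
  have hv2 : v ^ 2 = u ^ 2 := (sq_eq_sq_iff_abs_eq_abs _ _).2 hv
  have h := abs_re_rayIntegral_sub_le (u := v) (ρ := ρ) (by linarith) (by rw [hv]; nlinarith)
  rw [hv, hv2, show v ^ 4 = u ^ 4 by rw [show v ^ 4 = (v ^ 2) ^ 2 by ring, hv2]; ring] at h
  refine h.trans ?_
  have : (1 / 2 : ℝ) ^ 6 ≤ ρ ^ 6 := by gcongr
  rw [div_le_iff₀ (by linarith)]
  have hu4 : 0 ≤ u ^ 4 := by positivity
  nlinarith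

/-- The chord through a point at squared distance `p` from the centre of the unit disk, with `b` the
component of the point along it: its two parts multiply to the power `1 - p` of the point. -/
lemma chord_bounds {p b : ℝ} (hb : b ^ 2 ≤ p) (hp4 : p ≤ 1 / 4) :
    1 / 2 ≤ b + √(1 - p + b ^ 2) ∧ b + √(1 - p + b ^ 2) ≤ 3 / 2 ∧
      (-b + √(1 - p + b ^ 2)) * (b + √(1 - p + b ^ 2)) = 1 - p ∧
      (-b + √(1 - p + b ^ 2)) ^ 2 + (b + √(1 - p + b ^ 2)) ^ 2 = 2 * (1 - p) + 4 * b ^ 2 := by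
  have hsq : √(1 - p + b ^ 2) ^ 2 = 1 - p + b ^ 2 := Real.sq_sqrt (by nlinarith [sq_nonneg b])
  have hs := Real.sqrt_nonneg (1 - p + b ^ 2)
  set s := √(1 - p + b ^ 2)
  have h1 : s ≤ 1 := by nlinarith
  have h2 : |b| ≤ 1 / 2 := abs_le_of_sq_le_sq (by nlinarith) (by norm_num)
  have h3 := abs_le.1 h2
  have h4 : (-b + s) * (b + s) = 1 - p := by nlinarith
  have h5 : 0 < b + s := by nlinarith
  refine ⟨by nlinarith, by linarith, h4, by nlinarith⟩

lemma abs_inv_pow_four_sub_le {p b₀ b₁ ρ₀ ρ₁ ρ₂ ρ₃ : ℝ} (hp : b₀ ^ 2 + b₁ ^ 2 = p)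
    (hp4 : p ≤ 1 / 4) (m₀ : ρ₀ * ρ₂ = 1 - p) (m₁ : ρ₁ * ρ₃ = 1 - p)
    (a₀ : ρ₀ ^ 2 + ρ₂ ^ 2 = 2 * (1 - p) + 4 * b₀ ^ 2)
    (a₁ : ρ₁ ^ 2 + ρ₃ ^ 2 = 2 * (1 - p) + 4 * b₁ ^ 2) :
    |(ρ₀ ^ 4)⁻¹ + (ρ₂ ^ 4)⁻¹ - (ρ₁ ^ 4)⁻¹ - (ρ₃ ^ 4)⁻¹| ≤ 72 * p := by
  have hp1 : 0 < 1 - p := by linarith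
  have e : ∀ x y c : ℝ, x * y = 1 - p → x ^ 2 + y ^ 2 = c → (x ^ 4)⁻¹ + (y ^ 4)⁻¹ =
      (c ^ 2 - 2 * (1 - p) ^ 2) / (1 - p) ^ 4 := by
    intro x y c hxy hc
    have hx : x ≠ 0 := by rintro rfl; simp at hxy; linarith
    have hy : y ≠ 0 := by rintro rfl; simp at hxy; linarith
    rw [← hxy, ← hc]
    field_simp
    ring
  have e2 : (ρ₀ ^ 4)⁻¹ + (ρ₂ ^ 4)⁻¹ - (ρ₁ ^ 4)⁻¹ - (ρ₃ ^ 4)⁻¹ =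
      16 * (b₀ ^ 2 - b₁ ^ 2) / (1 - p) ^ 4 := by
    rw [sub_sub, e _ _ _ m₀ a₀, e _ _ _ m₁ a₁, ← sub_div]
    congr 1
    rw [← hp]
    ring
  have h1 : |b₀ ^ 2 - b₁ ^ 2| ≤ p := by
    rw [abs_le]; constructor <;> linarith [sq_nonneg b₀, sq_nonneg b₁]
  have hp0 : 0 ≤ p := (abs_nonneg _).trans h1
  have h2 : (3 / 4 : ℝ) ^ 4 ≤ (1 - p) ^ 4 := by gcongr; linarith
  rw [e2, abs_div, abs_mul, abs_of_pos (pow_pos hp1 4), abs_of_pos (by norm_num : (0 : ℝ) < 16),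
    div_le_iff₀ (pow_pos hp1 4)]
  nlinarith

lemma sum_div_sq_eq {u p b₀ b₁ ρ₀ ρ₁ ρ₂ ρ₃ : ℝ} (hp : b₀ ^ 2 + b₁ ^ 2 = p)
    (hp4 : p ≤ 1 / 4) (m₀ : ρ₀ * ρ₂ = 1 - p) (m₁ : ρ₁ * ρ₃ = 1 - p)
    (a₀ : ρ₀ ^ 2 + ρ₂ ^ 2 = 2 * (1 - p) + 4 * b₀ ^ 2)
    (a₁ : ρ₁ ^ 2 + ρ₃ ^ 2 = 2 * (1 - p) + 4 * b₁ ^ 2) :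
    u ^ 2 / (4 * ρ₀ ^ 2) + u ^ 2 / (4 * ρ₁ ^ 2) + u ^ 2 / (4 * ρ₂ ^ 2) +
      u ^ 2 / (4 * ρ₃ ^ 2) = u ^ 2 / (1 - p) ^ 2 := by
  have hp1 : 0 < 1 - p := by linarith
  have e : ∀ x y c : ℝ, x * y = 1 - p → x ^ 2 + y ^ 2 = c →
      u ^ 2 / (4 * x ^ 2) + u ^ 2 / (4 * y ^ 2) = u ^ 2 * c / (4 * (1 - p) ^ 2) := by
    intro x y c hxy hc
    have hx : x ≠ 0 := by rintro rfl; simp at hxy; linarith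
    have hy : y ≠ 0 := by rintro rfl; simp at hxy; linarith
    rw [← hxy, ← hc]
    field_simp
    ring
  have : u ^ 2 / (4 * ρ₀ ^ 2) + u ^ 2 / (4 * ρ₁ ^ 2) + u ^ 2 / (4 * ρ₂ ^ 2) +
      u ^ 2 / (4 * ρ₃ ^ 2) = (u ^ 2 / (4 * ρ₀ ^ 2) + u ^ 2 / (4 * ρ₂ ^ 2)) +
        (u ^ 2 / (4 * ρ₁ ^ 2) + u ^ 2 / (4 * ρ₃ ^ 2)) := by ring
  rw [this, e _ _ _ m₀ a₀, e _ _ _ m₁ a₁, ← add_div, ← mul_add]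
  have : 2 * (1 - p) + 4 * b₀ ^ 2 + (2 * (1 - p) + 4 * b₁ ^ 2) = 4 := by rw [← hp]; ring
  rw [this]
  field_simp

/-- The four rays at successive right angles from a point at squared distance `p` from the centre
of the unit disk. Opposite rays have lengths with product `1 - p`, so the logarithms of the
expansion cancel between the two pairs, as do the terms that are odd in `u`. -/
lemma norm_sum_rayIntegral_sub_le {u p b₀ b₁ : ℝ} (hp : b₀ ^ 2 + b₁ ^ 2 = p) (hp4 : p ≤ 1 / 4)
    (hu : |u| ≤ 1 / 4) :
    ‖rayIntegral u (-b₀ + √(1 - p + b₀ ^ 2)) + rayIntegral (-u) (-b₁ + √(1 - p + b₁ ^ 2)) +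
      rayIntegral u (b₀ + √(1 - p + b₀ ^ 2)) + rayIntegral (-u) (b₁ + √(1 - p + b₁ ^ 2)) -
      ((2 - Real.pi * |u| + u ^ 2 / (1 - p) ^ 2 : ℝ) : ℂ)‖ ≤ 260 * (u ^ 4 + |u| ^ 3 * p) := by
  have hb₀ : b₀ ^ 2 ≤ p := by linarith [sq_nonneg b₁]
  have hb₁ : b₁ ^ 2 ≤ p := by linarith [sq_nonneg b₀]
  obtain ⟨l₂, g₂, m₀, a₀⟩ := chord_bounds hb₀ hp4
  obtain ⟨l₀, g₀, -, -⟩ := chord_bounds (b := -b₀) (by rwa [neg_sq]) hp4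
  obtain ⟨l₃, g₃, m₁, a₁⟩ := chord_bounds hb₁ hp4
  obtain ⟨l₁, g₁, -, -⟩ := chord_bounds (b := -b₁) (by rwa [neg_sq]) hp4
  rw [neg_sq] at l₀ g₀ l₁ g₁
  generalize -b₀ + √(1 - p + b₀ ^ 2) = ρ₀ at *
  generalize b₀ + √(1 - p + b₀ ^ 2) = ρ₂ at *
  generalize -b₁ + √(1 - p + b₁ ^ 2) = ρ₁ at *
  generalize b₁ + √(1 - p + b₁ ^ 2) = ρ₃ at *
  have hsq := sum_div_sq_eq (u := u) hp hp4 m₀ m₁ a₀ a₁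
  have hfour := abs_inv_pow_four_sub_le hp hp4 m₀ m₁ a₀ a₁
  have hlog : Real.log ρ₀ + Real.log ρ₂ = Real.log ρ₁ + Real.log ρ₃ := by
    rw [← Real.log_mul (by linarith) (by linarith), ← Real.log_mul (by linarith) (by linarith),
      m₀, m₁]
  have hlogu : u * Real.log ρ₀ + u * Real.log ρ₂ = u * Real.log ρ₁ + u * Real.log ρ₃ := by
    rw [← mul_add, ← mul_add, hlog]
  have hfour' : |u ^ 3 / 24 * ((ρ₀ ^ 4)⁻¹ + (ρ₂ ^ 4)⁻¹ - (ρ₁ ^ 4)⁻¹ - (ρ₃ ^ 4)⁻¹)| ≤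
      3 * (|u| ^ 3 * p) := by
    rw [abs_mul, abs_div, abs_pow, abs_of_pos (by norm_num : (0 : ℝ) < 24)]
    calc |u| ^ 3 / 24 * _ ≤ |u| ^ 3 / 24 * (72 * p) := by gcongr
      _ = 3 * (|u| ^ 3 * p) := by ring
  refine (Complex.norm_le_abs_re_add_abs_im _).trans ?_
  have hre : |(rayIntegral u ρ₀ + rayIntegral (-u) ρ₁ + rayIntegral u ρ₂ + rayIntegral (-u) ρ₃ -
      ((2 - Real.pi * |u| + u ^ 2 / (1 - p) ^ 2 : ℝ) : ℂ)).re| ≤ 256 * u ^ 4 := by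
    have r₀ := abs_le.1 (abs_re_rayIntegral_sub_le_of_half_le (u := u) rfl l₀ hu)
    have r₁ := abs_le.1 (abs_re_rayIntegral_sub_le_of_half_le (u := u) (abs_neg u) l₁ hu)
    have r₂ := abs_le.1 (abs_re_rayIntegral_sub_le_of_half_le (u := u) rfl l₂ hu)
    have r₃ := abs_le.1 (abs_re_rayIntegral_sub_le_of_half_le (u := u) (abs_neg u) l₃ hu)
    rw [Complex.sub_re, Complex.add_re, Complex.add_re, Complex.add_re, Complex.ofReal_re, ← hsq]
    rw [abs_le]
    constructor <;> linarith [r₀.1, r₁.1, r₂.1, r₃.1, r₀.2, r₁.2, r₂.2, r₃.2]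
  have him : |(rayIntegral u ρ₀ + rayIntegral (-u) ρ₁ + rayIntegral u ρ₂ + rayIntegral (-u) ρ₃ -
      ((2 - Real.pi * |u| + u ^ 2 / (1 - p) ^ 2 : ℝ) : ℂ)).im| ≤
        4 * u ^ 4 + 3 * (|u| ^ 3 * p) := by
    have i₀ := abs_le.1 (abs_im_rayIntegral_sub_le l₀ g₀ hu)
    have i₂ := abs_le.1 (abs_im_rayIntegral_sub_le l₂ g₂ hu)
    have i₁ := abs_le.1 (abs_im_rayIntegral_sub_le l₁ g₁ hu)
    have i₃ := abs_le.1 (abs_im_rayIntegral_sub_le l₃ g₃ hu)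
    rw [Complex.sub_im, Complex.add_im, Complex.add_im, Complex.add_im, Complex.ofReal_im, sub_zero,
      im_rayIntegral_neg, im_rayIntegral_neg]
    have h4 := abs_le.1 hfour'
    rw [abs_le]
    constructor <;> linarith [i₀.1, i₁.1, i₂.1, i₃.1, i₀.2, i₁.2, i₂.2, i₃.2, h4.1, h4.2]
  have : 0 ≤ |u| ^ 3 * p := mul_nonneg (by positivity) ((sq_nonneg _).trans hb₀)
  linarith

end RadialExpansion

/-! ### Angular averages -/

section Angular

open Set Real

lemma integral_comp_two_mul_sub_of_periodic {f : ℝ → ℝ} (hf : Function.Periodic f (2 * π))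
    (hc : Continuous f) (α : ℝ) : ∫ θ in -π..π, f (2 * θ - α) = ∫ θ in -π..π, f θ := by
  rw [intervalIntegral.integral_comp_mul_sub f two_ne_zero α]
  have h1 := hf.intervalIntegral_add_zsmul_eq 2 (2 * -π - α)
    (fun t₁ t₂ => hc.intervalIntegrable t₁ t₂)
  have h2 := hf.intervalIntegral_add_eq (2 * -π - α) (-π)
  rw [h2] at h1
  have e1 : 2 * -π - α + (2 : ℤ) • (2 * π) = 2 * π - α := by simp; ring
  have e2 : -π + 2 * π = π := by ring
  rw [e1, e2] at h1
  rw [h1]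
  simp

lemma integral_shift_of_periodic {E : Type*} [NormedAddCommGroup E] [NormedSpace ℝ E] {f : ℝ → E}
    (hf : Function.Periodic f (2 * π)) (a : ℝ) :
    ∫ θ in -π..π, f (θ + a) = ∫ θ in -π..π, f θ := by
  rw [intervalIntegral.integral_comp_add_right]
  have h := hf.intervalIntegral_add_eq (-π + a) (-π)
  rw [show -π + a + 2 * π = π + a by ring, show -π + 2 * π = π by ring] at h
  exact h

/-- The integral of a periodic function over a period, as the integral of its average over the four
quarter turns. -/
lemma four_mul_integral_eq_integral_quarter_turns {f : ℝ → ℂ} (hf : Function.Periodic f (2 * π))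
    (hi : ∀ a b, IntervalIntegrable f volume a b) :
    4 * ∫ θ in -π..π, f θ =
      ∫ θ in -π..π, (f θ + f (θ + π / 2) + f (θ + π) + f (θ + 3 * π / 2)) := by
  have hs : ∀ a, IntervalIntegrable (fun θ => f (θ + a)) volume (-π) π := fun a => by
    have := (hi (-π + a) (π + a)).comp_add_right a
    simpa using this
  rw [intervalIntegral.integral_add (((hi _ _).add (hs _)).add (hs _)) (hs _),
    intervalIntegral.integral_add ((hi _ _).add (hs _)) (hs _),
    intervalIntegral.integral_add (hi _ _) (hs _), integral_shift_of_periodic hf,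
    integral_shift_of_periodic hf, integral_shift_of_periodic hf]
  ring

lemma integral_abs_cos : ∫ θ in -π..π, |cos θ| = 4 := by
  have hper : Function.Periodic (fun θ => |cos θ|) (2 * π) := fun θ => by simp
  have hi : ∀ a b, IntervalIntegrable (fun θ => |cos θ|) volume a b := fun a b =>
    (by fun_prop : Continuous fun θ => |cos θ|).intervalIntegrable a b
  have h := hper.intervalIntegral_add_eq (-π) (-(π / 2))
  rw [show -π + 2 * π = π by ring, show -(π / 2) + 2 * π = 3 * π / 2 by ring] at h
  rw [h, ← intervalIntegral.integral_add_adjacent_intervals (hi _ (π / 2)) (hi _ _)]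
  have h1 : ∫ θ in -(π / 2)..(π / 2), |cos θ| = ∫ θ in -(π / 2)..(π / 2), cos θ := by
    refine intervalIntegral.integral_congr fun θ hθ => ?_
    rw [uIcc_of_le (by linarith [pi_pos])] at hθ
    exact abs_of_nonneg (cos_nonneg_of_mem_Icc hθ)
  have h2 : ∫ θ in (π / 2)..(3 * π / 2), |cos θ| = ∫ θ in (π / 2)..(3 * π / 2), -cos θ := by
    refine intervalIntegral.integral_congr fun θ hθ => ?_
    rw [uIcc_of_le (by linarith [pi_pos])] at hθ
    exact abs_of_nonpos (cos_nonpos_of_pi_div_two_le_of_le hθ.1 (by linarith [hθ.2]))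
  rw [h1, h2, intervalIntegral.integral_neg, integral_cos, integral_cos,
    show 3 * π / 2 = π + π / 2 by ring, sin_add, sin_neg]
  simp
  norm_num

lemma integral_cos_sq_period : ∫ θ in -π..π, cos θ ^ 2 = π := by
  rw [integral_cos_sq]; simp

/-- With `k = κ / √(κ² + Γ²)`, the arctangent below equals `θ - arctan (k tan θ)` and has no
singularity, so the fundamental theorem of calculus applies over the whole period. -/
lemma integral_inv_sq_add_sq_mul_cos_sq {κ : ℝ} (hκ : 0 < κ) (Γ : ℝ) :
    ∫ θ in -π..π, κ / (κ ^ 2 + Γ ^ 2 * cos θ ^ 2) = 2 * π / √(κ ^ 2 + Γ ^ 2) := by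
  set S := √(κ ^ 2 + Γ ^ 2) with hS
  have hSpos : 0 < S := Real.sqrt_pos.2 (by positivity)
  have hS2 : S ^ 2 = κ ^ 2 + Γ ^ 2 := Real.sq_sqrt (by positivity)
  have hden : ∀ θ : ℝ, 0 < S * cos θ ^ 2 + κ * sin θ ^ 2 := by
    intro θ
    have h := sin_sq_add_cos_sq θ
    rcases eq_or_ne (sin θ) 0 with h0 | h0
    · rw [h0] at h ⊢; nlinarith
    · have : 0 < sin θ ^ 2 := by positivity
      have : 0 ≤ S * cos θ ^ 2 := by positivity
      nlinarith
  have hpos : ∀ θ : ℝ, 0 < κ ^ 2 + Γ ^ 2 * cos θ ^ 2 := fun θ => by positivity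
  set F : ℝ → ℝ := fun θ =>
    1 / S * (θ - arctan ((S - κ) * (sin θ * cos θ) / (S * cos θ ^ 2 + κ * sin θ ^ 2))) with hF
  have hder : ∀ θ ∈ uIcc (-π) π, HasDerivAt F (κ / (κ ^ 2 + Γ ^ 2 * cos θ ^ 2)) θ := by
    intro θ _
    have hs := hasDerivAt_sin θ
    have hc := hasDerivAt_cos θ
    have hN := (hs.mul hc).const_mul (S - κ)
    have hD := ((hc.pow 2).const_mul S).add ((hs.pow 2).const_mul κ)
    have hq := (hN.div hD (hden θ).ne').arctan
    have := ((hasDerivAt_id θ).sub hq).const_mul (1 / S)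
    convert! this using 1
    have hd := (hden θ).ne'
    have hp := (hpos θ).ne'
    have hsc : sin θ ^ 2 = 1 - cos θ ^ 2 := by linarith [sin_sq_add_cos_sq θ]
    have hsum : (S * cos θ ^ 2 + κ * sin θ ^ 2) ^ 2 + ((S - κ) * (sin θ * cos θ)) ^ 2 =
        κ ^ 2 + Γ ^ 2 * cos θ ^ 2 := by
      have : ((S - κ) * (sin θ * cos θ)) ^ 2 = (S - κ) ^ 2 * sin θ ^ 2 * cos θ ^ 2 := by ring
      rw [this, hsc]
      linear_combination (cos θ ^ 2) * hS2
    simp only [Pi.mul_apply, Pi.add_apply, Pi.pow_apply, Pi.div_apply]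
    set D := S * cos θ ^ 2 + κ * sin θ ^ 2 with hDdef
    set N := (S - κ) * (sin θ * cos θ) with hNdef
    have hq2 : 1 + (N / D) ^ 2 = (κ ^ 2 + Γ ^ 2 * cos θ ^ 2) / D ^ 2 := by
      rw [← hsum]; field_simp
    have hnum : (S - κ) * (cos θ * cos θ + sin θ * -sin θ) * D -
        N * (S * (((2 : ℕ) : ℝ) * cos θ ^ (2 - 1) * -sin θ) +
          κ * (((2 : ℕ) : ℝ) * sin θ ^ (2 - 1) * cos θ)) =
        κ ^ 2 + Γ ^ 2 * cos θ ^ 2 - κ * S := by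
      have e : (S - κ) * (cos θ * cos θ + sin θ * -sin θ) * D -
        N * (S * (((2 : ℕ) : ℝ) * cos θ ^ (2 - 1) * -sin θ) +
          κ * (((2 : ℕ) : ℝ) * sin θ ^ (2 - 1) * cos θ)) =
          (S - κ) * (sin θ ^ 2 + cos θ ^ 2) * (S * cos θ ^ 2 - κ * sin θ ^ 2) := by
        rw [hNdef, hDdef]; push_cast; ring
      rw [e, sin_sq_add_cos_sq, hsc]
      linear_combination (cos θ ^ 2) * hS2
    rw [hq2, hnum]
    field_simp
    ring
  have hcont : IntervalIntegrable (fun θ => κ / (κ ^ 2 + Γ ^ 2 * cos θ ^ 2)) volume (-π) π := by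
    refine Continuous.intervalIntegrable ?_ _ _
    exact continuous_const.div (by fun_prop) fun θ => (hpos θ).ne'
  rw [intervalIntegral.integral_eq_sub_of_hasDerivAt hder hcont]
  simp [hF]
  field_simp
  ring

lemma integral_inv_one_add_sq_mul_cos_sq_le {τ : ℝ} (hτ : 0 < τ) (α : ℝ) :
    ∫ θ in -π..π, (1 + (τ * cos (2 * θ - α)) ^ 2)⁻¹ ≤ 2 * π / τ := by
  have hpos : ∀ θ : ℝ, 0 < 1 + (τ * cos θ) ^ 2 := fun θ => by positivity
  have h := integral_comp_two_mul_sub_of_periodic (f := fun θ => (1 + (τ * cos θ) ^ 2)⁻¹)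
    (fun θ => by simp) (Continuous.inv₀ (by fun_prop) fun θ => (hpos θ).ne') α
  rw [h]
  have h2 := integral_inv_sq_add_sq_mul_cos_sq one_pos τ
  have h3 : ∀ θ, 1 / (1 ^ 2 + τ ^ 2 * cos θ ^ 2) = (1 + (τ * cos θ) ^ 2)⁻¹ := fun θ => by
    rw [one_pow, one_div, mul_pow]
  simp_rw [h3] at h2
  rw [h2]
  gcongr
  exact Real.le_sqrt_of_sq_le (by linarith [sq_nonneg τ])

/-- The distance from the point `-y` of the unit disk to the unit circle in the direction `θ`. -/
noncomputable def chord (y : ℂ) (θ : ℝ) : ℝ :=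
  -(y.re * cos θ + y.im * sin θ) +
    √(1 - Complex.normSq y + (y.re * cos θ + y.im * sin θ) ^ 2)

lemma chord_component_sq_le (y : ℂ) (θ : ℝ) :
    (y.re * cos θ + y.im * sin θ) ^ 2 ≤ Complex.normSq y := by
  rw [Complex.normSq_apply]
  have h : (y.re * cos θ + y.im * sin θ) ^ 2 + (y.re * sin θ - y.im * cos θ) ^ 2 =
      (y.re * y.re + y.im * y.im) * (sin θ ^ 2 + cos θ ^ 2) := by ring
  rw [sin_sq_add_cos_sq, mul_one] at h
  linarith [sq_nonneg (y.re * sin θ - y.im * cos θ)]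

lemma continuous_chord (y : ℂ) : Continuous (chord y) := by
  unfold chord; fun_prop

lemma chord_nonneg {y : ℂ} (hy : Complex.normSq y ≤ 1) (θ : ℝ) : 0 ≤ chord y θ := by
  unfold chord
  have : y.re * cos θ + y.im * sin θ ≤
      √(1 - Complex.normSq y + (y.re * cos θ + y.im * sin θ) ^ 2) :=
    Real.le_sqrt_of_sq_le (by linarith)
  linarith

lemma chord_le_two {y : ℂ} (hy : Complex.normSq y ≤ 1) (θ : ℝ) : chord y θ ≤ 2 := by
  unfold chord
  have hb := chord_component_sq_le y θ
  have h1 : √(1 - Complex.normSq y + (y.re * cos θ + y.im * sin θ) ^ 2) ≤ 1 :=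
    Real.sqrt_le_one.2 (by linarith)
  have h2 := abs_le.1 (abs_le_of_sq_le_sq (a := y.re * cos θ + y.im * sin θ) (b := 1)
    (by linarith) (by norm_num))
  linarith

lemma norm_add_le_one_iff_le_chord {y : ℂ} (hy : Complex.normSq y ≤ 1) {r : ℝ} (hr : 0 < r)
    (θ : ℝ) : ‖(r : ℂ) * (cos θ + sin θ * Complex.I) + y‖ ≤ 1 ↔ r ≤ chord y θ := by
  have hsq : ‖(r : ℂ) * (cos θ + sin θ * Complex.I) + y‖ ^ 2 =
      r ^ 2 + 2 * r * (y.re * cos θ + y.im * sin θ) + Complex.normSq y := by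
    rw [← Complex.normSq_eq_norm_sq, Complex.normSq_apply, Complex.normSq_apply]
    simp only [Complex.add_re, Complex.mul_re, Complex.ofReal_re, Complex.ofReal_im, Complex.I_re,
      Complex.I_im, Complex.add_im, Complex.mul_im]
    linear_combination (r ^ 2) * sin_sq_add_cos_sq θ
  have h0 : ‖(r : ℂ) * (cos θ + sin θ * Complex.I) + y‖ ≤ 1 ↔
      ‖(r : ℂ) * (cos θ + sin θ * Complex.I) + y‖ ^ 2 ≤ 1 :=
    (sq_le_one_iff₀ (norm_nonneg _)).symm
  rw [h0, hsq, chord]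
  set b := y.re * cos θ + y.im * sin θ
  have hs : √(1 - Complex.normSq y + b ^ 2) ^ 2 = 1 - Complex.normSq y + b ^ 2 :=
    Real.sq_sqrt (by linarith [sq_nonneg b])
  constructor
  · intro h
    have : r + b ≤ √(1 - Complex.normSq y + b ^ 2) := Real.le_sqrt_of_sq_le (by linarith)
    linarith
  · intro h
    have h1 : |b| ≤ √(1 - Complex.normSq y + b ^ 2) := by
      rw [← Real.sqrt_sq_eq_abs]
      exact Real.sqrt_le_sqrt (by linarith)
    have h2 := abs_le.1 h1
    have h3 : (r + b) ^ 2 ≤ √(1 - Complex.normSq y + b ^ 2) ^ 2 :=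
      sq_le_sq' (by linarith) (by linarith)
    linarith

lemma rayIntegral_eq_integral_Ioi {u ρ : ℝ} (hρ : 0 ≤ ρ) :
    rayIntegral u ρ = ∫ r in Ioi (0 : ℝ),
      if r ≤ ρ then (r : ℂ) * Complex.exp ((u / r ^ 2 : ℝ) * Complex.I) else 0 := by
  rw [rayIntegral, intervalIntegral.integral_of_le hρ]
  have : (fun r : ℝ => if r ≤ ρ then (r : ℂ) * Complex.exp ((u / r ^ 2 : ℝ) * Complex.I) else 0) =
      (Iic ρ).indicator fun r : ℝ => (r : ℂ) * Complex.exp ((u / r ^ 2 : ℝ) * Complex.I) := by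
    ext r; simp [indicator_apply]
  rw [this, setIntegral_indicator measurableSet_Iic, Ioi_inter_Iic]

/-- The integral of `rayIntegral` over all directions. -/
noncomputable def raySum (τ α : ℝ) (y : ℂ) : ℂ :=
  ∫ θ in -π..π, rayIntegral (τ * cos (2 * θ - α)) (chord y θ)

lemma intervalIntegrable_rayIntegral (τ α : ℝ) {y : ℂ} (hy : Complex.normSq y ≤ 1) (a b : ℝ) :
    IntervalIntegrable (fun θ => rayIntegral (τ * cos (2 * θ - α)) (chord y θ)) volume a b := by
  refine (intervalIntegrable_const (c := (2 : ℝ))).mono_fun ?_ (ae_of_all _ fun θ => ?_)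
  · have hm : StronglyMeasurable (Function.uncurry fun θ r : ℝ => if r ≤ chord y θ then
        (r : ℂ) * Complex.exp ((τ * cos (2 * θ - α) / r ^ 2 : ℝ) * Complex.I) else 0) := by
      refine (Measurable.ite ?_ ?_ measurable_const).stronglyMeasurable
      · exact measurableSet_le measurable_snd ((continuous_chord y).measurable.comp measurable_fst)
      · fun_prop
    have h2 := (hm.integral_prod_right (ν := volume.restrict (Ioi (0 : ℝ)))).aestronglyMeasurable
      (μ := volume.restrict (uIoc a b))
    refine h2.congr (ae_of_all _ fun θ => ?_)
    exact (rayIntegral_eq_integral_Ioi (chord_nonneg hy θ)).symm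
  · have h1 := norm_rayIntegral_le (u := τ * cos (2 * θ - α)) (chord_nonneg hy θ)
    have h2 := chord_nonneg hy θ
    have h3 := chord_le_two hy θ
    simp only [Real.norm_eq_abs, abs_two]
    nlinarith

lemma raySum_periodic (τ α : ℝ) (y : ℂ) : Function.Periodic
    (fun θ => rayIntegral (τ * cos (2 * θ - α)) (chord y θ)) (2 * π) := by
  intro θ
  have : cos (2 * (θ + 2 * π) - α) = cos (2 * θ - α) := by
    rw [show 2 * (θ + 2 * π) - α = 2 * θ - α + 2 * π + 2 * π by ring, cos_add_two_pi,
      cos_add_two_pi]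
  simp only [chord, this, cos_add_two_pi, sin_add_two_pi]

lemma norm_raySum_sub_le {τ : ℝ} (hτ0 : 0 ≤ τ) (hτ : τ ≤ 1 / 4) (α : ℝ) {y : ℂ}
    (hy : Complex.normSq y ≤ 1 / 4) :
    ‖raySum τ α y - π * ((1 - τ + τ ^ 2 / (4 * (1 - Complex.normSq y) ^ 2) : ℝ) : ℂ)‖ ≤
      π * (130 * (τ ^ 4 + τ ^ 3 * Complex.normSq y)) := by
  have hy1 : Complex.normSq y ≤ 1 := by linarith
  set p := Complex.normSq y with hp
  have hp0 : 0 ≤ p := Complex.normSq_nonneg y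
  set f : ℝ → ℂ := fun θ => rayIntegral (τ * cos (2 * θ - α)) (chord y θ) with hf
  set g : ℝ → ℝ := fun θ => 2 - π * |τ * cos (2 * θ - α)| +
    (τ * cos (2 * θ - α)) ^ 2 / (1 - p) ^ 2 with hg
  have hfi : ∀ a b, IntervalIntegrable f volume a b := intervalIntegrable_rayIntegral τ α hy1
  have hfour := four_mul_integral_eq_integral_quarter_turns (raySum_periodic τ α y) hfi
  have hgc : Continuous g := by simp only [hg]; fun_prop
  have hgint : ∫ θ in -π..π, g θ = 4 * (π * (1 - τ + τ ^ 2 / (4 * (1 - p) ^ 2))) := by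
    have e1 := integral_comp_two_mul_sub_of_periodic (f := fun θ => |cos θ|)
      (fun θ => by simp) (by fun_prop) α
    have e2 := integral_comp_two_mul_sub_of_periodic (f := fun θ => cos θ ^ 2)
      (fun θ => by simp) (by fun_prop) α
    rw [integral_abs_cos] at e1
    rw [integral_cos_sq_period] at e2
    have hgeq : g = fun θ => 2 - π * τ * |cos (2 * θ - α)| +
        τ ^ 2 / (1 - p) ^ 2 * cos (2 * θ - α) ^ 2 := by
      ext θ
      simp only [hg]
      rw [abs_mul, abs_of_nonneg hτ0]
      ring
    rw [hgeq, intervalIntegral.integral_add (Continuous.intervalIntegrable (by fun_prop) _ _)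
      (Continuous.intervalIntegrable (by fun_prop) _ _), intervalIntegral.integral_sub
      (Continuous.intervalIntegrable (by fun_prop) _ _)
      (Continuous.intervalIntegrable (by fun_prop) _ _), intervalIntegral.integral_const_mul,
      intervalIntegral.integral_const_mul, e1, e2]
    have hp1 : 1 - p ≠ 0 := by linarith
    simp
    field_simp
    ring
  have hpt : ∀ θ, ‖f θ + f (θ + π / 2) + f (θ + π) + f (θ + 3 * π / 2) - (g θ : ℂ)‖ ≤
      260 * (τ ^ 4 + τ ^ 3 * p) := by
    intro θ
    set u := τ * cos (2 * θ - α) with hu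
    have hcos := abs_cos_le_one (2 * θ - α)
    have huτ : |u| ≤ τ := by
      rw [hu, abs_mul, abs_of_nonneg hτ0]
      exact mul_le_of_le_one_right hτ0 hcos
    have c1 : τ * cos (2 * (θ + π / 2) - α) = -u := by
      rw [show 2 * (θ + π / 2) - α = 2 * θ - α + π by ring, cos_add_pi, hu]; ring
    have c2 : τ * cos (2 * (θ + π) - α) = u := by
      rw [show 2 * (θ + π) - α = 2 * θ - α + 2 * π by ring, cos_add_two_pi]
    have c3 : τ * cos (2 * (θ + 3 * π / 2) - α) = -u := by
      rw [show 2 * (θ + 3 * π / 2) - α = 2 * θ - α + π + 2 * π by ring, cos_add_two_pi,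
        cos_add_pi, hu]; ring
    have t3c : cos (θ + 3 * π / 2) = sin θ := by
      rw [show θ + 3 * π / 2 = θ + π / 2 + π by ring, cos_add_pi, cos_add_pi_div_two, neg_neg]
    have t3s : sin (θ + 3 * π / 2) = -cos θ := by
      rw [show θ + 3 * π / 2 = θ + π / 2 + π by ring, sin_add_pi, sin_add_pi_div_two]
    have d0 : chord y θ = -(y.re * cos θ + y.im * sin θ) +
        √(1 - p + (y.re * cos θ + y.im * sin θ) ^ 2) := rfl
    have d1 : chord y (θ + π / 2) = -(y.im * cos θ - y.re * sin θ) +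
        √(1 - p + (y.im * cos θ - y.re * sin θ) ^ 2) := by
      rw [chord, cos_add_pi_div_two, sin_add_pi_div_two, ← hp]; ring_nf
    have d2 : chord y (θ + π) = (y.re * cos θ + y.im * sin θ) +
        √(1 - p + (y.re * cos θ + y.im * sin θ) ^ 2) := by
      rw [chord, cos_add_pi, sin_add_pi, ← hp]; ring_nf
    have d3 : chord y (θ + 3 * π / 2) = (y.im * cos θ - y.re * sin θ) +
        √(1 - p + (y.im * cos θ - y.re * sin θ) ^ 2) := by
      rw [chord, t3c, t3s, ← hp]; ring_nf
    simp only [hf, hg]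
    rw [c1, c2, c3, d0, d1, d2, d3, ← hu]
    have hb : (y.re * cos θ + y.im * sin θ) ^ 2 + (y.im * cos θ - y.re * sin θ) ^ 2 = p := by
      rw [hp, Complex.normSq_apply]
      linear_combination (y.re * y.re + y.im * y.im) * sin_sq_add_cos_sq θ
    refine (norm_sum_rayIntegral_sub_le hb hy (huτ.trans hτ)).trans ?_
    have : u ^ 4 ≤ τ ^ 4 := by
      rw [show u ^ 4 = |u| ^ 4 by rw [← abs_pow, abs_of_nonneg (by positivity)]]
      gcongr
    gcongr
  have hsub : 4 * (raySum τ α y - π * ((1 - τ + τ ^ 2 / (4 * (1 - p) ^ 2) : ℝ) : ℂ)) =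
      ∫ θ in -π..π, (f θ + f (θ + π / 2) + f (θ + π) + f (θ + 3 * π / 2) - (g θ : ℂ)) := by
    have hs : ∀ a, IntervalIntegrable (fun θ => f (θ + a)) volume (-π) π := fun a => by
      have := (hfi (-π + a) (π + a)).comp_add_right a
      simpa using this
    have hgi : IntervalIntegrable (fun θ => (g θ : ℂ)) volume (-π) π :=
      (Complex.continuous_ofReal.comp hgc).intervalIntegrable _ _
    rw [intervalIntegral.integral_sub ((((hfi _ _).add (hs _)).add (hs _)).add (hs _))
      hgi, ← hfour,
      intervalIntegral.integral_ofReal, hgint, raySum]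
    push_cast
    ring
  have hn := intervalIntegral.norm_integral_le_of_norm_le_const (a := -π) (b := π)
    (fun θ _ => hpt θ)
  rw [← hsub, norm_mul, show π - -π = 2 * π by ring, abs_of_pos (by positivity)] at hn
  have h4 : ‖(4 : ℂ)‖ = 4 := by norm_num
  rw [h4] at hn
  linarith

lemma norm_raySum_le {τ : ℝ} (hτ : 0 < τ) (α : ℝ) {y : ℂ} (hy : Complex.normSq y ≤ 1) :
    ‖raySum τ α y‖ ≤ π * (36 / √τ) := by
  have hlam : 0 < 1 / √τ := by positivity
  have hpos : ∀ θ : ℝ, 0 < 1 + (τ * cos (2 * θ - α)) ^ 2 := fun θ => by positivity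
  have hc : Continuous fun θ => (1 + (τ * cos (2 * θ - α)) ^ 2)⁻¹ :=
    Continuous.inv₀ (by fun_prop) fun θ => (hpos θ).ne'
  have h := intervalIntegral.norm_integral_le_of_norm_le (μ := volume) (a := -π) (b := π)
    (by linarith [pi_pos]) (f := fun θ => rayIntegral (τ * cos (2 * θ - α)) (chord y θ))
    (g := fun θ => 9 * (1 / √τ + (1 / √τ)⁻¹ * (1 + (τ * cos (2 * θ - α)) ^ 2)⁻¹))
    (ae_of_all _ fun θ _ => norm_rayIntegral_le_div (chord_nonneg hy θ) (chord_le_two hy θ) hlam)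
    (Continuous.intervalIntegrable (by fun_prop) _ _)
  refine h.trans ?_
  rw [intervalIntegral.integral_const_mul, intervalIntegral.integral_add (by simp)
    (Continuous.intervalIntegrable (by fun_prop) _ _), intervalIntegral.integral_const_mul]
  have h2 := integral_inv_one_add_sq_mul_cos_sq_le hτ α
  have h3 : (1 / √τ)⁻¹ * ∫ θ in -π..π, (1 + (τ * cos (2 * θ - α)) ^ 2)⁻¹ ≤
      (1 / √τ)⁻¹ * (2 * π / τ) := by gcongr
  have h4 : (1 / √τ)⁻¹ * (2 * π / τ) = 2 * π / √τ := by
    have : τ = √τ * √τ := (Real.mul_self_sqrt hτ.le).symm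
    rw [one_div, inv_inv]
    nth_rewrite 2 [this]
    field_simp
  have h5 : ∫ _ in -π..π, 1 / √τ = 2 * π / √τ := by simp; ring
  rw [h5]
  have h6 : π * (36 / √τ) = 9 * (2 * π / √τ + 2 * π / √τ) := by ring
  linarith

end Angular

/-! ### The characteristic function of a single star -/

section SingleStar

open Set
open scoped RealInnerProductSpace

/-- The shear at the origin of a star of unit mass at `w`, as a complex number; this is
`1 / conj w ^ 2`. -/
noncomputable def shearKernel (w : ℂ) : ℂ := w ^ 2 / (Complex.normSq w : ℂ) ^ 2

/-- The unit disk in coordinates in which the point `y` of the disk is the origin. -/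
def shiftedDisk (y : ℂ) : Set ℂ := {w | ‖w + y‖ ≤ 1}

/-- The law of the shear at the point `y` due to a star of unit mass that is uniformly distributed
in the unit disk. -/
noncomputable def starLaw (y : ℂ) : Measure ℂ :=
  (ProbabilityTheory.cond volume (shiftedDisk y)).map shearKernel

lemma measurable_shearKernel : Measurable shearKernel := by
  unfold shearKernel
  have : Measurable fun w : ℂ => (Complex.normSq w : ℂ) := by
    exact Complex.measurable_ofReal.comp Complex.continuous_normSq.measurable
  fun_prop

lemma shearKernel_real_mul (r : ℝ) (w : ℂ) :
    shearKernel ((r : ℂ) * w) = ((r ^ 2)⁻¹ : ℝ) * shearKernel w := by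
  rcases eq_or_ne r 0 with rfl | hr
  · simp [shearKernel]
  have hr' : (r : ℂ) ≠ 0 := by exact_mod_cast hr
  unfold shearKernel
  rw [Complex.normSq_mul, Complex.normSq_ofReal]
  push_cast
  rcases eq_or_ne ((Complex.normSq w : ℝ) : ℂ) 0 with h0 | h0
  · simp [h0]
  field_simp

lemma shiftedDisk_eq (y : ℂ) : shiftedDisk y = Metric.closedBall (-y) 1 := by
  ext w; simp [shiftedDisk, dist_eq_norm]

lemma measurableSet_shiftedDisk (y : ℂ) : MeasurableSet (shiftedDisk y) := by
  rw [shiftedDisk_eq]; exact Metric.isClosed_closedBall.measurableSet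

lemma volume_shiftedDisk (y : ℂ) : volume (shiftedDisk y) = ENNReal.ofReal Real.pi := by
  rw [shiftedDisk_eq, Complex.volume_closedBall]
  simp [← NNReal.coe_real_pi, ENNReal.ofReal_coe_nnreal]

instance isProbabilityMeasure_starLaw (y : ℂ) : IsProbabilityMeasure (starLaw y) := by
  have : IsProbabilityMeasure (ProbabilityTheory.cond volume (shiftedDisk y)) :=
    cond_isProbabilityMeasure_of_finite
      (by rw [volume_shiftedDisk]; simp [Real.pi_pos]) (by rw [volume_shiftedDisk]; simp)
  exact Measure.isProbabilityMeasure_map measurable_shearKernel.aemeasurable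

lemma charFun_starLaw_eq_integral (y s : ℂ) :
    charFun (starLaw y) s =
      (Real.pi : ℂ)⁻¹ * ∫ w in shiftedDisk y, Complex.exp (⟪shearKernel w, s⟫ * Complex.I) := by
  rw [charFun_apply, starLaw, integral_map measurable_shearKernel.aemeasurable
    (Continuous.aestronglyMeasurable (by fun_prop)), ProbabilityTheory.cond, integral_smul_measure,
    volume_shiftedDisk, ENNReal.toReal_inv, ENNReal.toReal_ofReal Real.pi_pos.le,
    Complex.real_smul, Complex.ofReal_inv]

lemma inner_shearKernel_polar (r θ : ℝ) (s : ℂ) :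
    ⟪shearKernel ((r : ℂ) * (Real.cos θ + Real.sin θ * Complex.I)), s⟫ =
      ‖s‖ * Real.cos (2 * θ - s.arg) / r ^ 2 := by
  have h1 : shearKernel ((Real.cos θ : ℂ) + Real.sin θ * Complex.I) =
      (Real.cos (2 * θ) : ℂ) + Real.sin (2 * θ) * Complex.I := by
    have hn : Complex.normSq ((Real.cos θ : ℂ) + Real.sin θ * Complex.I) = 1 := by
      rw [Complex.normSq_add_mul_I, Real.cos_sq_add_sin_sq]
    rw [shearKernel, hn, Real.cos_two_mul', Real.sin_two_mul]
    rw [Complex.ofReal_sub, Complex.ofReal_mul, Complex.ofReal_mul, Complex.ofReal_pow,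
      Complex.ofReal_pow, Complex.ofReal_one, one_pow, div_one]
    push_cast
    linear_combination (Complex.sin θ ^ 2) * Complex.I_sq
  rw [shearKernel_real_mul, h1, ← Complex.real_smul, real_inner_smul_left, Complex.inner,
    Real.cos_sub]
  have hre : ‖s‖ * Real.cos s.arg = s.re := Complex.norm_mul_cos_arg s
  have him : ‖s‖ * Real.sin s.arg = s.im := Complex.norm_mul_sin_arg s
  simp only [Complex.mul_re, map_add, map_mul, Complex.conj_ofReal, Complex.conj_I, Complex.add_re,
    Complex.add_im, Complex.mul_im, Complex.ofReal_re, Complex.ofReal_im, Complex.neg_re,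
    Complex.neg_im, Complex.I_re, Complex.I_im]
  rw [← hre, ← him]
  ring

/-- In polar coordinates about the point at which the shear is taken, the characteristic function is
the sum over all directions of the contributions of the rays. -/
lemma charFun_starLaw {y : ℂ} (hy : Complex.normSq y ≤ 1) (s : ℂ) :
    charFun (starLaw y) s = (Real.pi : ℂ)⁻¹ * raySum ‖s‖ s.arg y := by
  rw [charFun_starLaw_eq_integral]
  congr 1
  rw [← integral_indicator (measurableSet_shiftedDisk y), ← Complex.integral_comp_polarCoord_symm,
    polarCoord_target, raySum, intervalIntegral.integral_of_le (by linarith [Real.pi_pos]),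
    integral_Ioc_eq_integral_Ioo, Measure.volume_eq_prod, ← Measure.prod_restrict]
  set F : ℝ × ℝ → ℂ := fun p => if p.1 ≤ chord y p.2 then
    (p.1 : ℂ) * Complex.exp ((‖s‖ * Real.cos (2 * p.2 - s.arg) / p.1 ^ 2 : ℝ) * Complex.I) else 0
    with hF
  have hFm : Measurable F := by
    refine Measurable.ite ?_ ?_ measurable_const
    · exact measurableSet_le measurable_fst ((continuous_chord y).measurable.comp measurable_snd)
    · fun_prop
  have hae : ∀ᵐ p : ℝ × ℝ ∂(volume.restrict (Ioi (0 : ℝ))).prod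
      (volume.restrict (Ioo (-Real.pi) Real.pi)), 0 < p.1 := by
    rw [Measure.prod_restrict]
    filter_upwards [ae_restrict_mem (measurableSet_Ioi.prod measurableSet_Ioo)] with p hp
    exact hp.1
  have hcongr : ∀ p : ℝ × ℝ, 0 < p.1 → p.1 • (shiftedDisk y).indicator
      (fun w => Complex.exp (⟪shearKernel w, s⟫ * Complex.I)) (Complex.polarCoord.symm p) =
        F p := by
    intro p hp
    classical
    rw [Complex.polarCoord_symm_apply, indicator_apply, inner_shearKernel_polar]
    have : (p.1 : ℂ) * (Real.cos p.2 + Real.sin p.2 * Complex.I) ∈ shiftedDisk y ↔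
        p.1 ≤ chord y p.2 := norm_add_le_one_iff_le_chord hy hp p.2
    simp only [this, hF]
    split_ifs
    · rw [Complex.real_smul]
    · simp
  rw [integral_congr_ae (hae.mono fun p hp => hcongr p hp)]
  have hint : Integrable F ((volume.restrict (Ioi (0 : ℝ))).prod
      (volume.restrict (Ioo (-Real.pi) Real.pi))) := by
    have h1 : Integrable ((Ioc (0 : ℝ) 2).indicator fun _ => (2 : ℝ))
        (volume.restrict (Ioi (0 : ℝ))) := by
      rw [integrable_indicator_iff measurableSet_Ioc]
      exact (integrableOn_const (by simp)).mono_measure Measure.restrict_le_self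
    have h2 := h1.mul_prod (integrable_const (1 : ℝ)
      (μ := volume.restrict (Ioo (-Real.pi) Real.pi)))
    refine h2.mono' hFm.aestronglyMeasurable (hae.mono fun p hp => ?_)
    simp only [hF, mul_one]
    split_ifs with h
    · have h2 := h.trans (chord_le_two hy p.2)
      rw [norm_cexp_ofReal_mul_I_mul, abs_of_pos hp, indicator_of_mem (by exact ⟨hp, h2⟩)]
      exact h2
    · simp only [norm_zero]
      exact indicator_nonneg (fun _ _ => by norm_num) _
  rw [integral_prod_symm _ hint]
  refine integral_congr_ae (ae_of_all _ fun θ => ?_)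
  simp only [hF]
  rw [rayIntegral_eq_integral_Ioi (chord_nonneg hy θ)]

/-- The expansion of the characteristic function of a star at the origin. -/
lemma norm_charFun_starLaw_sub_le {y s : ℂ} (hy : Complex.normSq y ≤ 1 / 4) (hs : ‖s‖ ≤ 1 / 4) :
    ‖charFun (starLaw y) s -
      ((1 - ‖s‖ + ‖s‖ ^ 2 / (4 * (1 - Complex.normSq y) ^ 2) : ℝ) : ℂ)‖ ≤
      130 * (‖s‖ ^ 4 + ‖s‖ ^ 3 * Complex.normSq y) := by
  have h := norm_raySum_sub_le (norm_nonneg s) hs s.arg hy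
  rw [charFun_starLaw (by linarith)]
  have hpi : (Real.pi : ℂ) ≠ 0 := by exact_mod_cast Real.pi_ne_zero
  set a := ((1 - ‖s‖ + ‖s‖ ^ 2 / (4 * (1 - Complex.normSq y) ^ 2) : ℝ) : ℂ)
  have e : (Real.pi : ℂ)⁻¹ * raySum ‖s‖ s.arg y - a =
      (Real.pi : ℂ)⁻¹ * (raySum ‖s‖ s.arg y - Real.pi * a) := by
    field_simp
  rw [e, norm_mul, norm_inv, Complex.norm_real, Real.norm_eq_abs, abs_of_pos Real.pi_pos,
    inv_mul_le_iff₀ Real.pi_pos]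
  exact h

lemma norm_charFun_starLaw_le {y s : ℂ} (hy : Complex.normSq y ≤ 1) (hs : s ≠ 0) :
    ‖charFun (starLaw y) s‖ ≤ 36 / √‖s‖ := by
  have h := norm_raySum_le (norm_pos_iff.2 hs) s.arg hy
  rw [charFun_starLaw hy, norm_mul, norm_inv, Complex.norm_real, Real.norm_eq_abs,
    abs_of_pos Real.pi_pos, inv_mul_le_iff₀ Real.pi_pos]
  exact h

/-- The variance of the square of a unimodular random variable `Z` is at most four times that of
`Z`, as squaring is 2-Lipschitz on the unit disk. -/
lemma one_sub_norm_integral_sq_le {Ω : Type*} [MeasurableSpace Ω] (P : Measure Ω)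
    [IsProbabilityMeasure P] {Z : Ω → ℂ} (hm : AEStronglyMeasurable Z P) (hZ : ∀ ω, ‖Z ω‖ = 1) :
    1 - ‖∫ ω, Z ω ^ 2 ∂P‖ ^ 2 ≤ 4 * (1 - ‖∫ ω, Z ω ∂P‖ ^ 2) := by
  have hvar : ∀ (W : Ω → ℂ) (c : ℂ), AEStronglyMeasurable W P → (∀ ω, ‖W ω‖ = 1) →
      Integrable (fun ω => ‖W ω - c‖ ^ 2) P ∧
      ∫ ω, ‖W ω - c‖ ^ 2 ∂P = 1 - ‖∫ ω, W ω ∂P‖ ^ 2 + ‖(∫ ω, W ω ∂P) - c‖ ^ 2 := by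
    intro W c hWm hW
    have hWi : Integrable W P := Integrable.of_bound hWm 1 (ae_of_all _ fun ω => (hW ω).le)
    have e : ∀ a : ℂ, ‖a - c‖ ^ 2 = ‖a‖ ^ 2 + ‖c‖ ^ 2 - 2 * ⟪c, a⟫ := by
      intro a
      rw [norm_sub_sq_real, real_inner_comm]; ring
    have hin : Integrable (fun ω => ⟪c, W ω⟫) P := hWi.const_inner c
    simp_rw [e, hW]
    refine ⟨(integrable_const _).sub (hin.const_mul 2), ?_⟩
    rw [integral_sub (integrable_const _) (hin.const_mul 2), integral_const_mul,
      integral_inner hWi, integral_const]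
    simp only [probReal_univ, one_smul]
    ring
  set a := ∫ ω, Z ω ∂P with ha
  obtain ⟨i1, v1⟩ := hvar Z a hm hZ
  obtain ⟨i2, v2⟩ := hvar (fun ω => Z ω ^ 2) (a ^ 2) (hm.pow 2) (fun ω => by simp [hZ])
  rw [← ha, sub_self, norm_zero] at v1
  have han : ‖a‖ ≤ 1 := by
    have := norm_integral_le_of_norm_le_const (μ := P) (f := Z) (C := 1)
      (ae_of_all _ fun ω => (hZ ω).le)
    simpa using this
  have hle : ∫ ω, ‖Z ω ^ 2 - a ^ 2‖ ^ 2 ∂P ≤ ∫ ω, 4 * ‖Z ω - a‖ ^ 2 ∂P := by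
    refine integral_mono i2 (i1.const_mul 4) fun ω => ?_
    have h1 : ‖Z ω + a‖ ≤ 2 := (norm_add_le _ _).trans (by rw [hZ]; linarith)
    have h2 : ‖Z ω ^ 2 - a ^ 2‖ = ‖Z ω + a‖ * ‖Z ω - a‖ := by rw [sq_sub_sq, norm_mul]
    simp only [h2, mul_pow]
    have : ‖Z ω + a‖ ^ 2 ≤ 4 := by nlinarith [norm_nonneg (Z ω + a)]
    gcongr
  rw [integral_const_mul, v1, v2] at hle
  have : 0 ≤ ‖(∫ ω, Z ω ^ 2 ∂P) - a ^ 2‖ ^ 2 := by positivity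
  linarith

lemma one_sub_norm_charFun_two_smul_le {E : Type*} [NormedAddCommGroup E] [InnerProductSpace ℝ E]
    [MeasurableSpace E] [BorelSpace E] [SecondCountableTopology E] (μ : Measure E)
    [IsProbabilityMeasure μ] (t : E) :
    1 - ‖charFun μ ((2 : ℝ) • t)‖ ^ 2 ≤ 4 * (1 - ‖charFun μ t‖ ^ 2) := by
  have h := one_sub_norm_integral_sq_le μ
    (Z := fun x => Complex.exp (⟪x, t⟫ * Complex.I))
    (Continuous.aestronglyMeasurable (by fun_prop)) (fun ω => Complex.norm_exp_ofReal_mul_I _)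
  rw [charFun_apply, charFun_apply]
  convert! h using 6
  rw [← Complex.exp_nat_mul, inner_smul_right]
  push_cast
  ring_nf

lemma one_sub_norm_charFun_two_pow_smul_le {E : Type*} [NormedAddCommGroup E]
    [InnerProductSpace ℝ E] [MeasurableSpace E] [BorelSpace E] [SecondCountableTopology E]
    (μ : Measure E) [IsProbabilityMeasure μ] (t : E) (k : ℕ) :
    1 - ‖charFun μ ((2 : ℝ) ^ k • t)‖ ^ 2 ≤ 4 ^ k * (1 - ‖charFun μ t‖ ^ 2) := by
  induction k with
  | zero => simp
  | succ k ih =>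
    rw [pow_succ' (2 : ℝ) k, pow_succ' (4 : ℝ) k, mul_smul]
    have := one_sub_norm_charFun_two_smul_le μ ((2 : ℝ) ^ k • t)
    linarith

/-- Away from zero the characteristic function is bounded away from one, uniformly in the position
`y`: it is small at infinity, and doubling the argument increases `1 - ‖φ‖ ^ 2` at most fourfold. -/
lemma exists_norm_charFun_starLaw_le {τ₀ : ℝ} (hτ₀ : 0 < τ₀) :
    ∃ q : ℝ, 0 ≤ q ∧ q < 1 ∧ ∀ y s : ℂ, Complex.normSq y ≤ 1 → τ₀ ≤ ‖s‖ →
      ‖charFun (starLaw y) s‖ ≤ q := by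
  obtain ⟨k, hk⟩ := pow_unbounded_of_one_lt (72 ^ 2 / τ₀) (by norm_num : (1 : ℝ) < 2)
  rw [div_lt_iff₀ hτ₀] at hk
  have h4 : (1 : ℝ) ≤ 4 ^ k := one_le_pow₀ (by norm_num)
  have hq : (0 : ℝ) ≤ 1 - 3 / 4 / 4 ^ k := by
    have : (3 / 4 : ℝ) / 4 ^ k ≤ 1 := by
      rw [div_le_one (by positivity)]; linarith
    linarith
  refine ⟨√(1 - 3 / 4 / 4 ^ k), Real.sqrt_nonneg _, ?_, fun y s hy hs => ?_⟩
  · rw [Real.sqrt_lt' one_pos]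
    have : (0 : ℝ) < 3 / 4 / 4 ^ k := by positivity
    linarith
  · have hnorm : ‖(2 : ℝ) ^ k • s‖ = 2 ^ k * ‖s‖ := by
      rw [norm_smul]; simp
    have hbig : 72 ^ 2 ≤ ‖(2 : ℝ) ^ k • s‖ := by
      rw [hnorm]
      have : (2 : ℝ) ^ k * τ₀ ≤ 2 ^ k * ‖s‖ := by gcongr
      linarith
    have hne : (2 : ℝ) ^ k • s ≠ 0 := norm_pos_iff.1 (by linarith)
    have h1 := norm_charFun_starLaw_le hy hne
    have h2 : 36 / √‖(2 : ℝ) ^ k • s‖ ≤ 1 / 2 := by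
      have : 72 ≤ √‖(2 : ℝ) ^ k • s‖ := Real.le_sqrt_of_sq_le hbig
      rw [div_le_div_iff₀ (by linarith) (by norm_num)]
      linarith
    have h3 : ‖charFun (starLaw y) ((2 : ℝ) ^ k • s)‖ ^ 2 ≤ (1 / 2) ^ 2 := by
      gcongr; linarith
    have h5 := one_sub_norm_charFun_two_pow_smul_le (starLaw y) s k
    refine Real.le_sqrt_of_sq_le ?_
    have h6 : 3 / 4 / 4 ^ k ≤ 1 - ‖charFun (starLaw y) s‖ ^ 2 := by
      rw [div_le_iff₀ (by positivity)]
      linarith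
    linarith

end SingleStar

/-! ### Powers of the characteristic function -/

section Power

/-- The approximation to the characteristic function of the shear of `g` stars, as a function of
`T = κ ‖t‖`; `n` is the mean number of stars closer to the centre than `x`. -/
noncomputable def charApprox (n : ℝ) (g : ℕ) (T : ℝ) : ℝ :=
  Real.exp (-T) * (1 - T ^ 2 / (4 * g) + (n * T ^ 2 / 2 - T ^ 3 / 12 + T ^ 4 / 32) / (g : ℝ) ^ 2)

lemma one_add_pow_mul_exp_le (n : ℕ) (hn : n ≠ 0) {T : ℝ} (hT : 0 ≤ T) :
    (1 + T) ^ n * Real.exp (-T / 2) ≤ (2 * n : ℝ) ^ n := by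
  have hn' : (1 : ℝ) ≤ n := by exact_mod_cast Nat.one_le_iff_ne_zero.2 hn
  have h1 : 1 + T ≤ 2 * n * Real.exp (T / (2 * n)) := by
    have h := Real.add_one_le_exp (T / (2 * n))
    have h2 : 2 * n * (T / (2 * n) + 1) ≤ 2 * n * Real.exp (T / (2 * n)) := by gcongr
    have h3 : 2 * n * (T / (2 * n) + 1) = T + 2 * n := by field_simp
    linarith
  have h2 : (1 + T) ^ n ≤ (2 * n : ℝ) ^ n * Real.exp (T / 2) := by
    calc (1 + T) ^ n ≤ (2 * n * Real.exp (T / (2 * n))) ^ n := by gcongr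
      _ = (2 * n : ℝ) ^ n * Real.exp (T / 2) := by
        rw [mul_pow, ← Real.exp_nat_mul]
        congr 2
        field_simp
  calc (1 + T) ^ n * Real.exp (-T / 2)
      ≤ (2 * n : ℝ) ^ n * Real.exp (T / 2) * Real.exp (-T / 2) := by gcongr
    _ = (2 * n : ℝ) ^ n := by
      rw [mul_assoc, ← Real.exp_add, show T / 2 + -T / 2 = 0 by ring, Real.exp_zero, mul_one]

lemma norm_one_add_pow_sub_le (δ : ℂ) (g : ℕ) :
    ‖(1 + δ) ^ g - (1 + g * δ + (g * (g - 1) / 2 : ℝ) * δ ^ 2)‖ ≤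
      (g * ‖δ‖) ^ 3 * Real.exp (g * ‖δ‖) := by
  induction g with
  | zero => simp
  | succ g ih =>
    set d := ‖δ‖ with hd
    have hd0 : 0 ≤ d := norm_nonneg _
    have e : (1 + δ) ^ (g + 1) -
        (1 + (g + 1 : ℕ) * δ + (((g + 1 : ℕ) : ℝ) * (((g + 1 : ℕ) : ℝ) - 1) / 2 : ℝ) * δ ^ 2) =
        (1 + δ) * ((1 + δ) ^ g - (1 + g * δ + (g * (g - 1) / 2 : ℝ) * δ ^ 2)) +
          ((g : ℝ) * (g - 1) / 2 : ℝ) * δ ^ 3 := by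
      push_cast
      ring
    have h1 : ‖1 + δ‖ ≤ Real.exp d := by
      refine (norm_add_le _ _).trans ?_
      rw [norm_one, add_comm]
      exact Real.add_one_le_exp d
    have h2 : |(g : ℝ) * (g - 1) / 2| ≤ (g : ℝ) ^ 2 := by
      have : (0 : ℝ) ≤ g := g.cast_nonneg
      rcases Nat.eq_zero_or_pos g with h | h
      · simp [h]
      · have : (1 : ℝ) ≤ g := by exact_mod_cast h
        rw [abs_of_nonneg (by nlinarith)]
        nlinarith
    have h3 : Real.exp ((g + 1 : ℕ) * d) = Real.exp d * Real.exp (g * d) := by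
      rw [← Real.exp_add]; push_cast; ring_nf
    have h4 : 1 ≤ Real.exp d * Real.exp (g * d) := by
      rw [← h3]; exact Real.one_le_exp (by positivity)
    rw [e]
    calc ‖(1 + δ) * ((1 + δ) ^ g - (1 + g * δ + (g * (g - 1) / 2 : ℝ) * δ ^ 2)) +
          ((g : ℝ) * (g - 1) / 2 : ℝ) * δ ^ 3‖
        ≤ ‖1 + δ‖ * ‖(1 + δ) ^ g - (1 + g * δ + (g * (g - 1) / 2 : ℝ) * δ ^ 2)‖ +
          |(g : ℝ) * (g - 1) / 2| * d ^ 3 := by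
          refine (norm_add_le _ _).trans ?_
          rw [norm_mul, norm_mul, norm_pow, Complex.norm_real, Real.norm_eq_abs]
      _ ≤ Real.exp d * ((g * d) ^ 3 * Real.exp (g * d)) + (g : ℝ) ^ 2 * d ^ 3 * 1 := by
          rw [mul_one]; gcongr
      _ ≤ Real.exp d * ((g * d) ^ 3 * Real.exp (g * d)) +
          (g : ℝ) ^ 2 * d ^ 3 * (Real.exp d * Real.exp (g * d)) := by gcongr
      _ = ((g : ℝ) ^ 3 + (g : ℝ) ^ 2) * d ^ 3 * (Real.exp d * Real.exp (g * d)) := by ring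
      _ ≤ ((g : ℝ) + 1) ^ 3 * d ^ 3 * (Real.exp d * Real.exp (g * d)) := by
          gcongr
          have : (0 : ℝ) ≤ g := g.cast_nonneg
          nlinarith [sq_nonneg (g : ℝ)]
      _ = ((g + 1 : ℕ) * d) ^ 3 * Real.exp ((g + 1 : ℕ) * d) := by
          rw [h3]; push_cast; ring

/-- Factoring out `exp (-τ)` removes the first-order term of the expansion of a single
characteristic function. -/
lemma norm_mul_exp_sub_le {φ : ℂ} {τ p : ℝ} (hτ0 : 0 ≤ τ) (hτ : τ ≤ 1 / 4) (hp0 : 0 ≤ p)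
    (hp : p ≤ 1 / 4)
    (h : ‖φ - ((1 - τ + τ ^ 2 / (4 * (1 - p) ^ 2) : ℝ) : ℂ)‖ ≤ 130 * (τ ^ 4 + τ ^ 3 * p)) :
    ‖φ * Real.exp τ - 1 - ((-τ ^ 2 / 4 + p * τ ^ 2 / 2 - τ ^ 3 / 12 : ℝ) : ℂ)‖ ≤
      300 * (τ ^ 4 + τ ^ 3 * p + τ ^ 2 * p ^ 2) := by
  have hexp := Real.exp_bound (x := τ) (by rw [abs_of_nonneg hτ0]; linarith) (n := 4) (by norm_num)
  rw [abs_of_nonneg hτ0] at hexp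
  norm_num [Finset.sum_range_succ, Nat.factorial] at hexp
  have hexp2 : Real.exp τ ≤ 2 := by
    have h1 : Real.exp τ ≤ Real.exp (1 / 4) := Real.exp_le_exp.2 hτ
    have h2 := Real.exp_bound' (x := 1 / 4) (by norm_num) (by norm_num) (n := 1) (by norm_num)
    norm_num [Finset.sum_range_succ, Nat.factorial] at h2
    linarith
  obtain ⟨r, hr⟩ : ∃ r, r = Real.exp τ - (1 + τ + τ ^ 2 / 2 + τ ^ 3 / 6) := ⟨_, rfl⟩
  rw [← hr] at hexp
  have hexpeq : Real.exp τ = 1 + τ + τ ^ 2 / 2 + τ ^ 3 / 6 + r := by rw [hr]; ring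
  have hp1 : 0 < 1 - p := by linarith
  obtain ⟨w, hw⟩ : ∃ w, w = 1 / (1 - p) ^ 2 - 1 - 2 * p := ⟨_, rfl⟩
  have hwb : 0 ≤ w ∧ w ≤ 6 * p ^ 2 := by
    have e : w = p ^ 2 * (3 - 2 * p) / (1 - p) ^ 2 := by
      rw [hw]; field_simp; ring
    rw [e]
    constructor
    · have : 0 ≤ 3 - 2 * p := by linarith
      positivity
    · rw [div_le_iff₀ (by positivity)]
      have : (3 - 2 * p) ≤ 6 * (1 - p) ^ 2 := by nlinarith
      nlinarith [sq_nonneg p]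
  have hq : τ ^ 2 / (4 * (1 - p) ^ 2) = τ ^ 2 / 4 * (1 + 2 * p + w) := by
    rw [hw]; field_simp; ring
  rw [hq] at h
  obtain ⟨ψ, hψ⟩ : ∃ ψ, ψ = φ - ((1 - τ + τ ^ 2 / 4 * (1 + 2 * p + w) : ℝ) : ℂ) := ⟨_, rfl⟩
  rw [← hψ] at h
  have hφ : φ = ψ + ((1 - τ + τ ^ 2 / 4 * (1 + 2 * p + w) : ℝ) : ℂ) := by rw [hψ]; ring
  have hmain : φ * Real.exp τ - 1 - ((-τ ^ 2 / 4 + p * τ ^ 2 / 2 - τ ^ 3 / 12 : ℝ) : ℂ) =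
      ψ * Real.exp τ + (((1 - τ + τ ^ 2 / 4 * (1 + 2 * p + w)) * Real.exp τ - 1 -
        (-τ ^ 2 / 4 + p * τ ^ 2 / 2 - τ ^ 3 / 12) : ℝ) : ℂ) := by
    rw [hφ]; push_cast; ring
  have hreal : (1 - τ + τ ^ 2 / 4 * (1 + 2 * p + w)) * Real.exp τ - 1 -
        (-τ ^ 2 / 4 + p * τ ^ 2 / 2 - τ ^ 3 / 12) =
      τ ^ 4 * (-1 / 24 + τ / 24) + τ ^ 3 * p * (1 / 2 + τ / 4 + τ ^ 2 / 12) +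
      r * (1 - τ + τ ^ 2 / 4 + p * τ ^ 2 / 2) + τ ^ 2 / 4 * w * Real.exp τ := by
    have : τ ^ 2 / 4 * w * Real.exp τ = τ ^ 2 / 4 * w * (1 + τ + τ ^ 2 / 2 + τ ^ 3 / 6 + r) := by
      rw [hexpeq]
    rw [this, hexpeq]
    ring
  have b1 : |τ ^ 4 * (-1 / 24 + τ / 24)| ≤ τ ^ 4 * 1 := by
    rw [abs_mul, abs_of_nonneg (by positivity : 0 ≤ τ ^ 4)]
    gcongr
    rw [abs_le]; constructor <;> linarith
  have b2 : |τ ^ 3 * p * (1 / 2 + τ / 4 + τ ^ 2 / 12)| ≤ τ ^ 3 * p * 1 := by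
    rw [abs_mul, abs_of_nonneg (by positivity : 0 ≤ τ ^ 3 * p)]
    gcongr
    rw [abs_le]; constructor <;> nlinarith
  have b3 : |r * (1 - τ + τ ^ 2 / 4 + p * τ ^ 2 / 2)| ≤ τ ^ 4 * 1 := by
    rw [abs_mul]
    have : |1 - τ + τ ^ 2 / 4 + p * τ ^ 2 / 2| ≤ 1 := by
      rw [abs_le]; constructor <;> nlinarith [mul_nonneg hp0 (sq_nonneg τ)]
    have h4 : 0 ≤ τ ^ 4 := by positivity
    have : |r| ≤ τ ^ 4 := by linarith
    gcongr
  have b4 : |τ ^ 2 / 4 * w * Real.exp τ| ≤ τ ^ 2 / 4 * (6 * p ^ 2) * 2 := by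
    have := hwb.1
    rw [abs_of_nonneg (by positivity)]
    gcongr
    exact hwb.2
  have b5 : ‖ψ * Real.exp τ‖ ≤ 130 * (τ ^ 4 + τ ^ 3 * p) * 2 := by
    rw [norm_mul, Complex.norm_real, Real.norm_eq_abs, abs_of_pos (Real.exp_pos τ)]
    gcongr
  rw [hmain]
  refine (norm_add_le _ _).trans ?_
  rw [Complex.norm_real, Real.norm_eq_abs, hreal]
  have c1 := abs_add_le (τ ^ 4 * (-1 / 24 + τ / 24) + τ ^ 3 * p * (1 / 2 + τ / 4 + τ ^ 2 / 12) +
      r * (1 - τ + τ ^ 2 / 4 + p * τ ^ 2 / 2)) (τ ^ 2 / 4 * w * Real.exp τ)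
  have c2 := abs_add_three (τ ^ 4 * (-1 / 24 + τ / 24)) (τ ^ 3 * p * (1 / 2 + τ / 4 + τ ^ 2 / 12))
      (r * (1 - τ + τ ^ 2 / 4 + p * τ ^ 2 / 2))
  have d1 : 0 ≤ τ ^ 4 := by positivity
  have d2 : 0 ≤ τ ^ 3 * p := by positivity
  have d3 : 0 ≤ τ ^ 2 * p ^ 2 := by positivity
  linarith

lemma sq_add_cube_add_pow_four_le {T n : ℝ} (hT : 0 ≤ T) (hn : 0 ≤ n) :
    T ^ 4 + T ^ 3 * n + T ^ 2 * n ^ 2 + n * T ^ 2 + T ^ 3 + T ^ 2 + 1 ≤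
      6 * ((1 + n) ^ 2 * (1 + T) ^ 4) := by
  have e : 6 * ((1 + n) ^ 2 * (1 + T) ^ 4) -
      (T ^ 4 + T ^ 3 * n + T ^ 2 * n ^ 2 + n * T ^ 2 + T ^ 3 + T ^ 2 + 1) =
      (5 + 24 * T + 35 * T ^ 2 + 23 * T ^ 3 + 5 * T ^ 4) +
        n * (12 + 48 * T + 71 * T ^ 2 + 47 * T ^ 3 + 12 * T ^ 4) +
        n ^ 2 * (6 + 24 * T + 35 * T ^ 2 + 24 * T ^ 3 + 6 * T ^ 4) := by ring
  have : 0 ≤ 6 * ((1 + n) ^ 2 * (1 + T) ^ 4) -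
      (T ^ 4 + T ^ 3 * n + T ^ 2 * n ^ 2 + n * T ^ 2 + T ^ 3 + T ^ 2 + 1) := by
    rw [e]; positivity
  linarith

lemma one_add_mul_add_sq_sub_eq {δ G : ℂ} {T c : ℝ} {g : ℕ} (hg : 1 ≤ g)
    (hgδ : (g : ℂ) * δ = ((-T ^ 2 / (4 * g) + c / (g : ℝ) ^ 2 : ℝ) : ℂ) + G) :
    1 + (g : ℂ) * δ + (g * (g - 1) / 2 : ℝ) * δ ^ 2 -
      ((1 - T ^ 2 / (4 * g) + (c + T ^ 4 / 32) / (g : ℝ) ^ 2 : ℝ) : ℂ) =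
      G - ((T ^ 2 / (4 * g) : ℝ) : ℂ) * (((c / (g : ℝ) ^ 2 : ℝ) : ℂ) + G) +
        (((c / (g : ℝ) ^ 2 : ℝ) : ℂ) + G) ^ 2 / 2 -
        (g * δ) ^ 2 * ((1 / (2 * g) : ℝ) : ℂ) := by
  have hgc : (g : ℂ) ≠ 0 := by exact_mod_cast (by omega : g ≠ 0)
  have e1 : ((g * (g - 1) / 2 : ℝ) : ℂ) * δ ^ 2 =
      (g * δ) ^ 2 / 2 - (g * δ) ^ 2 * ((1 / (2 * g) : ℝ) : ℂ) := by
    push_cast; field_simp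
  have e2 : ((g : ℂ) * δ) ^ 2 / 2 =
      (((-T ^ 2 / (4 * g) + c / (g : ℝ) ^ 2 : ℝ) : ℂ) + G) ^ 2 / 2 := by rw [hgδ]
  have e3 : 1 + (g : ℂ) * δ =
      1 + (((-T ^ 2 / (4 * g) + c / (g : ℝ) ^ 2 : ℝ) : ℂ) + G) := by rw [hgδ]
  rw [e1, e2, e3]
  push_cast
  field_simp
  ring

lemma norm_one_add_pow_sub_expansion_le {δ G : ℂ} {T c A : ℝ} {g : ℕ} (hg : 1 ≤ g) (hT : 0 ≤ T)
    (hA : 300 ≤ A) (hTA : T ^ 2 ≤ A) (hc : |c| ≤ A / 2) (hG : ‖G‖ ≤ A / 2 / (g : ℝ) ^ 3)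
    (hgδ : (g : ℂ) * δ = ((-T ^ 2 / (4 * g) + c / (g : ℝ) ^ 2 : ℝ) : ℂ) + G)
    (hδ : (g : ℝ) * ‖δ‖ ≤ T / 2) :
    ‖(1 + δ) ^ g - ((1 - T ^ 2 / (4 * g) + (c + T ^ 4 / 32) / (g : ℝ) ^ 2 : ℝ) : ℂ)‖ ≤
      (9 * A ^ 3 * Real.exp (T / 2)) / (g : ℝ) ^ 3 := by
  have hg1 : (1 : ℝ) ≤ g := by exact_mod_cast hg
  have hgpos : (0 : ℝ) < g := by linarith
  have hA0 : 0 < A := by linarith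
  have hdiff := one_add_mul_add_sq_sub_eq hg hgδ
  obtain ⟨F, hF⟩ : ∃ F : ℂ, F = ((c / (g : ℝ) ^ 2 : ℝ) : ℂ) + G := ⟨_, rfl⟩
  rw [← hF] at hdiff
  have hFle : ‖F‖ ≤ A / (g : ℝ) ^ 2 := by
    rw [hF]
    refine (norm_add_le _ _).trans ?_
    rw [Complex.norm_real, Real.norm_eq_abs, abs_div, abs_of_pos (by positivity : 0 < (g : ℝ) ^ 2)]
    have h1 : A / 2 / (g : ℝ) ^ 3 ≤ A / 2 / (g : ℝ) ^ 2 :=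
      div_le_div_of_nonneg_left (by positivity) (by positivity)
        (pow_le_pow_right₀ hg1 (by norm_num))
    calc |c| / (g : ℝ) ^ 2 + ‖G‖ ≤ (A / 2) / (g : ℝ) ^ 2 + (A / 2) / (g : ℝ) ^ 2 := by
          gcongr; linarith
      _ = A / (g : ℝ) ^ 2 := by ring
  have hgδle : ‖(g : ℂ) * δ‖ ≤ 2 * A / g := by
    have e : (g : ℂ) * δ = ((-T ^ 2 / (4 * g) : ℝ) : ℂ) + F := by
      rw [hgδ, hF]; push_cast; ring
    rw [e]
    refine (norm_add_le _ _).trans ?_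
    rw [Complex.norm_real, Real.norm_eq_abs, abs_div, abs_neg, abs_of_nonneg (sq_nonneg T),
      abs_of_pos (by positivity : 0 < 4 * (g : ℝ))]
    have h1 : T ^ 2 / (4 * g) ≤ A / g := by
      rw [div_le_div_iff₀ (by positivity) hgpos]
      nlinarith
    have h2 : A / (g : ℝ) ^ 2 ≤ A / g :=
      div_le_div_of_nonneg_left hA0.le hgpos (by nlinarith)
    calc T ^ 2 / (4 * g) + ‖F‖ ≤ A / g + A / g := by linarith
      _ = 2 * A / g := by ring
  have n1 : ‖((T ^ 2 / (4 * g) : ℝ) : ℂ) * F‖ ≤ A ^ 2 / 4 / (g : ℝ) ^ 3 := by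
    rw [norm_mul, Complex.norm_real, Real.norm_eq_abs, abs_of_nonneg (by positivity)]
    calc T ^ 2 / (4 * g) * ‖F‖ ≤ A / (4 * g) * (A / (g : ℝ) ^ 2) := by gcongr
      _ = A ^ 2 / 4 / (g : ℝ) ^ 3 := by field_simp
  have n2 : ‖F ^ 2 / 2‖ ≤ A ^ 2 / 2 / (g : ℝ) ^ 3 := by
    rw [norm_div, norm_pow]
    have : ‖(2 : ℂ)‖ = 2 := by norm_num
    rw [this]
    calc ‖F‖ ^ 2 / 2 ≤ (A / (g : ℝ) ^ 2) ^ 2 / 2 := by gcongr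
      _ = A ^ 2 / 2 / (g : ℝ) ^ 4 := by field_simp
      _ ≤ A ^ 2 / 2 / (g : ℝ) ^ 3 :=
        div_le_div_of_nonneg_left (by positivity) (by positivity)
          (pow_le_pow_right₀ hg1 (by norm_num))
  have n3 : ‖((g : ℂ) * δ) ^ 2 * ((1 / (2 * g) : ℝ) : ℂ)‖ ≤ 2 * A ^ 2 / (g : ℝ) ^ 3 := by
    rw [norm_mul, norm_pow, Complex.norm_real, Real.norm_eq_abs, abs_of_nonneg (by positivity)]
    calc ‖(g : ℂ) * δ‖ ^ 2 * (1 / (2 * g)) ≤ (2 * A / g) ^ 2 * (1 / (2 * g)) := by gcongr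
      _ = 2 * A ^ 2 / (g : ℝ) ^ 3 := by field_simp
  have n4 : ‖(1 + δ) ^ g - (1 + (g : ℂ) * δ + (g * (g - 1) / 2 : ℝ) * δ ^ 2)‖ ≤
      8 * A ^ 3 * Real.exp (T / 2) / (g : ℝ) ^ 3 := by
    have hgn : (g : ℝ) * ‖δ‖ = ‖(g : ℂ) * δ‖ := by rw [norm_mul, Complex.norm_natCast]
    calc _ ≤ (g * ‖δ‖) ^ 3 * Real.exp (g * ‖δ‖) := norm_one_add_pow_sub_le δ g
      _ ≤ (2 * A / g) ^ 3 * Real.exp (T / 2) := by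
        gcongr
        rw [hgn]; exact hgδle
      _ = 8 * A ^ 3 * Real.exp (T / 2) / (g : ℝ) ^ 3 := by field_simp; norm_num
  have e : (1 + δ) ^ g - ((1 - T ^ 2 / (4 * g) + (c + T ^ 4 / 32) / (g : ℝ) ^ 2 : ℝ) : ℂ) =
      ((1 + δ) ^ g - (1 + (g : ℂ) * δ + (g * (g - 1) / 2 : ℝ) * δ ^ 2)) +
      (G - ((T ^ 2 / (4 * g) : ℝ) : ℂ) * F + F ^ 2 / 2 -
        (g * δ) ^ 2 * ((1 / (2 * g) : ℝ) : ℂ)) := by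
    rw [← hdiff]; ring
  rw [e]
  refine (norm_add_le _ _).trans ?_
  have t1 := norm_sub_le (G - ((T ^ 2 / (4 * g) : ℝ) : ℂ) * F + F ^ 2 / 2)
    (((g : ℂ) * δ) ^ 2 * ((1 / (2 * g) : ℝ) : ℂ))
  have t2 := norm_add_le (G - ((T ^ 2 / (4 * g) : ℝ) : ℂ) * F) (F ^ 2 / 2)
  have t3 := norm_sub_le G (((T ^ 2 / (4 * g) : ℝ) : ℂ) * F)
  have hfin : 8 * A ^ 3 * Real.exp (T / 2) + (A / 2 + A ^ 2 / 4 + A ^ 2 / 2 + 2 * A ^ 2) ≤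
      9 * A ^ 3 * Real.exp (T / 2) := by
    have hexp1 : 1 ≤ Real.exp (T / 2) := Real.one_le_exp (by positivity)
    have e1 : A / 2 + A ^ 2 / 4 + A ^ 2 / 2 + 2 * A ^ 2 ≤ A ^ 3 := by nlinarith [sq_nonneg A]
    have e2 : A ^ 3 * 1 ≤ A ^ 3 * Real.exp (T / 2) := by gcongr
    linarith
  calc _ ≤ 8 * A ^ 3 * Real.exp (T / 2) / (g : ℝ) ^ 3 + (A / 2 / (g : ℝ) ^ 3 +
        A ^ 2 / 4 / (g : ℝ) ^ 3 + A ^ 2 / 2 / (g : ℝ) ^ 3 + 2 * A ^ 2 / (g : ℝ) ^ 3) := by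
        linarith
    _ = (8 * A ^ 3 * Real.exp (T / 2) + (A / 2 + A ^ 2 / 4 + A ^ 2 / 2 + 2 * A ^ 2)) /
        (g : ℝ) ^ 3 := by ring
    _ ≤ _ := by gcongr

lemma norm_expansion_le_half {τ p : ℝ} {δ : ℂ} (hτ0 : 0 ≤ τ) (hτ : τ ≤ 1 / 1000) (hp0 : 0 ≤ p)
    (hp : p ≤ 1 / 4)
    (h : ‖δ - ((-τ ^ 2 / 4 + p * τ ^ 2 / 2 - τ ^ 3 / 12 : ℝ) : ℂ)‖ ≤
      300 * (τ ^ 4 + τ ^ 3 * p + τ ^ 2 * p ^ 2)) : ‖δ‖ ≤ τ / 2 := by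
  have e0 : τ ^ 2 ≤ τ / 1000 := by nlinarith
  have e1 : |-τ ^ 2 / 4 + p * τ ^ 2 / 2 - τ ^ 3 / 12| ≤ τ / 1000 := by
    have e3 : τ ^ 3 ≤ τ ^ 2 := by nlinarith [sq_nonneg τ]
    have e4 : p * τ ^ 2 ≤ 1 / 4 * τ ^ 2 := by gcongr
    have e5 : 0 ≤ p * τ ^ 2 := by positivity
    have e6 : 0 ≤ τ ^ 3 := by positivity
    rw [abs_le]; constructor <;> linarith [sq_nonneg τ]
  have e2 : 300 * (τ ^ 4 + τ ^ 3 * p + τ ^ 2 * p ^ 2) ≤ τ / 20 := by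
    have f1 : τ ^ 4 + τ ^ 3 * p + τ ^ 2 * p ^ 2 = τ ^ 2 * (τ ^ 2 + τ * p + p ^ 2) := by ring
    have f2 : τ ^ 2 + τ * p + p ^ 2 ≤ 1 / 10 := by nlinarith
    rw [f1]
    have : τ ^ 2 * (τ ^ 2 + τ * p + p ^ 2) ≤ τ / 1000 * (1 / 10) := by gcongr
    linarith
  have := norm_add_le (δ - ((-τ ^ 2 / 4 + p * τ ^ 2 / 2 - τ ^ 3 / 12 : ℝ) : ℂ))
    ((-τ ^ 2 / 4 + p * τ ^ 2 / 2 - τ ^ 3 / 12 : ℝ) : ℂ)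
  rw [sub_add_cancel, Complex.norm_real, Real.norm_eq_abs] at this
  linarith

/-- The expansion of the `g`-th power in the central range `τ ≤ 1 / 1000`, where `T = g τ`. -/
lemma norm_pow_sub_charApprox_le {φ : ℂ} {τ n : ℝ} {g : ℕ} (hg : 1 ≤ g) (hτ0 : 0 ≤ τ)
    (hτ : τ ≤ 1 / 1000) (hn : 0 ≤ n) (hng : n / g ≤ 1 / 4)
    (h : ‖φ - ((1 - τ + τ ^ 2 / (4 * (1 - n / g) ^ 2) : ℝ) : ℂ)‖ ≤
      130 * (τ ^ 4 + τ ^ 3 * (n / g))) :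
    ‖φ ^ g - charApprox n g (g * τ)‖ ≤
      9 * (3600 * (1 + n) ^ 2) ^ 3 * 30 ^ 15 / (g : ℝ) ^ 3 * ((1 + g * τ) ^ 3)⁻¹ := by
  have hgpos : (0 : ℝ) < g := by exact_mod_cast hg
  obtain ⟨T, hT⟩ : ∃ T, T = (g : ℝ) * τ := ⟨_, rfl⟩
  have hT0 : 0 ≤ T := by rw [hT]; positivity
  obtain ⟨p, hp⟩ : ∃ p, p = n / g := ⟨_, rfl⟩
  rw [← hp] at h hng
  have hp0 : 0 ≤ p := by rw [hp]; positivity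
  have hE := norm_mul_exp_sub_le hτ0 (by linarith) hp0 hng h
  obtain ⟨δ, hδ⟩ : ∃ δ, δ = φ * Real.exp τ - 1 := ⟨_, rfl⟩
  rw [← hδ] at hE
  have hδ2 := norm_expansion_le_half hτ0 hτ hp0 hng hE
  obtain ⟨E, hEdef⟩ : ∃ E, E = δ - ((-τ ^ 2 / 4 + p * τ ^ 2 / 2 - τ ^ 3 / 12 : ℝ) : ℂ) := ⟨_, rfl⟩
  rw [← hEdef] at hE
  have hδE : δ = ((-τ ^ 2 / 4 + p * τ ^ 2 / 2 - τ ^ 3 / 12 : ℝ) : ℂ) + E := by rw [hEdef]; ring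
  have hτT : τ = T / g := by rw [hT]; field_simp
  -- `A` dominates the coefficients of all the expansions below.
  obtain ⟨A, hA⟩ : ∃ A, A = 3600 * ((1 + n) ^ 2 * (1 + T) ^ 4) := ⟨_, rfl⟩
  have hpoly := sq_add_cube_add_pow_four_le hT0 hn
  have hA600 : A = 600 * (6 * ((1 + n) ^ 2 * (1 + T) ^ 4)) := by rw [hA]; ring
  rw [← (by linarith : A / 600 = 6 * ((1 + n) ^ 2 * (1 + T) ^ 4))] at hpoly
  have m1 : 0 ≤ T ^ 4 := by positivity
  have m2 : 0 ≤ T ^ 3 * n := by positivity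
  have m3 : 0 ≤ T ^ 2 * n ^ 2 := by positivity
  have m4 : 0 ≤ n * T ^ 2 := by positivity
  have m5 : 0 ≤ T ^ 3 := by positivity
  have m6 : 0 ≤ T ^ 2 := by positivity
  have hgE : ‖(g : ℂ) * E‖ ≤ A / 2 / (g : ℝ) ^ 3 := by
    rw [norm_mul, Complex.norm_natCast]
    calc (g : ℝ) * ‖E‖ ≤ g * (300 * (τ ^ 4 + τ ^ 3 * p + τ ^ 2 * p ^ 2)) := by gcongr
      _ = 300 * (T ^ 4 + T ^ 3 * n + T ^ 2 * n ^ 2) / (g : ℝ) ^ 3 := by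
        rw [hτT, hp]; field_simp
      _ ≤ A / 2 / (g : ℝ) ^ 3 := by gcongr ?_ / _; linarith
  have hgδ : (g : ℂ) * δ = ((-T ^ 2 / (4 * g) + (n * T ^ 2 / 2 - T ^ 3 / 12) / (g : ℝ) ^ 2 : ℝ) : ℂ)
      + g * E := by
    have hgc : (g : ℂ) ≠ 0 := by exact_mod_cast hgpos.ne'
    rw [hδE, hτT, hp]; push_cast; field_simp; ring
  have herr := norm_one_add_pow_sub_expansion_le hg hT0 (A := A) (by linarith) (by linarith)
    (by rw [abs_le]; constructor <;> linarith) hgE hgδ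
    (by calc (g : ℝ) * ‖δ‖ ≤ g * (τ / 2) := by gcongr
          _ = T / 2 := by rw [hT]; ring)
  have hpow : φ ^ g = Real.exp (-T) * (1 + δ) ^ g := by
    have h1 : 1 + δ = φ * Real.exp τ := by rw [hδ]; ring
    rw [h1, mul_pow, ← Complex.ofReal_pow, ← Real.exp_nat_mul, ← hT, mul_left_comm,
      ← Complex.ofReal_mul, ← Real.exp_add, neg_add_cancel, Real.exp_zero]
    simp
  rw [← hT, hpow, charApprox, Complex.ofReal_mul, ← mul_sub, norm_mul, Complex.norm_real,
    Real.norm_eq_abs, abs_of_pos (Real.exp_pos _)]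
  have hpowexp := one_add_pow_mul_exp_le 15 (by norm_num) hT0
  rw [show (2 * ((15 : ℕ) : ℝ)) = 30 by norm_num] at hpowexp
  have hexpmul : Real.exp (-T) * Real.exp (T / 2) = Real.exp (-T / 2) := by
    rw [← Real.exp_add]; ring_nf
  calc _ ≤ Real.exp (-T) * ((9 * A ^ 3 * Real.exp (T / 2)) / (g : ℝ) ^ 3) := by gcongr
    _ = 9 * A ^ 3 * (Real.exp (-T) * Real.exp (T / 2)) / (g : ℝ) ^ 3 := by ring
    _ = 9 * (3600 * (1 + n) ^ 2) ^ 3 / (g : ℝ) ^ 3 *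
          ((1 + T) ^ 15 * Real.exp (-T / 2)) * ((1 + T) ^ 3)⁻¹ := by
        rw [hexpmul, hA]; field_simp
    _ ≤ 9 * (3600 * (1 + n) ^ 2) ^ 3 / (g : ℝ) ^ 3 * 30 ^ 15 * ((1 + T) ^ 3)⁻¹ := by
        gcongr
    _ = _ := by ring

lemma exists_pow_mul_pow_le {q : ℝ} (hq0 : 0 ≤ q) (hq : q < 1) (k : ℕ) :
    ∃ B : ℝ, 0 ≤ B ∧ ∀ g : ℕ, k ≤ g → (g : ℝ) ^ k * q ^ (g - k) ≤ B := by
  obtain ⟨B, hB⟩ := (tendsto_pow_const_mul_const_pow_of_abs_lt_one k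
    (r := (q + 1) / 2) (by rw [abs_lt]; constructor <;> linarith)).bddAbove_range
  have hr : 0 < (q + 1) / 2 := by linarith
  refine ⟨|B| / ((q + 1) / 2) ^ k, by positivity, fun g hg => ?_⟩
  rw [le_div_iff₀ (by positivity)]
  have h1 : (g : ℝ) ^ k * ((q + 1) / 2) ^ g ≤ B := hB ⟨g, rfl⟩
  have h2 : q ^ (g - k) ≤ ((q + 1) / 2) ^ (g - k) := by gcongr; linarith
  calc (g : ℝ) ^ k * q ^ (g - k) * ((q + 1) / 2) ^ k
      ≤ (g : ℝ) ^ k * ((q + 1) / 2) ^ (g - k) * ((q + 1) / 2) ^ k := by gcongr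
    _ = (g : ℝ) ^ k * ((q + 1) / 2) ^ g := by
      rw [mul_assoc, ← pow_add, Nat.sub_add_cancel hg]
    _ ≤ |B| := h1.trans (le_abs_self B)

lemma abs_charApprox_le_mul_exp {n T : ℝ} {g : ℕ} (hg : 1 ≤ g) (hn : 0 ≤ n) (hT0 : 0 ≤ T) :
    |charApprox n g T| ≤ (6 + n) * (1 + T) ^ 4 * Real.exp (-T) := by
  have hg1 : (1 : ℝ) ≤ g := by exact_mod_cast hg
  have hgpos : (0 : ℝ) < g := by linarith
  rw [charApprox, abs_mul, abs_of_pos (Real.exp_pos _), mul_comm]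
  gcongr
  have a1 : T ^ 2 / (4 * g) ≤ T ^ 2 := div_le_self (sq_nonneg T) (by linarith)
  have a2 : 0 ≤ T ^ 2 / (4 * g) := by positivity
  have a3 : |(n * T ^ 2 / 2 - T ^ 3 / 12 + T ^ 4 / 32) / (g : ℝ) ^ 2| ≤
      n * T ^ 2 + T ^ 3 + T ^ 4 := by
    rw [abs_div, abs_of_pos (by positivity : 0 < (g : ℝ) ^ 2)]
    have m1 : 0 ≤ n * T ^ 2 := by positivity
    have m2 : 0 ≤ T ^ 3 := by positivity
    have m3 : 0 ≤ T ^ 4 := by positivity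
    refine (div_le_self (abs_nonneg _) (one_le_pow₀ hg1)).trans ?_
    rw [abs_le]; constructor <;> linarith
  have a4 := abs_le.1 a3
  have e : (6 + n) * (1 + T) ^ 4 = (1 + T ^ 2 + (n * T ^ 2 + T ^ 3 + T ^ 4)) +
      (5 + 24 * T + 35 * T ^ 2 + 23 * T ^ 3 + 5 * T ^ 4 +
        n * (1 + 4 * T + 5 * T ^ 2 + 4 * T ^ 3 + T ^ 4)) := by ring
  have e2 : 0 ≤ 5 + 24 * T + 35 * T ^ 2 + 23 * T ^ 3 + 5 * T ^ 4 +
        n * (1 + 4 * T + 5 * T ^ 2 + 4 * T ^ 3 + T ^ 4) := by positivity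
  rw [e, abs_le]
  constructor <;> linarith [a4.1, a4.2, sq_nonneg T]

lemma abs_charApprox_mul_pow_le {n T : ℝ} {g k : ℕ} (hg : 1 ≤ g) (hn : 0 ≤ n) (hT0 : 0 ≤ T)
    (hk : k ≤ 10) : |charApprox n g T| * (1 + T) ^ k ≤ (6 + n) * 28 ^ 14 := by
  have h14 := one_add_pow_mul_exp_le 14 (by norm_num) hT0
  rw [show (2 * ((14 : ℕ) : ℝ)) = 28 by norm_num] at h14
  have hexp : Real.exp (-T) ≤ Real.exp (-T / 2) := Real.exp_le_exp.2 (by linarith)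
  have hmono : (1 + T) ^ (4 + k) ≤ (1 + T) ^ 14 :=
    pow_le_pow_right₀ (by linarith) (by omega)
  calc |charApprox n g T| * (1 + T) ^ k
      ≤ (6 + n) * (1 + T) ^ 4 * Real.exp (-T / 2) * (1 + T) ^ k := by
        gcongr
        exact (abs_charApprox_le_mul_exp hg hn hT0).trans (by gcongr)
    _ = (6 + n) * ((1 + T) ^ (4 + k) * Real.exp (-T / 2)) := by ring
    _ ≤ (6 + n) * ((1 + T) ^ 14 * Real.exp (-T / 2)) := by gcongr
    _ ≤ (6 + n) * 28 ^ 14 := by gcongr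

/-- The approximation is negligible outside the central range. -/
lemma abs_charApprox_le {n T : ℝ} {g : ℕ} (hg : 1 ≤ g) (hn : 0 ≤ n) (hT : (g : ℝ) / 1000 ≤ T) :
    |charApprox n g T| ≤ (6 + n) * 28 ^ 14 * 1000 ^ 3 / (g : ℝ) ^ 3 * ((1 + T) ^ 3)⁻¹ := by
  have hgpos : (0 : ℝ) < g := by exact_mod_cast hg
  have hT0 : 0 ≤ T := le_trans (by positivity) hT
  have hgT : (g : ℝ) ^ 3 ≤ 1000 ^ 3 * (1 + T) ^ 3 := by
    rw [← mul_pow]; gcongr; linarith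
  rw [div_mul_eq_mul_div, le_div_iff₀ (by positivity), ← div_eq_mul_inv,
    le_div_iff₀ (by positivity)]
  calc |charApprox n g T| * (g : ℝ) ^ 3 * (1 + T) ^ 3
      ≤ |charApprox n g T| * (1000 ^ 3 * (1 + T) ^ 3) * (1 + T) ^ 3 := by gcongr
    _ = |charApprox n g T| * (1 + T) ^ 6 * 1000 ^ 3 := by ring
    _ ≤ (6 + n) * 28 ^ 14 * 1000 ^ 3 := by
      exact mul_le_mul_of_nonneg_right (abs_charApprox_mul_pow_le hg hn hT0 (by norm_num))
        (by norm_num)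

/-- The characteristic function of the total shear of `g` stars, rescaled by `g`, differs from the
approximation by `O(g⁻³)`, with an integrable dependence on the argument. -/
theorem exists_norm_charFun_starLaw_pow_sub_le {n : ℝ} (hn : 0 ≤ n) :
    ∃ C : ℝ, 0 ≤ C ∧ ∃ N : ℕ, 1 ≤ N ∧ ∀ g : ℕ, N ≤ g → ∀ y : ℂ, Complex.normSq y = n / g →
      ∀ s : ℂ, ‖charFun (starLaw y) s ^ g - charApprox n g (g * ‖s‖)‖ ≤
        C / (g : ℝ) ^ 3 * ((1 + g * ‖s‖) ^ 3)⁻¹ := by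
  obtain ⟨q, hq0, hq1, hq⟩ := exists_norm_charFun_starLaw_le (τ₀ := 1 / 1000) (by norm_num)
  obtain ⟨B, hB0, hB⟩ := exists_pow_mul_pow_le hq0 hq1 6
  obtain ⟨N, hN⟩ := exists_nat_ge (4 * n)
  refine ⟨9 * (3600 * (1 + n) ^ 2) ^ 3 * 30 ^ 15 + (B * 36 ^ 6 * 1001 ^ 3 +
    (6 + n) * 28 ^ 14 * 1000 ^ 3), by positivity, max N 6, by omega, fun g hg y hy s => ?_⟩
  have hg6 : 6 ≤ g := (le_max_right _ _).trans hg
  have hg1 : (6 : ℝ) ≤ g := by exact_mod_cast hg6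
  have hgpos : (0 : ℝ) < g := by linarith
  have hng : n / g ≤ 1 / 4 := by
    have : (N : ℝ) ≤ g := by exact_mod_cast (le_max_left _ _).trans hg
    rw [div_le_div_iff₀ hgpos (by norm_num)]
    linarith
  have hpos : 0 < ((1 + (g : ℝ) * ‖s‖) ^ 3)⁻¹ := by positivity
  rcases le_total ‖s‖ (1 / 1000) with hs | hs
  · have h1 := norm_charFun_starLaw_sub_le (y := y) (s := s) (by rw [hy]; exact hng) (by linarith)
    rw [hy] at h1
    refine (norm_pow_sub_charApprox_le (by omega) (norm_nonneg s) hs hn hng h1).trans ?_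
    gcongr
    have : 0 ≤ B * 36 ^ 6 * 1001 ^ 3 + (6 + n) * 28 ^ 14 * 1000 ^ 3 := by positivity
    linarith
  · have hy1 : Complex.normSq y ≤ 1 := by rw [hy]; linarith
    have hs0 : 0 < ‖s‖ := by linarith
    have h1 := hq y s hy1 hs
    have h2 := norm_charFun_starLaw_le hy1 (norm_pos_iff.1 hs0)
    have h3 := abs_charApprox_le (n := n) (T := g * ‖s‖) (g := g) (by omega) hn
      (by rw [div_eq_mul_inv]; gcongr; linarith)
    have h4 : ‖charFun (starLaw y) s ^ g‖ ≤
        B * 36 ^ 6 * 1001 ^ 3 / (g : ℝ) ^ 3 * ((1 + g * ‖s‖) ^ 3)⁻¹ := by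
      have hsix : ‖charFun (starLaw y) s‖ ^ 6 ≤ 36 ^ 6 / ‖s‖ ^ 3 := by
        calc ‖charFun (starLaw y) s‖ ^ 6 ≤ (36 / √‖s‖) ^ 6 := by gcongr
          _ = 36 ^ 6 / (√‖s‖ ^ 2) ^ 3 := by rw [div_pow, ← pow_mul]
          _ = 36 ^ 6 / ‖s‖ ^ 3 := by rw [Real.sq_sqrt hs0.le]
      have hsg : (1 + g * ‖s‖) ^ 3 ≤ (1001 * (g * ‖s‖)) ^ 3 := by
        gcongr
        nlinarith
      rw [norm_pow]
      calc ‖charFun (starLaw y) s‖ ^ g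
          = ‖charFun (starLaw y) s‖ ^ (g - 6) * ‖charFun (starLaw y) s‖ ^ 6 := by
            rw [← pow_add, Nat.sub_add_cancel hg6]
        _ ≤ q ^ (g - 6) * (36 ^ 6 / ‖s‖ ^ 3) := by gcongr
        _ = ((g : ℝ) ^ 6 * q ^ (g - 6)) * 36 ^ 6 * 1001 ^ 3 / (g : ℝ) ^ 3 *
            ((1001 * (g * ‖s‖)) ^ 3)⁻¹ := by field_simp
        _ ≤ B * 36 ^ 6 * 1001 ^ 3 / (g : ℝ) ^ 3 * ((1 + g * ‖s‖) ^ 3)⁻¹ := by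
          gcongr
          exact hB g hg6
    have h5 : 0 ≤ 9 * (3600 * (1 + n) ^ 2) ^ 3 * 30 ^ 15 / (g : ℝ) ^ 3 *
        ((1 + g * ‖s‖) ^ 3)⁻¹ := by positivity
    have h6 := norm_sub_le (charFun (starLaw y) s ^ g) (charApprox n g (g * ‖s‖) : ℂ)
    rw [Complex.norm_real, Real.norm_eq_abs] at h6
    rw [add_div, add_div, add_mul, add_mul]
    linarith

end Power

/-! ### The Fourier transform of the approximation -/

section ExplicitTransforms

open Set
open scoped FourierTransform RealInnerProductSpace

lemma integrableOn_pow_mul_cexp_neg_mul_Ioi {B : ℂ} (hB : 0 < B.re) (k : ℕ) :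
    IntegrableOn (fun r : ℝ => (r : ℂ) ^ k * Complex.exp (-(B * r))) (Ioi 0) := by
  have h := integrableOn_rpow_mul_exp_neg_mul_rpow (p := 1) (s := k) (b := B.re)
    (by linarith [k.cast_nonneg (α := ℝ)]) one_pos hB
  refine h.mono' (by fun_prop) ?_
  filter_upwards [ae_restrict_mem measurableSet_Ioi] with r hr
  rw [norm_mul, norm_pow, Complex.norm_real, Real.norm_of_nonneg (le_of_lt hr), Complex.norm_exp,
    Real.rpow_natCast, Real.rpow_one]
  simp

lemma integral_pow_mul_cexp_neg_mul_Ioi {B : ℂ} (hB : 0 < B.re) (k : ℕ) :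
    ∫ r in Ioi (0 : ℝ), (r : ℂ) ^ k * Complex.exp (-(B * r)) = k.factorial / B ^ (k + 1) := by
  have hB0 : B ≠ 0 := fun h => by simp [h] at hB
  induction k with
  | zero =>
    have h := integral_exp_mul_complex_Ioi (a := -B) (by simpa using hB) 0
    simp only [pow_zero, one_mul, ← neg_mul]
    rw [h]
    simp
  | succ k ih =>
    have hder : ∀ r ∈ Ici (0 : ℝ), HasDerivAt
        (fun r : ℝ => (r : ℂ) ^ (k + 1) * Complex.exp (-(B * r)))
        ((k + 1) * ((r : ℂ) ^ k * Complex.exp (-(B * r))) -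
          B * ((r : ℂ) ^ (k + 1) * Complex.exp (-(B * r)))) r := by
      intro r _
      have h1 := (hasDerivAt_id (r : ℂ)).pow (k + 1)
      have h2 := (((hasDerivAt_id (r : ℂ)).const_mul B).neg).cexp
      have := (h1.mul h2).comp_ofReal
      convert! this using 1
      simp
      ring
    have hi1 := integrableOn_pow_mul_cexp_neg_mul_Ioi hB k
    have hi2 := integrableOn_pow_mul_cexp_neg_mul_Ioi hB (k + 1)
    have hlim : Tendsto (fun r : ℝ => (r : ℂ) ^ (k + 1) * Complex.exp (-(B * r))) atTop (𝓝 0) := by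
      rw [tendsto_zero_iff_norm_tendsto_zero]
      have h := tendsto_rpow_mul_exp_neg_mul_atTop_nhds_zero (k + 1 : ℕ) B.re hB
      refine h.congr' ?_
      filter_upwards [eventually_gt_atTop 0] with r hr
      rw [norm_mul, norm_pow, Complex.norm_real, Real.norm_of_nonneg (le_of_lt hr),
        Complex.norm_exp, Real.rpow_natCast]
      simp
    have h := integral_Ioi_of_hasDerivAt_of_tendsto' hder
      ((hi1.const_mul _).sub (hi2.const_mul _)) hlim
    rw [integral_sub (hi1.const_mul _) (hi2.const_mul _), integral_const_mul, integral_const_mul,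
      ih] at h
    simp only [Complex.ofReal_zero, ne_eq, Nat.add_eq_zero_iff, one_ne_zero, and_false,
      not_false_eq_true, zero_pow, zero_mul, sub_zero] at h
    rw [eq_div_iff (pow_ne_zero _ hB0), Nat.factorial_succ]
    push_cast
    field_simp at h
    linear_combination -h

/-- The Laplace transform of the approximation along a half-line, with a power weight. -/
lemma integral_pow_mul_charApprox_mul_cexp {κ : ℝ} (hκ : 0 < κ) (n : ℝ) (g j : ℕ) (b : ℝ) :
    ∫ r in Ioi (0 : ℝ), (r : ℂ) ^ j * (charApprox n g (2 * Real.pi * κ * r) *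
        Complex.exp (-(2 * Real.pi * (b * Complex.I) * r))) =
      ((2 * Real.pi : ℂ) ^ (j + 1))⁻¹ * (j.factorial * ((κ + b * Complex.I) ^ (j + 1))⁻¹ +
        (-1 / (4 * g) + n / (2 * g ^ 2)) * κ ^ 2 * (j + 2).factorial *
          ((κ + b * Complex.I) ^ (j + 3))⁻¹ -
        κ ^ 3 / (12 * g ^ 2) * (j + 3).factorial * ((κ + b * Complex.I) ^ (j + 4))⁻¹ +
        κ ^ 4 / (32 * g ^ 2) * (j + 4).factorial * ((κ + b * Complex.I) ^ (j + 5))⁻¹) := by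
  set A : ℂ := κ + b * Complex.I with hA
  have hAre : A.re = κ := by simp [hA]
  have hA0 : A ≠ 0 := fun h => by rw [h] at hAre; simp at hAre; exact hκ.ne hAre
  set B : ℂ := 2 * Real.pi * A with hB
  have hBre : 0 < B.re := by
    have : B.re = 2 * Real.pi * κ := by
      rw [hB, show (2 * Real.pi * A : ℂ) = ((2 * Real.pi : ℝ) : ℂ) * A by push_cast; ring,
        Complex.re_ofReal_mul, hAre]
    rw [this]; positivity
  have hπ : (Real.pi : ℂ) ≠ 0 := by exact_mod_cast Real.pi_ne_zero
  have he : ∀ r : ℝ, (r : ℂ) ^ j * (charApprox n g (2 * Real.pi * κ * r) *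
        Complex.exp (-(2 * Real.pi * (b * Complex.I) * r))) =
      (r : ℂ) ^ j * Complex.exp (-(B * r)) +
        (-1 / (4 * g) + n / (2 * g ^ 2)) * (2 * Real.pi * κ) ^ 2 *
          ((r : ℂ) ^ (j + 2) * Complex.exp (-(B * r))) -
        (2 * Real.pi * κ) ^ 3 / (12 * g ^ 2) * ((r : ℂ) ^ (j + 3) * Complex.exp (-(B * r))) +
        (2 * Real.pi * κ) ^ 4 / (32 * g ^ 2) * ((r : ℂ) ^ (j + 4) * Complex.exp (-(B * r))) := by
    intro r
    have h1 : Complex.exp (-(B * r)) = Complex.exp (-(2 * Real.pi * κ * r)) *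
        Complex.exp (-(2 * Real.pi * (b * Complex.I) * r)) := by
      rw [← Complex.exp_add, hB, hA]; congr 1; ring
    rw [h1, charApprox]
    push_cast
    ring
  have hi := integrableOn_pow_mul_cexp_neg_mul_Ioi hBre
  simp_rw [he]
  have hlin : ∀ {f₀ f₁ f₂ f₃ : ℝ → ℂ}, IntegrableOn f₀ (Ioi 0) → IntegrableOn f₁ (Ioi 0) →
      IntegrableOn f₂ (Ioi 0) → IntegrableOn f₃ (Ioi 0) → ∀ c₁ c₂ c₃ : ℂ,
      ∫ r in Ioi (0 : ℝ), (f₀ r + c₁ * f₁ r - c₂ * f₂ r + c₃ * f₃ r) =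
        (∫ r in Ioi (0 : ℝ), f₀ r) + c₁ * (∫ r in Ioi (0 : ℝ), f₁ r) -
          c₂ * (∫ r in Ioi (0 : ℝ), f₂ r) + c₃ * ∫ r in Ioi (0 : ℝ), f₃ r := by
    intro f₀ f₁ f₂ f₃ h₀ h₁ h₂ h₃ c₁ c₂ c₃
    have h01 : IntegrableOn (fun r => f₀ r + c₁ * f₁ r) (Ioi 0) := h₀.add (h₁.const_mul _)
    have h02 : IntegrableOn (fun r => f₀ r + c₁ * f₁ r - c₂ * f₂ r) (Ioi 0) :=
      h01.sub (h₂.const_mul _)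
    rw [integral_add h02 (h₃.const_mul _), integral_sub h01 (h₂.const_mul _),
      integral_add h₀ (h₁.const_mul _), integral_const_mul, integral_const_mul,
      integral_const_mul]
  rw [hlin (hi _) (hi _) (hi _) (hi _)]
  simp only [integral_pow_mul_cexp_neg_mul_Ioi hBre]
  have ht : ∀ (k : ℕ) (c : ℂ), (2 * Real.pi * κ) ^ k * (c / B ^ (j + k + 1)) =
      ((2 * Real.pi : ℂ) ^ (j + 1))⁻¹ * (κ ^ k * c * (A ^ (j + k + 1))⁻¹) := by
    intro k c
    rw [hB, mul_pow _ A, mul_pow _ (κ : ℂ), show j + k + 1 = (j + 1) + k by ring,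
      pow_add (2 * Real.pi : ℂ) (j + 1) k]
    field_simp
  have h0 := ht 0 j.factorial
  simp only [pow_zero, one_mul, add_zero] at h0
  linear_combination h0 + (-1 / (4 * g) + n / (2 * g ^ 2) : ℂ) * ht 2 (j + 2).factorial -
    1 / (12 * g ^ 2) * ht 3 (j + 3).factorial + 1 / (32 * g ^ 2) * ht 4 (j + 4).factorial

lemma continuous_charApprox (n : ℝ) (g : ℕ) : Continuous (charApprox n g) := by
  unfold charApprox; fun_prop

lemma integrable_inv_one_add_mul_norm_pow_three {E : Type*} [NormedAddCommGroup E]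
    [NormedSpace ℝ E] [FiniteDimensional ℝ E] [MeasureSpace E] [BorelSpace E]
    [(volume : Measure E).IsAddHaarMeasure] (hE : Module.finrank ℝ E < 3) {c : ℝ} (hc : 0 < c) :
    Integrable (fun t : E => ((1 + c * ‖t‖) ^ 3)⁻¹) := by
  have h := (integrable_one_add_norm (E := E) (μ := volume) (r := 3) (by exact_mod_cast hE))
  have h2 := h.comp_smul hc.ne'
  refine h2.congr (ae_of_all _ fun t => ?_)
  simp only [norm_smul, Real.norm_of_nonneg hc.le]
  rw [Real.rpow_neg (by positivity)]
  norm_cast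

lemma integrable_charApprox {E : Type*} [NormedAddCommGroup E]
    [NormedSpace ℝ E] [FiniteDimensional ℝ E] [MeasureSpace E] [BorelSpace E]
    [(volume : Measure E).IsAddHaarMeasure] (hE : Module.finrank ℝ E < 3) {c n : ℝ} (hc : 0 < c)
    {g : ℕ} (hg : 1 ≤ g) (hn : 0 ≤ n) :
    Integrable (fun t : E => (charApprox n g (c * ‖t‖) : ℂ)) := by
  have h := (integrable_inv_one_add_mul_norm_pow_three hE hc).const_mul ((6 + n) * 28 ^ 14)
  have hcont := continuous_charApprox n g
  refine h.mono' (by fun_prop) (ae_of_all _ fun t => ?_)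
  rw [Complex.norm_real, Real.norm_eq_abs, ← div_eq_mul_inv, le_div_iff₀ (by positivity)]
  exact abs_charApprox_mul_pow_le hg hn (by positivity) (by norm_num)

/-- On the line, the Fourier transform of the approximation is the marginal expansion. -/
theorem fourier_charApprox_real {κ n : ℝ} (hκ : 0 < κ) {g : ℕ} (hg : 1 ≤ g) (hn : 0 ≤ n) (a : ℝ) :
    𝓕 (fun t : ℝ => (charApprox n g (2 * Real.pi * κ * ‖t‖) : ℂ)) a =
      (marginalApprox κ n g a : ℝ) := by
  have hc : 0 < 2 * Real.pi * κ := by positivity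
  have hint : Integrable (fun t : ℝ => Complex.exp (↑(-2 * Real.pi * t * a) * Complex.I) •
      (charApprox n g (2 * Real.pi * κ * ‖t‖) : ℂ)) := by
    have h := integrable_charApprox (E := ℝ) (by simp) hc hg hn
    have hcont := continuous_charApprox n g
    refine h.mono (by fun_prop) (ae_of_all _ fun t => ?_)
    rw [norm_smul, Complex.norm_exp_ofReal_mul_I, one_mul]
  rw [Real.fourier_real_eq_integral_exp_smul,
    ← intervalIntegral.integral_Iic_add_Ioi (b := 0) hint.integrableOn hint.integrableOn,
    show (Iic (0 : ℝ)) = Iic (-0) by simp, ← integral_comp_neg_Ioi]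
  have e1 := integral_pow_mul_charApprox_mul_cexp hκ n g 0 a
  have e2 := integral_pow_mul_charApprox_mul_cexp hκ n g 0 (-a)
  simp only [pow_zero, one_mul] at e1 e2
  have hpos : ∫ t in Ioi (0 : ℝ), Complex.exp (↑(-2 * Real.pi * t * a) * Complex.I) •
      (charApprox n g (2 * Real.pi * κ * ‖t‖) : ℂ) =
      ∫ t in Ioi (0 : ℝ), (charApprox n g (2 * Real.pi * κ * t) *
        Complex.exp (-(2 * Real.pi * (a * Complex.I) * t)) : ℂ) := by
    refine setIntegral_congr_fun measurableSet_Ioi fun t ht => ?_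
    rw [Real.norm_of_nonneg (le_of_lt ht), smul_eq_mul, mul_comm]
    congr 2
    push_cast
    ring
  have hneg : ∫ t in Ioi (0 : ℝ), Complex.exp (↑(-2 * Real.pi * -t * a) * Complex.I) •
      (charApprox n g (2 * Real.pi * κ * ‖-t‖) : ℂ) =
      ∫ t in Ioi (0 : ℝ), (charApprox n g (2 * Real.pi * κ * t) *
        Complex.exp (-(2 * Real.pi * ((-a : ℝ) * Complex.I) * t)) : ℂ) := by
    refine setIntegral_congr_fun measurableSet_Ioi fun t ht => ?_
    rw [norm_neg, Real.norm_of_nonneg (le_of_lt ht), smul_eq_mul, mul_comm]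
    congr 2
    push_cast
    ring
  rw [hpos, hneg, e1, e2]
  have hg0 : (g : ℂ) ≠ 0 := by exact_mod_cast (by omega : g ≠ 0)
  have hπ : (Real.pi : ℂ) ≠ 0 := by exact_mod_cast Real.pi_ne_zero
  have hS : (κ ^ 2 + a ^ 2 : ℂ) ≠ 0 := by exact_mod_cast (by positivity : κ ^ 2 + a ^ 2 ≠ 0)
  have hAB : (κ + a * Complex.I) * (κ + (-a : ℝ) * Complex.I) = (κ ^ 2 + a ^ 2 : ℂ) := by
    push_cast; linear_combination (-(a : ℂ) ^ 2) * Complex.I_sq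
  have hinv : ∀ k : ℕ, ((κ + a * Complex.I : ℂ) ^ k)⁻¹ + ((κ + (-a : ℝ) * Complex.I : ℂ) ^ k)⁻¹ =
      ((κ + a * Complex.I) ^ k + (κ + (-a : ℝ) * Complex.I) ^ k) / (κ ^ 2 + a ^ 2 : ℂ) ^ k := by
    intro k
    rw [← hAB] at hS ⊢
    have h1 := left_ne_zero_of_mul hS
    have h2 := right_ne_zero_of_mul hS
    rw [inv_add_inv (pow_ne_zero _ h1) (pow_ne_zero _ h2), ← mul_pow]
  have h1 := hinv 1
  have h3 := hinv 3
  have h4 := hinv 4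
  have h5 := hinv 5
  have p1 : (κ + a * Complex.I) ^ 1 + (κ + (-a : ℝ) * Complex.I) ^ 1 = (2 * κ : ℂ) := by
    push_cast; ring
  have p3 : (κ + a * Complex.I) ^ 3 + (κ + (-a : ℝ) * Complex.I) ^ 3 =
      (2 * κ ^ 3 - 6 * κ * a ^ 2 : ℂ) := by
    push_cast; linear_combination (6 * (κ : ℂ) * a ^ 2) * Complex.I_sq
  have p4 : (κ + a * Complex.I) ^ 4 + (κ + (-a : ℝ) * Complex.I) ^ 4 =
      (2 * κ ^ 4 - 12 * κ ^ 2 * a ^ 2 + 2 * a ^ 4 : ℂ) := by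
    push_cast
    linear_combination (12 * (κ : ℂ) ^ 2 * a ^ 2 + 2 * a ^ 4 * (Complex.I ^ 2 - 1)) * Complex.I_sq
  have p5 : (κ + a * Complex.I) ^ 5 + (κ + (-a : ℝ) * Complex.I) ^ 5 =
      (2 * κ ^ 5 - 20 * κ ^ 3 * a ^ 2 + 10 * κ * a ^ 4 : ℂ) := by
    push_cast
    linear_combination (20 * (κ : ℂ) ^ 3 * a ^ 2 + 10 * κ * a ^ 4 * (Complex.I ^ 2 - 1)) *
      Complex.I_sq
  rw [p1] at h1
  rw [p3] at h3
  rw [p4] at h4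
  rw [p5] at h5
  have hfin : ((marginalApprox κ n g a : ℝ) : ℂ) = (2 * Real.pi : ℂ)⁻¹ *
      (2 * κ / (κ ^ 2 + a ^ 2) ^ 1 + (-1 / (4 * g) + n / (2 * g ^ 2)) * κ ^ 2 * 2 *
        ((2 * κ ^ 3 - 6 * κ * a ^ 2) / (κ ^ 2 + a ^ 2) ^ 3) -
        κ ^ 3 / (12 * g ^ 2) * 6 *
          ((2 * κ ^ 4 - 12 * κ ^ 2 * a ^ 2 + 2 * a ^ 4) / (κ ^ 2 + a ^ 2) ^ 4) +
        κ ^ 4 / (32 * g ^ 2) * 24 *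
          ((2 * κ ^ 5 - 20 * κ ^ 3 * a ^ 2 + 10 * κ * a ^ 4) / (κ ^ 2 + a ^ 2) ^ 5)) := by
    unfold marginalApprox K₁ K₂
    push_cast
    field_simp
    ring
  rw [hfin, ← h1, ← h3, ← h4, ← h5]
  simp only [Nat.factorial, zero_add, Nat.cast_one, pow_one]
  push_cast
  ring

/-- The imaginary parts cancel under `θ ↦ θ + π`. -/
lemma integral_inv_add_mul_cos {κ : ℝ} (hκ : 0 < κ) (Γ : ℝ) :
    ∫ θ in -Real.pi..Real.pi, (κ + Γ * Real.cos θ * Complex.I : ℂ)⁻¹ =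
      ((2 * Real.pi / √(κ ^ 2 + Γ ^ 2) : ℝ) : ℂ) := by
  have hne : ∀ θ : ℝ, (κ + Γ * Real.cos θ * Complex.I : ℂ) ≠ 0 := fun θ h => by
    have := congrArg Complex.re h
    simp at this
    exact hκ.ne' this
  have hcont : Continuous fun θ : ℝ => (κ + Γ * Real.cos θ * Complex.I : ℂ)⁻¹ :=
    Continuous.inv₀ (by fun_prop) hne
  have hper : Function.Periodic (fun θ : ℝ => (κ + Γ * Real.cos θ * Complex.I : ℂ)⁻¹)
      (2 * Real.pi) := fun θ => by simp
  have h1 := integral_shift_of_periodic hper Real.pi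
  have h2 : (∫ θ in -Real.pi..Real.pi, (κ + Γ * Real.cos θ * Complex.I : ℂ)⁻¹) +
      ∫ θ in -Real.pi..Real.pi, (κ + Γ * Real.cos (θ + Real.pi) * Complex.I : ℂ)⁻¹ =
      ∫ θ in -Real.pi..Real.pi, ((2 * (κ / (κ ^ 2 + Γ ^ 2 * Real.cos θ ^ 2)) : ℝ) : ℂ) := by
    have hcont' : Continuous fun θ : ℝ =>
        (κ + Γ * Real.cos (θ + Real.pi) * Complex.I : ℂ)⁻¹ :=
      hcont.comp (continuous_add_const Real.pi)
    rw [← intervalIntegral.integral_add (hcont.intervalIntegrable _ _)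
      (hcont'.intervalIntegrable _ _)]
    refine intervalIntegral.integral_congr fun θ _ => ?_
    have ha := hne θ
    have hb := hne (θ + Real.pi)
    have hc : (κ ^ 2 + Γ ^ 2 * Real.cos θ ^ 2 : ℂ) ≠ 0 := by
      exact_mod_cast (by positivity : κ ^ 2 + Γ ^ 2 * Real.cos θ ^ 2 ≠ 0)
    rw [Real.cos_add_pi] at hb ⊢
    rw [inv_add_inv ha hb, Complex.ofReal_mul, Complex.ofReal_div, Complex.ofReal_add,
      Complex.ofReal_mul, Complex.ofReal_pow, Complex.ofReal_pow, Complex.ofReal_pow]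
    have hm : (κ + Γ * Real.cos θ * Complex.I) * (κ + Γ * (-Real.cos θ : ℝ) * Complex.I) =
        (κ ^ 2 + Γ ^ 2 * Real.cos θ ^ 2 : ℂ) := by
      rw [Complex.ofReal_neg]
      linear_combination (-(Γ : ℂ) ^ 2 * Real.cos θ ^ 2) * Complex.I_sq
    rw [hm, Complex.ofReal_neg]
    push_cast
    field_simp
    ring
  rw [h1, intervalIntegral.integral_ofReal, intervalIntegral.integral_const_mul,
    integral_inv_sq_add_sq_mul_cos_sq hκ] at h2
  rw [Complex.ofReal_mul, ← two_mul] at h2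
  exact mul_left_cancel₀ two_ne_zero (by simpa using h2)

/-- The recurrence for the integrals of negative powers of `κ + i Γ cos θ` comes from the derivative
of the periodic function `i Γ sin θ / (κ + i Γ cos θ) ^ (k + 1)`. -/
lemma integral_inv_pow_add_mul_cos_recurrence {κ : ℝ} (hκ : 0 < κ) (Γ : ℝ) (k : ℕ) :
    (k + 1) * (κ ^ 2 + Γ ^ 2) *
        ∫ θ in -Real.pi..Real.pi, ((κ + Γ * Real.cos θ * Complex.I : ℂ) ^ (k + 2))⁻¹ =
      (2 * k + 1) * κ *
        (∫ θ in -Real.pi..Real.pi, ((κ + Γ * Real.cos θ * Complex.I : ℂ) ^ (k + 1))⁻¹) -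
      k * ∫ θ in -Real.pi..Real.pi, ((κ + Γ * Real.cos θ * Complex.I : ℂ) ^ k)⁻¹ := by
  have hne : ∀ θ : ℝ, (κ + Γ * Real.cos θ * Complex.I : ℂ) ≠ 0 := fun θ h => by
    have := congrArg Complex.re h
    simp at this
    exact hκ.ne' this
  have hcont : ∀ k : ℕ, IntervalIntegrable
      (fun θ : ℝ => ((κ + Γ * Real.cos θ * Complex.I : ℂ) ^ k)⁻¹) volume (-Real.pi) Real.pi :=
    fun k => Continuous.intervalIntegrable
      (Continuous.inv₀ (by fun_prop) fun θ => pow_ne_zero _ (hne θ)) _ _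
  have hder : ∀ θ ∈ uIcc (-Real.pi) Real.pi, HasDerivAt
      (fun θ : ℝ => Γ * Real.sin θ * Complex.I *
        ((κ + Γ * Real.cos θ * Complex.I : ℂ) ^ (k + 1))⁻¹)
      ((2 * k + 1) * κ * ((κ + Γ * Real.cos θ * Complex.I : ℂ) ^ (k + 1))⁻¹ -
        k * ((κ + Γ * Real.cos θ * Complex.I : ℂ) ^ k)⁻¹ -
        (k + 1) * (κ ^ 2 + Γ ^ 2) * ((κ + Γ * Real.cos θ * Complex.I : ℂ) ^ (k + 2))⁻¹) θ := by
    intro θ _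
    have hs := (((Real.hasDerivAt_sin θ).ofReal_comp).const_mul (Γ : ℂ)).mul_const Complex.I
    have hc := ((((Real.hasDerivAt_cos θ).ofReal_comp).const_mul (Γ : ℂ)).mul_const
      Complex.I).const_add (κ : ℂ)
    have := hs.mul ((hc.pow (k + 1)).inv (pow_ne_zero _ (hne θ)))
    convert! this using 1
    have h0 := hne θ
    have htrig : ((Real.sin θ : ℝ) : ℂ) ^ 2 = 1 - (Real.cos θ : ℂ) ^ 2 := by
      exact_mod_cast (by linarith [Real.sin_sq_add_cos_sq θ] :
        Real.sin θ ^ 2 = 1 - Real.cos θ ^ 2)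
    have hI := Complex.I_sq
    simp only [Pi.pow_apply, Pi.inv_apply, Nat.add_sub_cancel]
    rw [Complex.ofReal_neg]
    set A : ℂ := κ + Γ * Real.cos θ * Complex.I with hA
    have hAc : (Γ * Real.cos θ * Complex.I : ℂ) = A - κ := by rw [hA]; ring
    have hsq : (Γ * Real.sin θ * Complex.I : ℂ) ^ 2 = - (κ ^ 2 + Γ ^ 2 - 2 * κ * A + A ^ 2) := by
      rw [hA]
      linear_combination (Γ ^ 2 * Complex.I ^ 2 : ℂ) * htrig + (Γ ^ 2 : ℂ) * hI
    have hgoal : (Γ * Real.cos θ * Complex.I : ℂ) * (A ^ (k + 1))⁻¹ +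
        (k + 1) * (Γ * Real.sin θ * Complex.I : ℂ) ^ 2 * (A ^ (k + 2))⁻¹ =
        (2 * k + 1) * κ * (A ^ (k + 1))⁻¹ - k * (A ^ k)⁻¹ -
        (k + 1) * (κ ^ 2 + Γ ^ 2) * (A ^ (k + 2))⁻¹ := by
      rw [hAc, hsq]
      simp only [pow_succ]
      field_simp
      ring
    rw [← hgoal]
    simp only [pow_succ]
    push_cast
    field_simp
  have h := intervalIntegral.integral_eq_sub_of_hasDerivAt hder
    ((((hcont _).const_mul _).sub ((hcont _).const_mul _)).sub ((hcont _).const_mul _))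
  rw [intervalIntegral.integral_sub (((hcont _).const_mul _).sub ((hcont _).const_mul _))
      ((hcont _).const_mul _),
    intervalIntegral.integral_sub ((hcont _).const_mul _) ((hcont _).const_mul _),
    intervalIntegral.integral_const_mul, intervalIntegral.integral_const_mul,
    intervalIntegral.integral_const_mul] at h
  simp only [Real.sin_pi, Real.sin_neg, neg_zero, Complex.ofReal_zero, mul_zero, zero_mul,
    sub_zero] at h
  linear_combination -h

/-- The joint expansion in the form in which the polar integration produces it, with Legendre
polynomials in `κ / √(κ² + Γ²)`. -/
lemma jointApprox_eq {κ : ℝ} (hκ : 0 < κ) {g : ℕ} (hg : 1 ≤ g) (n Γ : ℝ) :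
    jointApprox κ n g Γ = ((2 * Real.pi) ^ 2)⁻¹ * (2 * Real.pi / √(κ ^ 2 + Γ ^ 2)) *
      (κ / (κ ^ 2 + Γ ^ 2) + (-1 / (4 * g) + n / (2 * g ^ 2)) * κ ^ 2 * 6 *
          (κ * (5 * κ ^ 2 - 3 * (κ ^ 2 + Γ ^ 2)) / (2 * (κ ^ 2 + Γ ^ 2) ^ 3)) -
        κ ^ 3 / (12 * g ^ 2) * 24 *
          ((35 * κ ^ 4 - 30 * κ ^ 2 * (κ ^ 2 + Γ ^ 2) + 3 * (κ ^ 2 + Γ ^ 2) ^ 2) /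
            (8 * (κ ^ 2 + Γ ^ 2) ^ 4)) +
        κ ^ 4 / (32 * g ^ 2) * 120 *
          (κ * (63 * κ ^ 4 - 70 * κ ^ 2 * (κ ^ 2 + Γ ^ 2) + 15 * (κ ^ 2 + Γ ^ 2) ^ 2) /
            (8 * (κ ^ 2 + Γ ^ 2) ^ 5))) := by
  have hg0 : (g : ℝ) ≠ 0 := by exact_mod_cast (by omega : g ≠ 0)
  have hpow : (κ ^ 2 + Γ ^ 2) ^ (3 / 2 : ℝ) = (κ ^ 2 + Γ ^ 2) * √(κ ^ 2 + Γ ^ 2) := by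
    rw [show (3 / 2 : ℝ) = 1 + 1 / 2 by norm_num, Real.rpow_add (by positivity), Real.rpow_one,
      ← Real.sqrt_eq_rpow]
  have hq : √(κ ^ 2 + Γ ^ 2) ≠ 0 := by positivity
  unfold jointApprox H₁ H₂
  rw [hpow]
  generalize √(κ ^ 2 + Γ ^ 2) = q at *
  field_simp
  ring

/-- In the plane, the Fourier transform of the approximation is the joint expansion. -/
theorem fourier_charApprox_complex {κ n : ℝ} (hκ : 0 < κ) {g : ℕ} (hg : 1 ≤ g) (hn : 0 ≤ n)
    (z : ℂ) : 𝓕 (fun t : ℂ => (charApprox n g (2 * Real.pi * κ * ‖t‖) : ℂ)) z =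
      (jointApprox κ n g ‖z‖ : ℝ) := by
  have hc : 0 < 2 * Real.pi * κ := by positivity
  have hint := integrable_charApprox (E := ℂ) (by simp) hc hg hn
  set Γ := ‖z‖ with hΓ
  set F : ℝ × ℝ → ℂ := fun p => (p.1 : ℂ) * (charApprox n g (2 * Real.pi * κ * p.1) *
    Complex.exp (-(2 * Real.pi * ((Γ * Real.cos (p.2 - z.arg) : ℝ) * Complex.I) * p.1))) with hF
  have hae : ∀ᵐ p : ℝ × ℝ ∂(volume.restrict (Ioi (0 : ℝ))).prod
      (volume.restrict (Ioo (-Real.pi) Real.pi)), 0 < p.1 := by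
    rw [Measure.prod_restrict]
    filter_upwards [ae_restrict_mem (measurableSet_Ioi.prod measurableSet_Ioo)] with p hp
    exact hp.1
  have hFint : Integrable F ((volume.restrict (Ioi (0 : ℝ))).prod
      (volume.restrict (Ioo (-Real.pi) Real.pi))) := by
    have h1 := ((integrable_inv_one_add_mul_norm_pow_three (E := ℝ) (by simp) hc).const_mul
      ((6 + n) * 28 ^ 14 / (2 * Real.pi * κ))).restrict (s := Ioi (0 : ℝ))
    have h2 := h1.mul_prod (integrable_const (1 : ℝ)
      (μ := volume.restrict (Ioo (-Real.pi) Real.pi)))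
    have hcont := continuous_charApprox n g
    refine h2.mono' (by fun_prop) (hae.mono fun p hp => ?_)
    have hexp : ‖Complex.exp (-(2 * Real.pi * ((Γ * Real.cos (p.2 - z.arg) : ℝ) * Complex.I) *
        p.1))‖ = 1 := by
      rw [show -(2 * Real.pi * ((Γ * Real.cos (p.2 - z.arg) : ℝ) * Complex.I) * p.1 : ℂ) =
        ((-(2 * Real.pi * (Γ * Real.cos (p.2 - z.arg)) * p.1) : ℝ) : ℂ) * Complex.I by
        push_cast; ring]
      exact Complex.norm_exp_ofReal_mul_I _
    have hb := abs_charApprox_mul_pow_le (k := 4) hg hn (T := 2 * Real.pi * κ * p.1)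
      (by positivity) (by norm_num)
    simp only [hF, mul_one]
    rw [norm_mul, norm_mul, hexp, mul_one, Complex.norm_real, Complex.norm_real,
      Real.norm_of_nonneg hp.le, Real.norm_eq_abs, ← div_eq_mul_inv, le_div_iff₀ (by positivity),
      le_div_iff₀ hc]
    refine le_trans ?_ hb
    calc p.1 * |charApprox n g (2 * Real.pi * κ * p.1)| * (1 + 2 * Real.pi * κ * p.1) ^ 3 *
          (2 * Real.pi * κ)
        = |charApprox n g (2 * Real.pi * κ * p.1)| * ((2 * Real.pi * κ * p.1) *
          (1 + 2 * Real.pi * κ * p.1) ^ 3) := by ring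
      _ ≤ |charApprox n g (2 * Real.pi * κ * p.1)| * ((1 + 2 * Real.pi * κ * p.1) *
          (1 + 2 * Real.pi * κ * p.1) ^ 3) := by gcongr; linarith
      _ = |charApprox n g (2 * Real.pi * κ * p.1)| * (1 + 2 * Real.pi * κ * p.1) ^ 4 := by ring
  have hpolar : 𝓕 (fun t : ℂ => (charApprox n g (2 * Real.pi * κ * ‖t‖) : ℂ)) z =
      ∫ θ in -Real.pi..Real.pi, ∫ r in Ioi (0 : ℝ), F (r, θ) := by
    rw [Real.fourier_eq', ← Complex.integral_comp_polarCoord_symm, polarCoord_target,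
      intervalIntegral.integral_of_le (by linarith [Real.pi_pos]), integral_Ioc_eq_integral_Ioo,
      Measure.volume_eq_prod, ← Measure.prod_restrict, ← integral_prod_symm _ hFint]
    refine integral_congr_ae (hae.mono fun p hp => ?_)
    have hnorm : ‖Complex.polarCoord.symm p‖ = p.1 := by
      rw [Complex.norm_polarCoord_symm, abs_of_pos hp]
    have hinner : ⟪Complex.polarCoord.symm p, z⟫ = p.1 * (Γ * Real.cos (p.2 - z.arg)) := by
      rw [Complex.polarCoord_symm_apply, Complex.inner, Real.cos_sub,
        show Γ * (Real.cos p.2 * Real.cos z.arg + Real.sin p.2 * Real.sin z.arg) =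
          Real.cos p.2 * (Γ * Real.cos z.arg) + Real.sin p.2 * (Γ * Real.sin z.arg) by ring,
        Complex.norm_mul_cos_arg, Complex.norm_mul_sin_arg]
      simp only [Complex.mul_re, map_add, map_mul, Complex.conj_ofReal, Complex.conj_I,
        Complex.add_re, Complex.add_im, Complex.mul_im, Complex.ofReal_re, Complex.ofReal_im,
        Complex.neg_re, Complex.neg_im, Complex.I_re, Complex.I_im]
      ring
    simp only [hF]
    rw [hnorm, hinner, Complex.real_smul, smul_eq_mul, mul_comm (Complex.exp _)]
    congr 3
    push_cast
    ring
  rw [hpolar]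
  simp only [hF]
  have hrad := fun θ : ℝ =>
    integral_pow_mul_charApprox_mul_cexp hκ n g 1 (Γ * Real.cos (θ - z.arg))
  simp only [pow_one] at hrad
  simp_rw [hrad]
  set G : ℝ → ℂ := fun θ => ((2 * Real.pi : ℂ) ^ (1 + 1))⁻¹ * ((Nat.factorial 1) *
        ((κ + (Γ * Real.cos θ : ℝ) * Complex.I) ^ (1 + 1))⁻¹ +
        (-1 / (4 * g) + n / (2 * g ^ 2)) * κ ^ 2 * (1 + 2).factorial *
          ((κ + (Γ * Real.cos θ : ℝ) * Complex.I) ^ (1 + 3))⁻¹ -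
        κ ^ 3 / (12 * g ^ 2) * (1 + 3).factorial *
          ((κ + (Γ * Real.cos θ : ℝ) * Complex.I) ^ (1 + 4))⁻¹ +
        κ ^ 4 / (32 * g ^ 2) * (1 + 4).factorial *
          ((κ + (Γ * Real.cos θ : ℝ) * Complex.I) ^ (1 + 5))⁻¹) with hG
  have hGper : Function.Periodic G (2 * Real.pi) := fun θ => by
    simp only [hG, Real.cos_add_two_pi]
  have hshift := integral_shift_of_periodic hGper (-z.arg)
  simp only [← sub_eq_add_neg, hG] at hshift
  rw [hshift]
  have hne : ∀ θ : ℝ, (κ + Γ * Real.cos θ * Complex.I : ℂ) ≠ 0 := fun θ h => by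
    have := congrArg Complex.re h
    simp at this
    exact hκ.ne' this
  have hcont : ∀ k : ℕ, IntervalIntegrable
      (fun θ : ℝ => ((κ + Γ * Real.cos θ * Complex.I : ℂ) ^ k)⁻¹) volume (-Real.pi) Real.pi :=
    fun k => Continuous.intervalIntegrable
      (Continuous.inv₀ (by fun_prop) fun θ => pow_ne_zero _ (hne θ)) _ _
  have r1 := integral_inv_add_mul_cos hκ Γ
  have hrec := integral_inv_pow_add_mul_cos_recurrence hκ Γ
  simp only [Complex.ofReal_mul, intervalIntegral.integral_const_mul]
  rw [intervalIntegral.integral_add ((((hcont _).const_mul _).add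
      ((hcont _).const_mul _)).sub ((hcont _).const_mul _)) ((hcont _).const_mul _),
    intervalIntegral.integral_sub (((hcont _).const_mul _).add
      ((hcont _).const_mul _)) ((hcont _).const_mul _),
    intervalIntegral.integral_add ((hcont _).const_mul _) ((hcont _).const_mul _),
    intervalIntegral.integral_const_mul, intervalIntegral.integral_const_mul,
    intervalIntegral.integral_const_mul, intervalIntegral.integral_const_mul]
  obtain ⟨J, hJ⟩ : ∃ J : ℕ → ℂ, ∀ k, ∫ θ in -Real.pi..Real.pi,
      ((κ + Γ * Real.cos θ * Complex.I : ℂ) ^ k)⁻¹ = J k := ⟨_, fun _ => rfl⟩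
  have hJ1 : J 1 = ((2 * Real.pi / √(κ ^ 2 + Γ ^ 2) : ℝ) : ℂ) := by
    rw [← hJ 1, ← r1]; simp only [pow_one]
  simp only [hJ] at hrec ⊢
  rw [jointApprox_eq hκ hg]
  have hS : (κ ^ 2 + Γ ^ 2 : ℂ) ≠ 0 := by exact_mod_cast (by positivity : κ ^ 2 + Γ ^ 2 ≠ 0)
  have r2 := hrec 0
  have r3 := hrec 1
  have r4 := hrec 2
  have r5 := hrec 3
  have r6 := hrec 4
  norm_num at r2 r3 r4 r5 r6
  set S : ℂ := κ ^ 2 + Γ ^ 2 with hSdef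
  -- The values are Legendre polynomials in `κ / √S`, up to a power of `S`.
  have j2 : J 2 = J 1 * (κ / S) := by
    field_simp; linear_combination r2
  have j3 : J 3 = J 1 * ((3 * κ ^ 2 - S) / (2 * S ^ 2)) := by
    rw [j2] at r3; field_simp at r3 ⊢; linear_combination r3
  have j4 : J 4 = J 1 * (κ * (5 * κ ^ 2 - 3 * S) / (2 * S ^ 3)) := by
    rw [j2, j3] at r4; field_simp at r4 ⊢; linear_combination r4 / 3
  have j5 : J 5 = J 1 * ((35 * κ ^ 4 - 30 * κ ^ 2 * S + 3 * S ^ 2) / (8 * S ^ 4)) := by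
    rw [j3, j4] at r5; field_simp at r5 ⊢; linear_combination r5
  have j6 : J 6 = J 1 * (κ * (63 * κ ^ 4 - 70 * κ ^ 2 * S + 15 * S ^ 2) / (8 * S ^ 5)) := by
    rw [j4, j5] at r6; field_simp at r6 ⊢; linear_combination r6 / 10
  norm_num [Nat.factorial]
  rw [j2, j4, j5, j6, hJ1]
  push_cast
  rw [← hSdef]
  ring

end ExplicitTransforms

/-! ### Measures under changes of variables -/

section Transfer

open Set

variable {α β : Type*} [MeasurableSpace α] [MeasurableSpace β]

lemma map_cond_preimage_of_map_eq_smul {μ : Measure α} {ν : Measure β} {φ : α → β}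
    (hφ : Measurable φ) {c : ENNReal} (hc0 : c ≠ 0) (hc : c ≠ ⊤) (h : μ.map φ = c • ν) {s : Set β}
    (hs : MeasurableSet s) : (cond μ (φ ⁻¹' s)).map φ = cond ν s := by
  have hμs : μ (φ ⁻¹' s) = c * ν s := by
    rw [← Measure.map_apply hφ hs, h, Measure.smul_apply, smul_eq_mul]
  rw [ProbabilityTheory.cond, ProbabilityTheory.cond, Measure.map_smul,
    ← Measure.restrict_map hφ hs, h, hμs, Measure.restrict_smul, smul_smul,
    ENNReal.mul_inv (Or.inl hc0) (Or.inl hc), mul_right_comm, ENNReal.inv_mul_cancel hc0 hc,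
    one_mul]

lemma map_withDensity_of_measurePreserving {μ : Measure α} {ν : Measure β} (e : α ≃ᵐ β)
    (he : MeasurePreserving e μ ν) (F : α → ENNReal) :
    (μ.withDensity F).map e = ν.withDensity (F ∘ e.symm) := by
  ext s hs
  rw [Measure.map_apply e.measurable hs, withDensity_apply _ (e.measurable hs),
    withDensity_apply _ hs, ← he.setLIntegral_comp_preimage_emb e.measurableEmbedding]
  simp

/-- A density of the first marginal is almost everywhere the integral of the joint density. -/
lemma ae_eq_integral_of_map_fst_eq {f : ℝ × ℝ → ℝ} (hf : Measurable f) (hf0 : ∀ p, 0 ≤ f p)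
    {f₁ : ℝ → ℝ} (hf₁ : Measurable f₁) (hf₁0 : ∀ z, 0 ≤ f₁ z)
    (h : (volume.withDensity fun p => ENNReal.ofReal (f p)).map Prod.fst =
      volume.withDensity fun z => ENNReal.ofReal (f₁ z)) :
    ∀ᵐ z : ℝ, f₁ z = ∫ w : ℝ, f (z, w) := by
  have h' : (volume.withDensity fun z : ℝ => ∫⁻ w : ℝ, ENNReal.ofReal (f (z, w))) =
      volume.withDensity fun z => ENNReal.ofReal (f₁ z) := by
    rw [← h]
    ext s hs
    rw [Measure.map_apply measurable_fst hs, withDensity_apply _ hs,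
      withDensity_apply _ (measurable_fst hs), ← prod_univ, Measure.volume_eq_prod,
      setLIntegral_prod _ hf.ennreal_ofReal.aemeasurable]
    simp
  rw [withDensity_eq_iff_of_sigmaFinite
    hf.ennreal_ofReal.lintegral_prod_right'.aemeasurable hf₁.ennreal_ofReal.aemeasurable] at h'
  filter_upwards [h'] with z hz
  rw [integral_eq_lintegral_of_nonneg_ae (ae_of_all _ fun w => hf0 _)
    (hf.comp measurable_prodMk_left).aestronglyMeasurable, hz, ENNReal.toReal_ofReal (hf₁0 z)]

end Transfer

/-! ### The total shear -/

section TotalShear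

open Set
open scoped RealInnerProductSpace FourierTransform

/-- The position of a star relative to the point `x`, in units of the radius `R` of the disk, as a
complex number. -/
noncomputable def relativePosition (x : ℝ × ℝ) (R : ℝ) (p : ℝ × ℝ) : ℂ :=
  R⁻¹ • (Complex.measurableEquivRealProd.symm p - Complex.measurableEquivRealProd.symm x)

/-- The two components of the shear as one complex number. -/
noncomputable def complexShear (m : ℝ) (x : ℝ × ℝ) {g : ℕ} (p : Fin g → ℝ × ℝ) : ℂ :=
  Complex.measurableEquivRealProd.symm (shear₁ m x p, shear₂ m x p)

lemma measurable_relativePosition (x : ℝ × ℝ) (R : ℝ) : Measurable (relativePosition x R) := by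
  unfold relativePosition
  exact (measurable_const_smul R⁻¹).comp
    (Complex.measurableEquivRealProd.symm.measurable.sub_const _)

lemma map_relativePosition_volume (x : ℝ × ℝ) {R : ℝ} (hR : 0 < R) :
    (volume : Measure (ℝ × ℝ)).map (relativePosition x R) =
      ENNReal.ofReal (R ^ 2) • (volume : Measure ℂ) := by
  have h1 := Complex.volume_preserving_equiv_real_prod.symm.map_eq
  have h2 := (measurePreserving_sub_right (volume : Measure ℂ)
    (Complex.measurableEquivRealProd.symm x)).map_eq
  have h3 := Measure.map_addHaar_smul (volume : Measure ℂ) (inv_ne_zero hR.ne')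
  rw [show relativePosition x R = (fun w : ℂ => R⁻¹ • w) ∘
    ((fun w => w - Complex.measurableEquivRealProd.symm x) ∘
      Complex.measurableEquivRealProd.symm) from rfl,
    ← Measure.map_map (by fun_prop) (by fun_prop), ← Measure.map_map (by fun_prop) (by fun_prop),
    h1, h2, h3, Complex.finrank_real_complex, inv_pow, inv_inv, abs_of_pos (by positivity)]

lemma disk_eq_preimage (x : ℝ × ℝ) {R : ℝ} (hR : 0 < R) :
    disk R = relativePosition x R ⁻¹'
      shiftedDisk (R⁻¹ • Complex.measurableEquivRealProd.symm x) := by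
  ext p
  rw [mem_preimage, shiftedDisk, mem_ofPred_eq, relativePosition, smul_sub, sub_add_cancel,
    norm_smul, Real.norm_of_nonneg (by positivity), inv_mul_le_iff₀ hR, mul_one,
    ← sq_le_sq₀ (norm_nonneg _) hR.le, ← Complex.normSq_eq_norm_sq, Complex.normSq_apply, disk,
    mem_ofPred_eq]
  simp [sq]

lemma complexShear_eq_sum (m : ℝ) (x : ℝ × ℝ) {R : ℝ} (hR : 0 < R) {g : ℕ} (p : Fin g → ℝ × ℝ) :
    complexShear m x p = ∑ j, (m / R ^ 2) • shearKernel (relativePosition x R (p j)) := by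
  have hterm : ∀ q : ℝ × ℝ, (m / R ^ 2) • shearKernel (relativePosition x R q) =
      m • shearKernel
        (Complex.measurableEquivRealProd.symm q - Complex.measurableEquivRealProd.symm x) := by
    intro q
    rw [relativePosition, Complex.real_smul (x := R⁻¹), shearKernel_real_mul, ← Complex.real_smul,
      smul_smul, inv_pow, inv_inv, div_mul_cancel₀ _ (by positivity)]
  have hk : ∀ a b : ℝ, shearKernel (Complex.mk a b) =
      Complex.mk ((a ^ 2 - b ^ 2) / (a ^ 2 + b ^ 2) ^ 2) (2 * a * b / (a ^ 2 + b ^ 2) ^ 2) := by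
    intro a b
    rw [shearKernel, Complex.normSq_mk, ← Complex.ofReal_pow]
    apply Complex.ext
    · rw [Complex.div_ofReal_re]; simp [sq]
    · rw [Complex.div_ofReal_im]; simp [sq]; ring
  have hmk : ∀ q : ℝ × ℝ,
      Complex.measurableEquivRealProd.symm q - Complex.measurableEquivRealProd.symm x =
        Complex.mk (q.1 - x.1) (q.2 - x.2) := fun q => rfl
  simp_rw [hterm, hmk, hk]
  apply Complex.ext
  · simp only [complexShear, shear₁, Complex.measurableEquivRealProd_symm_apply, Complex.re_sum,
      Complex.smul_re, smul_eq_mul]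
    exact Finset.sum_congr rfl fun j _ => by ring
  · simp only [complexShear, shear₂, Complex.measurableEquivRealProd_symm_apply, Complex.im_sum,
      Complex.smul_im, smul_eq_mul]
    exact Finset.sum_congr rfl fun j _ => by ring

variable {Ω : Type*} [MeasurableSpace Ω] {P : Measure Ω} {g : ℕ} {ξ : Fin g → Ω → ℝ × ℝ}

lemma volume_disk_ne {R : ℝ} (hR : 0 < R) :
    volume (disk R) ≠ 0 ∧ volume (disk R) ≠ ⊤ := by
  rw [disk_eq_preimage 0 hR, ← Measure.map_apply (measurable_relativePosition 0 R)
    (measurableSet_shiftedDisk _), map_relativePosition_volume 0 hR, Measure.smul_apply,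
    volume_shiftedDisk, smul_eq_mul, ← ENNReal.ofReal_mul (by positivity)]
  refine ⟨?_, ENNReal.ofReal_ne_top⟩
  rw [ne_eq, ENNReal.ofReal_eq_zero, not_le]
  positivity

lemma aemeasurable_of_isUniform_disk {R : ℝ} (hR : 0 < R)
    {η : Ω → ℝ × ℝ} (h : pdf.IsUniform η (disk R) P volume) : AEMeasurable η P :=
  pdf.IsUniform.aemeasurable (volume_disk_ne hR).1 (volume_disk_ne hR).2 h

lemma map_shearKernel_relativePosition {R : ℝ} (hR : 0 < R) (x : ℝ × ℝ)
    {η : Ω → ℝ × ℝ} (h : pdf.IsUniform η (disk R) P volume) :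
    P.map (fun ω => shearKernel (relativePosition x R (η ω))) =
      starLaw (R⁻¹ • Complex.measurableEquivRealProd.symm x) := by
  have hpos := measurable_relativePosition x R
  rw [show (fun ω => shearKernel (relativePosition x R (η ω))) =
    (shearKernel ∘ relativePosition x R) ∘ η from rfl,
    ← AEMeasurable.map_map_of_aemeasurable
      (measurable_shearKernel.comp hpos).aemeasurable (aemeasurable_of_isUniform_disk hR h),
    show P.map η = cond volume (disk R) from h, ← Measure.map_map measurable_shearKernel hpos,
    disk_eq_preimage x hR, map_cond_preimage_of_map_eq_smul hpos (by simpa using hR.ne')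
      ENNReal.ofReal_ne_top (map_relativePosition_volume x hR) (measurableSet_shiftedDisk _),
    starLaw]

lemma aemeasurable_complexShear (m : ℝ) (x : ℝ × ℝ) {R : ℝ} (hR : 0 < R)
    (h : ∀ j, pdf.IsUniform (ξ j) (disk R) P volume) :
    AEMeasurable (fun ω => complexShear m x fun j => ξ j ω) P := by
  simp_rw [complexShear_eq_sum m x hR]
  refine Finset.aemeasurable_fun_sum _ fun j _ => ?_
  exact ((measurable_const_smul (m / R ^ 2)).comp (measurable_shearKernel.comp
    (measurable_relativePosition x R))).comp_aemeasurable (aemeasurable_of_isUniform_disk hR (h j))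

/-- By independence, the characteristic function of the total shear is a power. -/
lemma charFun_complexShear [IsProbabilityMeasure P] (m : ℝ) (x : ℝ × ℝ) {R : ℝ} (hR : 0 < R)
    (hξ : iIndepFun ξ P) (h : ∀ j, pdf.IsUniform (ξ j) (disk R) P volume) (t : ℂ) :
    charFun (P.map fun ω => complexShear m x fun j => ξ j ω) t =
      charFun (starLaw (R⁻¹ • Complex.measurableEquivRealProd.symm x)) ((m / R ^ 2) • t) ^ g := by
  have hmeas : Measurable fun q => (m / R ^ 2) • shearKernel (relativePosition x R q) :=
    (measurable_const_smul (m / R ^ 2)).comp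
      (measurable_shearKernel.comp (measurable_relativePosition x R))
  have hind := hξ.comp (fun _ q => (m / R ^ 2) • shearKernel (relativePosition x R q))
    fun _ => hmeas
  simp_rw [complexShear_eq_sum m x hR]
  have := hind.charFun_map_fun_sum_eq_prod
    fun j => hmeas.comp_aemeasurable (aemeasurable_of_isUniform_disk hR (h j))
  simp only [Function.comp_def] at this
  rw [this, Finset.prod_apply]
  have hj : ∀ j, charFun (P.map fun ω => (m / R ^ 2) • shearKernel
      (relativePosition x R (ξ j ω))) t =
      charFun (starLaw (R⁻¹ • Complex.measurableEquivRealProd.symm x)) ((m / R ^ 2) • t) := by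
    intro j
    rw [← map_shearKernel_relativePosition hR x (h j)]
    exact charFun_map_smul_comp ((measurable_shearKernel.comp
      (measurable_relativePosition x R)).comp_aemeasurable
      (aemeasurable_of_isUniform_disk hR (h j))) _ _
  rw [Finset.prod_congr rfl fun j _ => hj j, Finset.prod_const, Finset.card_univ,
    Fintype.card_fin]

/-- A law on the line or the plane whose characteristic function is close to the approximation has
a characteristic function that is integrable. -/
lemma integrable_scaledCharFun_of_norm_sub_le {E : Type*} [NormedAddCommGroup E]
    [InnerProductSpace ℝ E] [FiniteDimensional ℝ E] [MeasurableSpace E] [BorelSpace E]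
    (hE : Module.finrank ℝ E < 3) {μ : Measure E} [IsProbabilityMeasure μ] {c n B : ℝ} (hc : 0 < c)
    (hg : 1 ≤ g) (hn : 0 ≤ n)
    (h : ∀ t, ‖scaledCharFun μ t - charApprox n g (c * ‖t‖)‖ ≤ B * ((1 + c * ‖t‖) ^ 3)⁻¹) :
    Integrable (scaledCharFun μ) := by
  have h1 : Integrable (fun t => scaledCharFun μ t - charApprox n g (c * ‖t‖)) := by
    have hcont := continuous_charApprox n g
    have hcont' := continuous_scaledCharFun μ
    exact ((integrable_inv_one_add_mul_norm_pow_three hE hc).const_mul B).mono' (by fun_prop)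
      (ae_of_all _ h)
  refine (h1.add (integrable_charApprox hE hc hg hn)).congr (ae_of_all _ fun t => ?_)
  simp

/-- For a component of a complex random variable, the characteristic function is the restriction of
the joint one to an axis. -/
lemma charFun_map_of_inner_eq {μ : Measure ℂ} (L : ℂ → ℝ) (hL : Measurable L) (e : ℂ)
    (h : ∀ (w : ℂ) (t : ℝ), ⟪w, t • e⟫ = ⟪L w, t⟫) (t : ℝ) :
    charFun (μ.map L) t = charFun μ (t • e) := by
  rw [charFun_apply, charFun_apply, integral_map hL.aemeasurable (by fun_prop)]
  simp_rw [h]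

/-- The error bound for the characteristic function of the total shear, in physical units. -/
lemma exists_norm_scaledCharFun_complexShear_sub_le {m κ : ℝ} (hm : 0 < m) (hκ : 0 < κ)
    (x : ℝ × ℝ) : ∃ C : ℝ, 0 ≤ C ∧ ∃ N : ℕ, 1 ≤ N ∧ ∀ g : ℕ, N ≤ g → ∀ R : ℝ, 0 < R →
      κ = m * g / R ^ 2 → ∀ (Ω : Type*) [MeasurableSpace Ω] (P : Measure Ω)
        [IsProbabilityMeasure P] (ξ : Fin g → Ω → ℝ × ℝ), iIndepFun ξ P →
        (∀ j, pdf.IsUniform (ξ j) (disk R) P volume) → ∀ t : ℂ,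
        ‖scaledCharFun (P.map fun ω => complexShear m x fun j => ξ j ω) t -
            charApprox (κ * planeNorm x ^ 2 / m) g (2 * Real.pi * κ * ‖t‖)‖ ≤
          C / (g : ℝ) ^ 3 * ((1 + 2 * Real.pi * κ * ‖t‖) ^ 3)⁻¹ := by
  obtain ⟨C, hC, N, hN, h⟩ := exists_norm_charFun_starLaw_pow_sub_le
    (n := κ * planeNorm x ^ 2 / m) (by positivity)
  refine ⟨C, hC, N, hN, fun g hg R hR hκR Ω _ P _ ξ hξ hunif t => ?_⟩
  have hg0 : (0 : ℝ) < g := by exact_mod_cast (by omega : 0 < g)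
  have hy : Complex.normSq (R⁻¹ • Complex.measurableEquivRealProd.symm x) =
      κ * planeNorm x ^ 2 / m / g := by
    rw [Complex.real_smul, Complex.normSq_mul, Complex.normSq_ofReal, Complex.normSq_apply,
      planeNorm, Real.sq_sqrt (by positivity), hκR]
    simp
    field_simp
  have hs : g * ‖(m / R ^ 2) • ((2 * Real.pi) • t)‖ = 2 * Real.pi * κ * ‖t‖ := by
    rw [norm_smul, norm_smul, Real.norm_of_nonneg (by positivity),
      Real.norm_of_nonneg (by positivity), hκR]
    ring
  have := h g hg _ hy ((m / R ^ 2) • ((2 * Real.pi) • t))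
  rwa [hs, ← charFun_complexShear m x hR hξ hunif] at this

end TotalShear

theorem theorem1 (m κ : ℝ) (hm : 0 < m) (hκ : 0 < κ) (x : ℝ × ℝ) :
    ∃ C : ℝ, ∃ N : ℕ, ∀ g : ℕ, N ≤ g → ∀ R : ℝ, 0 < R → planeNorm x < R → κ = m * g / R ^ 2 →
      ∀ (Ω : Type*) [MeasurableSpace Ω] (P : Measure Ω) [IsProbabilityMeasure P]
        (ξ : Fin g → Ω → ℝ × ℝ),
        iIndepFun ξ P → (∀ j, pdf.IsUniform (ξ j) (disk R) P volume) →
        ∃ (f : ℝ × ℝ → ℝ) (f₁ f₂ : ℝ → ℝ),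
          IsContinuousDensity
            (P.map (fun ω => (shear₁ m x (fun j => ξ j ω), shear₂ m x (fun j => ξ j ω)))) f ∧
          (∀ z w : ℝ,
            |f (z, w) - jointApprox κ (κ * planeNorm x ^ 2 / m) g (Real.sqrt (z ^ 2 + w ^ 2))|
              ≤ C / (g : ℝ) ^ 3) ∧
          IsContinuousDensity (P.map (fun ω => shear₁ m x (fun j => ξ j ω))) f₁ ∧
          (∀ᵐ z : ℝ, f₁ z = ∫ w : ℝ, f (z, w)) ∧
          (∀ z : ℝ,
            |f₁ z - marginalApprox κ (κ * planeNorm x ^ 2 / m) g z| ≤ C / (g : ℝ) ^ 3) ∧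
          IsContinuousDensity (P.map (fun ω => shear₂ m x (fun j => ξ j ω))) f₂ ∧
          (∀ᵐ w : ℝ, f₂ w = ∫ z : ℝ, f (z, w)) ∧
          (∀ w : ℝ,
            |f₂ w - marginalApprox κ (κ * planeNorm x ^ 2 / m) g w| ≤ C / (g : ℝ) ^ 3) := by
  obtain ⟨C, hC, N, hN, h⟩ := exists_norm_scaledCharFun_complexShear_sub_le hm hκ x
  have hc : 0 < 2 * Real.pi * κ := by positivity
  set n := κ * planeNorm x ^ 2 / m with hn_def
  have hn : 0 ≤ n := by positivity
  have hfC : Module.finrank ℝ ℂ < 3 := by simp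
  have hfR : Module.finrank ℝ ℝ < 3 := by simp
  set IC : ℝ := ∫ t : ℂ, ((1 + 2 * Real.pi * κ * ‖t‖) ^ 3)⁻¹ with hIC
  set IR : ℝ := ∫ t : ℝ, ((1 + 2 * Real.pi * κ * ‖t‖) ^ 3)⁻¹ with hIR
  refine ⟨C * max IC IR, N, fun g hg R hR _ hκR Ω _ P _ ξ hξ hunif => ?_⟩
  have hg1 : 1 ≤ g := hN.trans hg
  set e := Complex.measurableEquivRealProd with he
  have hmeas := aemeasurable_complexShear m x hR hunif
  set μ := P.map fun ω => complexShear m x fun j => ξ j ω with hμ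
  have : IsProbabilityMeasure μ := Measure.isProbabilityMeasure_map hmeas
  have hb := h g hg R hR hκR Ω P ξ hξ hunif
  rw [← hμ] at hb
  have hi := integrable_scaledCharFun_of_norm_sub_le hfC hc hg1 hn hb
  -- The joint law
  have hjoint : P.map (fun ω => (shear₁ m x (fun j => ξ j ω), shear₂ m x (fun j => ξ j ω))) =
      μ.map e := by
    rw [hμ, AEMeasurable.map_map_of_aemeasurable e.measurable.aemeasurable hmeas]
    rfl
  have hdens : μ.map e =
      volume.withDensity fun p => ENNReal.ofReal (charFunDensity μ (e.symm p)) := by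
    conv_lhs => rw [eq_withDensity_charFunDensity hi]
    exact map_withDensity_of_measurePreserving e Complex.volume_preserving_equiv_real_prod _
  have hcont : Continuous fun p : ℝ × ℝ => charFunDensity μ (e.symm p) :=
    (continuous_charFunDensity hi).comp Complex.equivRealProdCLM.symm.continuous
  have hnonneg : ∀ p : ℝ × ℝ, 0 ≤ charFunDensity μ (e.symm p) :=
    fun p => charFunDensity_nonneg hi _
  -- The laws of the components
  have hcomp : ∀ (L : ℂ → ℝ) (_ : Measurable L) (v : ℂ) (_ : ‖v‖ = 1)
      (_ : ∀ (w : ℂ) (t : ℝ), inner ℝ w (t • v) = inner ℝ (L w) t),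
      Continuous (charFunDensity (μ.map L)) ∧ (∀ z, 0 ≤ charFunDensity (μ.map L) z) ∧
      μ.map L = volume.withDensity (fun z => ENNReal.ofReal (charFunDensity (μ.map L) z)) ∧
      ∀ z, |charFunDensity (μ.map L) z - marginalApprox κ n g z| ≤
        C * max IC IR / (g : ℝ) ^ 3 := by
    intro L hL v hv hLv
    have : IsProbabilityMeasure (μ.map L) := Measure.isProbabilityMeasure_map hL.aemeasurable
    have hbL : ∀ t : ℝ, ‖scaledCharFun (μ.map L) t - charApprox n g (2 * Real.pi * κ * ‖t‖)‖ ≤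
        C / (g : ℝ) ^ 3 * ((1 + 2 * Real.pi * κ * ‖t‖) ^ 3)⁻¹ := by
      intro t
      have := hb (t • v)
      rwa [norm_smul, hv, mul_one, scaledCharFun, smul_smul, ← smul_eq_mul,
        ← charFun_map_of_inner_eq L hL v hLv] at this
    have hiL := integrable_scaledCharFun_of_norm_sub_le hfR hc hg1 hn hbL
    refine ⟨continuous_charFunDensity hiL, charFunDensity_nonneg hiL,
      eq_withDensity_charFunDensity hiL, fun z => ?_⟩
    refine (abs_charFunDensity_sub_le hiL (integrable_charApprox hfR hc hg1 hn)
      ((integrable_inv_one_add_mul_norm_pow_three hfR hc).const_mul _) hbL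
      (fourier_charApprox_real hκ hg1 hn z)).trans ?_
    rw [integral_const_mul, ← hIR, div_mul_eq_mul_div]
    gcongr
    exact le_max_right _ _
  obtain ⟨hc₁, hn₁, hd₁, hb₁⟩ := hcomp Complex.re Complex.measurable_re 1 (by simp)
    (fun w t => by simp [Complex.inner])
  obtain ⟨hc₂, hn₂, hd₂, hb₂⟩ := hcomp Complex.im Complex.measurable_im Complex.I (by simp)
    (fun w t => by simp [Complex.inner])
  have hm₁ : P.map (fun ω => shear₁ m x (fun j => ξ j ω)) = μ.map Complex.re := by
    rw [hμ, AEMeasurable.map_map_of_aemeasurable Complex.measurable_re.aemeasurable hmeas]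
    rfl
  have hm₂ : P.map (fun ω => shear₂ m x (fun j => ξ j ω)) = μ.map Complex.im := by
    rw [hμ, AEMeasurable.map_map_of_aemeasurable Complex.measurable_im.aemeasurable hmeas]
    rfl
  refine ⟨fun p => charFunDensity μ (e.symm p), charFunDensity (μ.map Complex.re),
    charFunDensity (μ.map Complex.im), ⟨hcont, hnonneg, hjoint.trans hdens⟩, fun z w => ?_,
    ⟨hc₁, hn₁, hm₁.trans hd₁⟩, ?_, hb₁, ⟨hc₂, hn₂, hm₂.trans hd₂⟩, ?_, hb₂⟩
  · have hnorm : Real.sqrt (z ^ 2 + w ^ 2) = ‖e.symm (z, w)‖ := by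
      rw [Complex.norm_def, Complex.normSq_apply]
      simp [he, sq]
    rw [hnorm]
    refine (abs_charFunDensity_sub_le hi (integrable_charApprox hfC hc hg1 hn)
      ((integrable_inv_one_add_mul_norm_pow_three hfC hc).const_mul _) hb
      (fourier_charApprox_complex hκ hg1 hn _)).trans ?_
    rw [integral_const_mul, ← hIC, div_mul_eq_mul_div]
    gcongr
    exact le_max_left _ _
  · refine ae_eq_integral_of_map_fst_eq hcont.measurable hnonneg hc₁.measurable hn₁ ?_
    rw [← hdens, ← hd₁, Measure.map_map measurable_fst e.measurable]
    rfl
  · refine ae_eq_integral_of_map_fst_eq (f := fun p => charFunDensity μ (e.symm p.swap))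
      (hcont.comp continuous_swap).measurable (fun p => hnonneg _) hc₂.measurable hn₂ ?_
    have hswap := map_withDensity_of_measurePreserving MeasurableEquiv.prodComm
      (Measure.measurePreserving_swap (μ := (volume : Measure ℝ)) (ν := (volume : Measure ℝ)))
      fun p => ENNReal.ofReal (charFunDensity μ (e.symm p))
    change _ = volume.withDensity fun p : ℝ × ℝ =>
      ENNReal.ofReal (charFunDensity μ (e.symm p.swap)) at hswap
    rw [← hswap, ← Measure.volume_eq_prod, ← hdens, ← hd₂,
      Measure.map_map MeasurableEquiv.prodComm.measurable e.measurable,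
      Measure.map_map measurable_fst (MeasurableEquiv.prodComm.measurable.comp e.measurable)]
    rfl
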